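/- Let $n>1$, let $t_1,\dots,t_n\in\mathbb{C}\setminus\{0,1\}$ be pairwise distinct and let $s,k_1,\dots,k_{n+2}\in\mathbb{C}$. Write $\tau_1=1$, $\tau_{i+1}=t_i$ ($1\le i\le n$), $\tau_{n+2}=0$, and $P(x)=\prod_{i=1}^{n+2}(x-\tau_i)=x(x-1)(x-t_1)\cdots(x-t_n)$. Define $$D_x=\frac{\partial}{\partial x}\,P(x)\,\frac{\partial}{\partial x}-s(s+n+1)x^n-\sum_{i=1}^{n+2}\frac{k_i^2\prod_{j\ne i}(\tau_i-\tau_j)}{x-\tau_i},$$ $$L_{x_1,\dots,x_{n+1}}=\sum_{i=1}^{n+1}\frac{1}{\prod_{j\ne i}(x_i-x_j)}D_{x_i},\qquad M_{x_1,\dots,x_{n+2}}=\sum_{i=1}^{n+2}\frac{P(x_i)}{\prod_{j\ne i}(x_i-x_j)}\frac{\partial}{\partial x_i}-s .$$ For $x=(x_1,\dots,x_{2n+1})$, $q=(q_1,\dots,q_{n+1})$ and $j=1,\dots,n+1$ put $$u_j=\frac{\prod_{\alpha=1}^{2n+1}(x_\alpha-\tau_j)}{\prod_{\alpha=1}^{2n+1}x_\alpha}\prod_{1\le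 l\le n+1,\ l\ne j}\frac{\tau_l^2}{(\tau_j-\tau_l)^2},$$ and let $K(x,q)$ be the multivalued function $$(x_1\cdots x_{2n+1})^s\prod_{j=1}^{n+1}u_j^{-k_j}q_j^{2k_j-1}\cdot\Big(1+\sum_{j=1}^{n+1}q_j\Big)^{s-k_1-\dots-k_{n+2}}\Big(1+\sum_{j=1}^{n+1}\frac{u_j}{q_j}\Big)^{s+k_1+\dots+k_{n+2}}.$$ Let $U\subset\mathbb{C}^{2n+1}$ be open and let $\Gamma$ be a smooth $(n+1)$-dimensional twisted cycle in $q$-space, independent of $x\in U$: a finite sum of smooth singular cubes, each carrying a constant multiple of a branch of $K$ (continuous on $U$ times the cube, no factor of $K$ vanishing there), whose twisted boundary is zero modulo degenerate cubes. Then $$K_n(x_1,\dots,x_{2n+1})=\int_\Gamma K(x,q)\,dq_1\cdots dq_{n+1}$$ is holomorphic on $U$ and satisfies $$L_{x_{i_1},\dots,x_{i_{n+1}}}K_n=0\quad(1\le i_1<\dots<i_{n+1}\le 2n+1),\qquad M_{x_{i_1},\dots,x_{i_{n+2}}}K_n=0\quad(1\le i_1<\dots<i_{n+2}\le 2n+1)$$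 at every point of $U$ where the variables involved are pairwise distinct. Moreover this system is holonomic: the quotient of the ring of differential operators in $x_1,\dots,x_{2n+1}$ with coefficients in $\mathbb{C}(x_1,\dots,x_{2n+1})$ by the left ideal generated by all these operators $L$ and $M$ is finite-dimensional over $\mathbb{C}(x_1,\dots,x_{2n+1})$. -/

import Mathlib

open scoped ContDiff

noncomputable section

namespace EulerKernel

/-! ### The parameters -/

/-- The finite singular points `1, t₁, …, tₙ` other than `0`. -/
def node {n : ℕ} (t : Fin n → ℂ) : Fin (n + 1) → ℂ := Fin.cons 1 t

/-- All finite singular points, in the order `1, t₁, …, tₙ, 0`. -/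
def sing {n : ℕ} (t : Fin n → ℂ) : Fin (n + 2) → ℂ := Fin.snoc (node t) 0

/-- The residue-type constant `∏_{j ≠ i} (tᵢ - tⱼ)` at the `i`-th finite singular point. -/
def singDiff {n : ℕ} (t : Fin n → ℂ) (i : Fin (n + 2)) : ℂ :=
  ∏ j ∈ Finset.univ.erase i, (sing t i - sing t j)

/-! ### The operators acting on functions of `2n+1` complex variables -/

/-- The partial derivative `∂f/∂x_α`. -/
def partialD {N : ℕ} (α : Fin N) (f : (Fin N → ℂ) → ℂ) : (Fin N → ℂ) → ℂ :=
  fun x => deriv (fun z => f (Function.update x α z)) (x α)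

/-- The polynomial `z (z - 1) (z - t₁) ⋯ (z - tₙ)`. -/
def polyP {n : ℕ} (t : Fin n → ℂ) (z : ℂ) : ℂ := ∏ i, (z - sing t i)

/-- The Fuchsian operator `D_x` in the variable `x = x_α`:
`∂ₓ P(x) ∂ₓ - s (s + n + 1) xⁿ - ∑ᵢ kᵢ² ∏_{j ≠ i} (tᵢ - tⱼ) / (x - tᵢ)`,
where `i` runs over the finite singular points. -/
def opD {n N : ℕ} (t : Fin n → ℂ) (s : ℂ) (k : Fin (n + 2) → ℂ) (α : Fin N)
    (f : (Fin N → ℂ) → ℂ) : (Fin N → ℂ) → ℂ :=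
  fun x => partialD α (fun y => polyP t (y α) * partialD α f y) x
    - (s * (s + n + 1) * x α ^ n + ∑ i, k i ^ 2 * singDiff t i / (x α - sing t i)) * f x

/-- The operator `L` for the variables `x_α`, `α ∈ S`. -/
def opL {n N : ℕ} (t : Fin n → ℂ) (s : ℂ) (k : Fin (n + 2) → ℂ) (S : Finset (Fin N))
    (f : (Fin N → ℂ) → ℂ) : (Fin N → ℂ) → ℂ :=
  fun x => ∑ α ∈ S, (∏ β ∈ S.erase α, (x α - x β))⁻¹ * opD t s k α f x

/-- The operator `M` for the variables `x_α`, `α ∈ T`. -/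
def opM {n N : ℕ} (t : Fin n → ℂ) (s : ℂ) (T : Finset (Fin N))
    (f : (Fin N → ℂ) → ℂ) : (Fin N → ℂ) → ℂ :=
  fun x => ∑ α ∈ T, (polyP t (x α) / ∏ β ∈ T.erase α, (x α - x β)) * partialD α f x - s * f x

/-! ### The integrand and its branches -/

/-- The functions `u₁, …, u_{n+1}` of `x₁, …, x_{2n+1}`; the index `j` refers to `node t j`. -/
def uVar {n : ℕ} (t : Fin n → ℂ) (j : Fin (n + 1)) (x : Fin (2 * n + 1) → ℂ) : ℂ :=
  ((∏ α, (x α - node t j)) * ∏ l ∈ Finset.univ.erase j, node t l ^ 2) /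
    ((∏ α, x α) * ∏ l ∈ Finset.univ.erase j, (node t j - node t l) ^ 2)

/-- The closed unit cube. -/
def cube (m : ℕ) : Set (Fin m → ℝ) := Set.Icc 0 1

/-- `Φ` is a constant multiple of a branch, along the singular cube `σ` in the space of
`q = (q₁, …, q_{n+1})` and for `x ∈ U`, of the multivalued function
`∏ x_α ^ s · ∏ uⱼ ^ (-kⱼ) · ∏ qⱼ ^ (2kⱼ - 1) · (1 + ∑ qⱼ) ^ (s - k₁ - ⋯ - k_{n+2})
  · (1 + ∑ uⱼ / qⱼ) ^ (s + k₁ + ⋯ + k_{n+2})`: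
each power `f ^ e` is `exp (e · ℓ)` with `ℓ` a continuous logarithm of `f`, so in particular
no factor vanishes for `x ∈ U` and `q` on the cube. -/
def IsBranch {n : ℕ} (t : Fin n → ℂ) (s : ℂ) (k : Fin (n + 2) → ℂ)
    (U : Set (Fin (2 * n + 1) → ℂ)) (σ : (Fin (n + 1) → ℝ) → (Fin (n + 1) → ℂ))
    (Φ : (Fin (2 * n + 1) → ℂ) → (Fin (n + 1) → ℝ) → ℂ) : Prop :=
  ∃ (c : ℂ)
    (lx : Fin (2 * n + 1) → (Fin (2 * n + 1) → ℂ) × (Fin (n + 1) → ℝ) → ℂ)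
    (lu lq : Fin (n + 1) → (Fin (2 * n + 1) → ℂ) × (Fin (n + 1) → ℝ) → ℂ)
    (lA lB : (Fin (2 * n + 1) → ℂ) × (Fin (n + 1) → ℝ) → ℂ),
    (∀ α, ContinuousOn (lx α) (U ×ˢ cube (n + 1))) ∧
    (∀ j, ContinuousOn (lu j) (U ×ˢ cube (n + 1))) ∧
    (∀ j, ContinuousOn (lq j) (U ×ˢ cube (n + 1))) ∧
    ContinuousOn lA (U ×ˢ cube (n + 1)) ∧
    ContinuousOn lB (U ×ˢ cube (n + 1)) ∧
    ∀ x ∈ U, ∀ τ ∈ cube (n + 1),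
      (∀ α, Complex.exp (lx α (x, τ)) = x α) ∧
      (∀ j, Complex.exp (lu j (x, τ)) = uVar t j x) ∧
      (∀ j, Complex.exp (lq j (x, τ)) = σ τ j) ∧
      Complex.exp (lA (x, τ)) = 1 + ∑ j, σ τ j ∧
      Complex.exp (lB (x, τ)) = 1 + ∑ j, uVar t j x / σ τ j ∧
      Φ x τ = c * ((∏ α, Complex.exp (s * lx α (x, τ)))
        * (∏ j, Complex.exp (-k j.castSucc * lu j (x, τ)))
        * (∏ j, Complex.exp ((2 * k j.castSucc - 1) * lq j (x, τ)))
        * Complex.exp ((s - ∑ i, k i) * lA (x, τ))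
        * Complex.exp ((s + ∑ i, k i) * lB (x, τ)))

/-! ### Twisted cycles and the integral -/

/-- A singular cube is degenerate if it does not depend on one of its coordinates. -/
def IsDegenerate {m d : ℕ} (c : (Fin m → ℝ) → (Fin d → ℂ)) : Prop :=
  ∃ i, ∀ τ ∈ cube m, ∀ r ∈ Set.Icc (0 : ℝ) 1, c (Function.update τ i r) = c τ

/-- The contribution to the boundary, at the point `τ` of the singular `n`-cube `c`, of the face
`{τᵢ = ε}` of the singular cube `σ` with coefficient function `φ`: the restriction of `φ` if this
face is `c`, and `0` otherwise. -/
def faceCoeff {n d : ℕ} (σ : (Fin (n + 1) → ℝ) → (Fin d → ℂ)) (φ : (Fin (n + 1) → ℝ) → ℂ)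
    (i : Fin (n + 1)) (ε : ℝ) (c : (Fin n → ℝ) → (Fin d → ℂ)) (τ : Fin n → ℝ) : ℂ :=
  open Classical in
  if Set.EqOn (fun τ' => σ (i.insertNth ε τ')) c (cube n) then φ (i.insertNth ε τ) else 0

/-- A twisted (loaded) cycle of dimension `n+1` in the `q`-space, independent of `x ∈ U`, with
coefficients in the local system of branches of the integrand: a finite sum of smooth singular
cubes, each carrying a constant multiple of a branch, whose boundary is zero modulo degenerate
cubes, i.e. for every nondegenerate singular `n`-cube `c` the signed sum of the branches carried
by the faces equal to `c` vanishes. -/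
structure TwistedCycle {n : ℕ} (t : Fin n → ℂ) (s : ℂ) (k : Fin (n + 2) → ℂ)
    (U : Set (Fin (2 * n + 1) → ℂ)) where
  /-- the number of singular cubes -/
  size : ℕ
  /-- the singular cubes -/
  map : Fin size → (Fin (n + 1) → ℝ) → (Fin (n + 1) → ℂ)
  /-- the branches (times constants) carried by the cubes -/
  branch : Fin size → (Fin (2 * n + 1) → ℂ) → (Fin (n + 1) → ℝ) → ℂ
  smooth : ∀ a, ContDiff ℝ ∞ (map a)
  isBranch : ∀ a, IsBranch t s k U (map a) (branch a)
  closed : ∀ c : (Fin n → ℝ) → (Fin (n + 1) → ℂ), ¬ IsDegenerate c →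
    ∀ x ∈ U, ∀ τ ∈ cube n,
      ∑ a, ∑ i : Fin (n + 1), (-1 : ℂ) ^ (i : ℕ) *
        (faceCoeff (map a) (branch a x) i 1 c τ - faceCoeff (map a) (branch a x) i 0 c τ) = 0

/-- The Jacobian determinant of a map from real to complex `m`-space, so that
`dq₁ ∧ ⋯ ∧ dq_m` pulls back to `jac σ τ dτ₁ ∧ ⋯ ∧ dτ_m`. -/
def jac {m : ℕ} (σ : (Fin m → ℝ) → (Fin m → ℂ)) (τ : Fin m → ℝ) : ℂ :=
  (Matrix.of fun i j : Fin m => fderiv ℝ σ τ (Pi.single j 1) i).det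

/-- The kernel `K_n(x₁, …, x_{2n+1}) = ∫_Γ K(x₁, …, x_{2n+1}, q₁, …, q_{n+1}) dq₁ ⋯ dq_{n+1}`. -/
def kernel {n : ℕ} {t : Fin n → ℂ} {s : ℂ} {k : Fin (n + 2) → ℂ}
    {U : Set (Fin (2 * n + 1) → ℂ)} (Γ : TwistedCycle t s k U) : (Fin (2 * n + 1) → ℂ) → ℂ :=
  fun x => ∑ a, ∫ τ in cube (n + 1), Γ.branch a x τ * jac (Γ.map a) τ

/-! ### Differential operators with rational coefficients, and holonomicity -/

/-- The field of rational functions `ℂ(x₁, …, x_N)`. -/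
abbrev RatField (N : ℕ) : Type := FractionRing (MvPolynomial (Fin N) ℂ)

/-- The coordinate `x_α` as a rational function. -/
def X {N : ℕ} (α : Fin N) : RatField N := algebraMap (MvPolynomial (Fin N) ℂ) _ (MvPolynomial.X α)

/-- The quotient rule, on a numerator and a denominator. -/
def quotRule {N : ℕ} (α : Fin N) (a b : MvPolynomial (Fin N) ℂ) : RatField N :=
  algebraMap _ (RatField N) (MvPolynomial.pderiv α a * b - a * MvPolynomial.pderiv α b) /
    algebraMap _ (RatField N) b ^ 2

theorem quotRule_aux {A K : Type*} [CommRing A] [Field K] (φ : A →+* K)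
    {a b c d a' b' c' d' : A} (hb : φ b ≠ 0) (hd : φ d ≠ 0) (h : a * d = c * b)
    (h' : a * d' + d * a' = c * b' + b * c') :
    φ (a' * b - a * b') / φ b ^ 2 = φ (c' * d - c * d') / φ d ^ 2 := by
  rw [div_eq_div_iff (pow_ne_zero 2 hb) (pow_ne_zero 2 hd), ← map_pow, ← map_pow, ← map_mul,
    ← map_mul]
  congr 1
  linear_combination (b * d) * h' - (d' * b + b' * d) * h

theorem algebraMap_ne_zero {N : ℕ} {b : MvPolynomial (Fin N) ℂ} (hb : b ≠ 0) :
    algebraMap _ (RatField N) b ≠ 0 := fun h =>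
  hb (IsFractionRing.injective (MvPolynomial (Fin N) ℂ) (RatField N) (h.trans (map_zero _).symm))

theorem quotRule_congr {N : ℕ} (α : Fin N) {a b c d : MvPolynomial (Fin N) ℂ}
    (hb : b ≠ 0) (hd : d ≠ 0) (h : a * d = c * b) : quotRule α a b = quotRule α c d := by
  have h' := congrArg (MvPolynomial.pderiv α) h
  rw [Derivation.leibniz, Derivation.leibniz, smul_eq_mul, smul_eq_mul, smul_eq_mul,
    smul_eq_mul] at h'
  exact quotRule_aux _ (algebraMap_ne_zero hb) (algebraMap_ne_zero hd) h h'

/-- The partial derivative `∂/∂x_α` on rational functions, as a function. -/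
def ratPartialFun {N : ℕ} (α : Fin N) (f : RatField N) : RatField N :=
  quotRule α (IsLocalization.sec (nonZeroDivisors (MvPolynomial (Fin N) ℂ)) f).1
    (IsLocalization.sec (nonZeroDivisors (MvPolynomial (Fin N) ℂ)) f).2

theorem frac_eq {A K : Type*} [CommRing A] [Field K] (φ : A →+* K)
    (hφ : Function.Injective φ) {a b c d : A} (hb : φ b ≠ 0)
    (h : φ a / φ b * φ d = φ c) : c * b = a * d := by
  apply hφ
  rw [map_mul, map_mul, ← h]
  field_simp

theorem ratPartialFun_div {N : ℕ} (α : Fin N) (a b : MvPolynomial (Fin N) ℂ) (hb : b ≠ 0) :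
    ratPartialFun α (algebraMap _ (RatField N) a / algebraMap _ (RatField N) b)
      = quotRule α a b :=
  quotRule_congr α (nonZeroDivisors.ne_zero (SetLike.coe_mem _)) hb
    (frac_eq (algebraMap (MvPolynomial (Fin N) ℂ) (RatField N))
      (IsFractionRing.injective (MvPolynomial (Fin N) ℂ) (RatField N)) (algebraMap_ne_zero hb)
      (IsLocalization.sec_spec (nonZeroDivisors (MvPolynomial (Fin N) ℂ)) _))

theorem exists_rep {N : ℕ} (f : RatField N) : ∃ a b : MvPolynomial (Fin N) ℂ, b ≠ 0 ∧
    f = algebraMap _ (RatField N) a / algebraMap _ (RatField N) b := by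
  obtain ⟨a, b, hb, h⟩ := IsFractionRing.div_surjective (A := MvPolynomial (Fin N) ℂ) f
  exact ⟨a, b, nonZeroDivisors.ne_zero hb, h.symm⟩

theorem frac_add {A K : Type*} [CommRing A] [Field K] (φ : A →+* K) {a b c d : A}
    (hb : φ b ≠ 0) (hd : φ d ≠ 0) :
    φ a / φ b + φ c / φ d = φ (a * d + c * b) / φ (b * d) := by
  simp only [map_add, map_mul]
  field_simp

theorem quot_add {A K : Type*} [CommRing A] [Field K] (φ : A →+* K)
    {a b c d a' b' c' d' : A} (hb : φ b ≠ 0) (hd : φ d ≠ 0) :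
    φ ((a * d' + d * a' + (c * b' + b * c')) * (b * d) - (a * d + c * b) * (b * d' + d * b')) /
      φ (b * d) ^ 2 = φ (a' * b - a * b') / φ b ^ 2 + φ (c' * d - c * d') / φ d ^ 2 := by
  simp only [map_add, map_mul, map_sub]
  field_simp
  ring

theorem quotRule_add {N : ℕ} (α : Fin N) {a b c d : MvPolynomial (Fin N) ℂ}
    (hb : b ≠ 0) (hd : d ≠ 0) :
    quotRule α (a * d + c * b) (b * d) = quotRule α a b + quotRule α c d := by
  unfold quotRule
  rw [map_add, Derivation.leibniz, Derivation.leibniz, Derivation.leibniz]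
  exact quot_add _ (algebraMap_ne_zero hb) (algebraMap_ne_zero hd)

/-- The partial derivative `∂/∂x_α` on rational functions, as a `ℂ`-linear map. -/
def ratPartial {N : ℕ} (α : Fin N) : Module.End ℂ (RatField N) where
  toFun := ratPartialFun α
  map_add' f g := by
    obtain ⟨a, b, hb, rfl⟩ := exists_rep f
    obtain ⟨c, d, hd, rfl⟩ := exists_rep g
    rw [frac_add _ (algebraMap_ne_zero hb) (algebraMap_ne_zero hd),
      ratPartialFun_div α _ _ (mul_ne_zero hb hd), ratPartialFun_div α _ _ hb,
      ratPartialFun_div α _ _ hd, quotRule_add α hb hd]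
  map_smul' r f := by
    obtain ⟨a, b, hb, rfl⟩ := exists_rep f
    have e : ∀ p : MvPolynomial (Fin N) ℂ, algebraMap _ (RatField N) (r • p)
        = r • algebraMap _ (RatField N) p := fun p =>
      (IsScalarTower.toAlgHom ℂ (MvPolynomial (Fin N) ℂ) (RatField N)).map_smul_of_tower r p
    rw [← smul_div_assoc, ← e, ratPartialFun_div α _ _ hb, ratPartialFun_div α _ _ hb]
    unfold quotRule
    rw [Derivation.map_smul, smul_mul_assoc, smul_mul_assoc, ← smul_sub, e, smul_div_assoc]
    rfl

/-- Multiplication by a rational function. -/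
def ratMul {N : ℕ} (f : RatField N) : Module.End ℂ (RatField N) := LinearMap.mulLeft ℂ f

/-- The ring of differential operators in `x₁, …, x_N` with rational coefficients, realized by
its faithful action on rational functions. -/
def RatDiff (N : ℕ) : Subalgebra ℂ (Module.End ℂ (RatField N)) :=
  Algebra.adjoin ℂ (Set.range ratMul ∪ Set.range ratPartial)

/-- The operator of order zero given by a rational function. -/
def mulOp {N : ℕ} (f : RatField N) : RatDiff N :=
  ⟨ratMul f, Algebra.subset_adjoin (Or.inl ⟨f, rfl⟩)⟩

/-- The operator `∂/∂x_α`. -/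
def dOp {N : ℕ} (α : Fin N) : RatDiff N :=
  ⟨ratPartial α, Algebra.subset_adjoin (Or.inr ⟨α, rfl⟩)⟩

/-- A complex constant as a rational function. -/
def const {N : ℕ} (c : ℂ) : RatField N := algebraMap ℂ (RatField N) c

/-- `P(x_α)` as a rational function. -/
def ratP {n N : ℕ} (t : Fin n → ℂ) (α : Fin N) : RatField N := ∏ i, (X α - const (sing t i))

/-- `D_{x_α}` in the ring of differential operators. -/
def ratD {n N : ℕ} (t : Fin n → ℂ) (s : ℂ) (k : Fin (n + 2) → ℂ) (α : Fin N) : RatDiff N :=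
  dOp α * mulOp (ratP t α) * dOp α
    - mulOp (const (s * (s + n + 1)) * X α ^ n
        + ∑ i, const (k i ^ 2 * singDiff t i) / (X α - const (sing t i)))

/-- `L` in the ring of differential operators. -/
def ratL {n N : ℕ} (t : Fin n → ℂ) (s : ℂ) (k : Fin (n + 2) → ℂ) (S : Finset (Fin N)) :
    RatDiff N :=
  ∑ α ∈ S, mulOp (∏ β ∈ S.erase α, (X α - X β))⁻¹ * ratD t s k α

/-- `M` in the ring of differential operators. -/
def ratM {n N : ℕ} (t : Fin n → ℂ) (s : ℂ) (T : Finset (Fin N)) : RatDiff N :=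
  ∑ α ∈ T, mulOp (ratP t α / ∏ β ∈ T.erase α, (X α - X β)) * dOp α - mulOp (const s)

/-- The left ideal generated by all the operators `L` and `M` of the system. -/
def systemIdeal {n : ℕ} (t : Fin n → ℂ) (s : ℂ) (k : Fin (n + 2) → ℂ) :
    Ideal (RatDiff (2 * n + 1)) :=
  Ideal.span ({A | ∃ S : Finset (Fin (2 * n + 1)), S.card = n + 1 ∧ A = ratL t s k S} ∪
    {A | ∃ T : Finset (Fin (2 * n + 1)), T.card = n + 2 ∧ A = ratM t s T})

/-- A system of linear differential equations with rational coefficients, i.e. a left ideal `I`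
of the ring of differential operators, is holonomic (at the generic point) if the quotient by `I`
is a finite-dimensional vector space over the field of rational functions: finitely many
operators span the quotient under left multiplication by rational functions. -/
def IsHolonomic {N : ℕ} (I : Ideal (RatDiff N)) : Prop :=
  ∃ B : Finset (RatDiff N), ∀ A : RatDiff N, ∃ c : RatDiff N → RatField N,
    A - ∑ b ∈ B, mulOp (c b) * b ∈ I

end EulerKernel

end

/-! Write τ_i for the n+2 singular points, b = s + Σ k_i, v_j = u_j/q_j for j ≤ n+1, v_{n+2} = 1 and
V_i = v_i / Σ v_l, so that Σ V_i = 1. The exponents in K are such that its logarithmic derivative in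
x_α is Σ_i (b V_i - k_i)/(x_α - τ_i). Everything then rests on one fact: the divided difference of a
polynomial over m+1 nodes is its coefficient of degree m.

Equations M. P(x_α) times the logarithmic derivative is the value at x_α of a polynomial of degree
at most n+1 whose coefficient of degree n+1 is Σ (b V_i - k_i) = s. A divided difference over n+2
variables gives s, so M annihilates the integrand itself.

Equations L. D_{x_α} K / K is N(x_α)/P(x_α) with N of degree at most 2n+2 (`riccatiPoly`). Its
coefficient of degree 2n+2 vanishes, so the divided difference of N over n+1 variables and the n+2
points τ_i is zero, and L K / K becomes a sum over the τ_i only (`sum_riccatiPoly_div`). That sum is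
b, up to sign, times the twisted divergence in q of an explicit vector field
(`divergence_boundaryField`), whose pole along 1 + Σ q_j = 0 cancels by one more divided difference
(`sum_uExt_mul_boundaryWeight`). Stokes' theorem on the twisted cycle
(`sum_integral_divergence_eq_zero`) makes the integral vanish.

Holonomicity. It suffices that the principal symbols have only the trivial common zero ξ. The
symbols of M say that P(x_α) ξ_α = g(x_α) with deg g ≤ n, those of L that P(x_α) ξ_α² = h(x_α) with
deg h < n. Then g² - P h has degree at most 2n+1 and vanishes at the 2n+1 points x_α, so it is c ∏
(X - x_α), and g(τ_i)² = c ∏ (τ_i - x_α). Since deg g ≤ n, the n+2 numbers g(τ_i) satisfy a linear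
relation with nonzero coefficients; but square roots of the ∏ (τ_i - x_α) are linearly independent
(`eq_zero_of_sum_sqrt_eq_zero`), which forces c = 0, then g = 0 and ξ = 0. -/

open scoped ContDiff

noncomputable section

namespace EulerKernel

/-! ### Interpolation -/

/-- If the divided differences of `y` over all `m + 1` of the nodes vanish, then `y` is
interpolated by a polynomial of degree less than `m`. -/
theorem exists_polynomial_of_divided_difference {F : Type*} [Field F] {N m : ℕ} (hm : m ≤ N)
    {x y : Fin N → F} (hx : Function.Injective x)
    (h : ∀ T : Finset (Fin N), T.card = m + 1 →
      ∑ α ∈ T, y α / ∏ β ∈ T.erase α, (x α - x β) = 0) :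
    ∃ g : Polynomial F, g.degree < m ∧ ∀ α, g.eval (x α) = y α := by
  obtain ⟨S, -, hS⟩ := Finset.exists_subset_card_eq
    (show m ≤ (Finset.univ : Finset (Fin N)).card by simpa using hm)
  have hdeg : (Lagrange.interpolate S x y).degree < m := by
    simpa [hS] using Lagrange.degree_interpolate_lt y (hx.injOn (s := S))
  refine ⟨Lagrange.interpolate S x y, hdeg, fun α => ?_⟩
  by_cases hα : α ∈ S
  · exact Lagrange.eval_interpolate_at_node y hx.injOn hα
  have hT : (insert α S).card = m + 1 := by rw [Finset.card_insert_of_notMem hα, hS]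
  -- The interpolant through m nodes has degree less than m, so its own divided difference over
  -- these nodes and `α` vanishes. Its terms on `S` agree with those of `y`, hence so does the term
  -- at `α`.
  have h1 := Lagrange.coeff_eq_sum (s := insert α S) (v := x) hx.injOn
    (P := Lagrange.interpolate S x y) (by rw [hT]; exact hdeg.trans (by norm_cast; omega))
  rw [hT, Nat.add_sub_cancel, Polynomial.coeff_eq_zero_of_degree_lt hdeg] at h1
  have h2 := h _ hT
  rw [Finset.sum_insert hα] at h1 h2
  have h3 : ∑ i ∈ S, (Lagrange.interpolate S x y).eval (x i) /
      ∏ j ∈ (insert α S).erase i, (x i - x j) =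
      ∑ i ∈ S, y i / ∏ j ∈ (insert α S).erase i, (x i - x j) :=
    Finset.sum_congr rfl fun i hi => by
      rw [Lagrange.eval_interpolate_at_node y hx.injOn hi]
  have h0 : ∏ j ∈ (insert α S).erase α, (x α - x j) ≠ 0 :=
    Finset.prod_ne_zero_iff.2 fun j hj => sub_ne_zero.2 fun e =>
      (Finset.mem_erase.1 hj).1 (hx e).symm
  have h4 : (Lagrange.interpolate S x y).eval (x α) / ∏ j ∈ (insert α S).erase α, (x α - x j)
      = y α / ∏ j ∈ (insert α S).erase α, (x α - x j) := by
    linear_combination -h1 - h2 - h3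
  exact (div_left_inj' h0).1 h4

/-- Square roots of elements `q i` of a domain satisfy no linear relation if, at some point, exactly
one of the `q i` does not vanish. -/
theorem eq_zero_of_sum_sqrt_eq_zero {R F k ι : Type*} [CommRing R] [Field F] [Algebra R F]
    [Field k] [Fintype ι] [DecidableEq ι] (hinj : Function.Injective (algebraMap R F))
    (ev : R →+* k) (q a : ι → R)
    (i₀ : ι) (hq : ev (q i₀) ≠ 0) (ha : ev (a i₀) ≠ 0) (hqi : ∀ i, i ≠ i₀ → ev (q i) = 0)
    {z : ι → F} {c : F} (hz : ∀ i, z i ^ 2 = c * algebraMap R F (q i))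
    (hsum : ∑ i, algebraMap R F (a i) * z i = 0) : c = 0 := by
  by_contra hc
  have hq0 : algebraMap R F (q i₀) ≠ 0 := fun h => hq <| by
    rw [(injective_iff_map_eq_zero _).1 hinj _ h, map_zero]
  have hz0 : z i₀ ≠ 0 := fun h => mul_ne_zero hc hq0 (by rw [← hz, h]; ring)
  -- Dividing by `z i₀` removes the unknown `c`: the rescaled roots have squares in `R`, so they are
  -- integral and can be reduced modulo a prime above the kernel of `ev`.
  have hv (i : ι) : (z i * algebraMap R F (q i₀) / z i₀) ^ 2 = algebraMap R F (q i * q i₀) := by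
    rw [div_pow, mul_pow, hz, hz, map_mul]
    field_simp
  have hint (i : ι) : IsIntegral R (z i * algebraMap R F (q i₀) / z i₀) :=
    IsIntegral.of_pow two_pos (by rw [hv]; exact isIntegral_algebraMap)
  let w (i : ι) : integralClosure R F := ⟨_, hint i⟩
  have hw (i : ι) : w i ^ 2 = algebraMap R _ (q i * q i₀) := Subtype.ext (hv i)
  have hw0 : w i₀ = algebraMap R _ (q i₀) :=
    Subtype.ext (mul_div_cancel_left₀ _ hz0)
  have hws : ∑ i, algebraMap R (integralClosure R F) (a i) * w i = 0 := by
    apply Subtype.ext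
    have : ∑ i, algebraMap R F (a i) * (z i * algebraMap R F (q i₀) / z i₀) = 0 := by
      have := congrArg (· * (algebraMap R F (q i₀) / z i₀)) hsum
      simp only [zero_mul, Finset.sum_mul] at this
      rw [← this]
      exact Finset.sum_congr rfl fun i _ => by ring
    simpa [w] using this
  have hinj' : Function.Injective (algebraMap R (integralClosure R F)) := fun x y h =>
    hinj (congrArg Subtype.val h)
  have hprime : (RingHom.ker ev).IsPrime := RingHom.ker_isPrime ev
  obtain ⟨Q, hQ, hQP⟩ := Ideal.exists_ideal_over_prime_of_isIntegral_of_isDomain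
    (S := integralClosure R F) (RingHom.ker ev)
    (by rw [(RingHom.injective_iff_ker_eq_bot _).1 hinj']; exact bot_le)
  have hmem (r : R) : algebraMap R (integralClosure R F) r ∈ Q ↔ ev r = 0 := by
    rw [← Ideal.mem_comap, hQP, RingHom.mem_ker]
  have hwQ (i : ι) (hi : i ≠ i₀) : w i ∈ Q := by
    refine hQ.mem_of_pow_mem 2 ?_
    rw [hw, hmem, map_mul, hqi i hi, zero_mul]
  -- Modulo `Q` only the term of index `i₀` survives, and it is `a i₀ * q i₀`, which does not reduce
  -- to zero.
  rw [← Finset.add_sum_erase _ _ (Finset.mem_univ i₀), hw0, ← map_mul] at hws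
  have : algebraMap R (integralClosure R F) (a i₀ * q i₀) ∈ Q := by
    rw [eq_neg_of_add_eq_zero_left hws]
    exact neg_mem <| Q.sum_mem fun i hi => Q.mul_mem_left _ (hwQ i (Finset.ne_of_mem_erase hi))
  rw [hmem, map_mul] at this
  exact mul_ne_zero ha hq this

/-! ### Common zeros of the symbols -/

theorem sing_injective {n : ℕ} {t : Fin n → ℂ} (ht : Function.Injective t) (ht0 : ∀ i, t i ≠ 0)
    (ht1 : ∀ i, t i ≠ 1) : Function.Injective (sing t) := by
  refine Fin.snoc_injective_iff.2 ⟨Fin.cons_injective_iff.2 ⟨?_, ht⟩, ?_⟩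
  · rintro ⟨i, hi⟩
    exact ht1 i hi
  · rintro ⟨i, hi⟩
    revert hi
    refine Fin.cases ?_ (fun j => ?_) i
    · simp [node]
    · simpa [node] using ht0 j

theorem sing_castSucc {n : ℕ} (t : Fin n → ℂ) (j : Fin (n + 1)) :
    sing t j.castSucc = node t j := by simp [sing]

theorem sing_last {n : ℕ} (t : Fin n → ℂ) : sing t (Fin.last (n + 1)) = 0 := by simp [sing]

theorem X_injective {N : ℕ} : Function.Injective (X : Fin N → RatField N) := fun _ _ h =>
  MvPolynomial.X_injective (IsFractionRing.injective _ _ h)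

/-- The common zeros of the symbols of the system, over any extension of the field of rational
functions, are trivial. -/
theorem eq_zero_of_symbols_eq_zero {n : ℕ} {t : Fin n → ℂ} (hs : Function.Injective (sing t))
    {F : Type*} [Field F] (φ : RatField (2 * n + 1) →+* F) (ξ : Fin (2 * n + 1) → F)
    (hM : ∀ T : Finset (Fin (2 * n + 1)), T.card = n + 2 →
      ∑ α ∈ T, φ (ratP t α / ∏ β ∈ T.erase α, (X α - X β)) * ξ α = 0)
    (hL : ∀ S : Finset (Fin (2 * n + 1)), S.card = n + 1 →
      ∑ α ∈ S, φ ((∏ β ∈ S.erase α, (X α - X β))⁻¹ * ratP t α) * ξ α ^ 2 = 0) :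
    ξ = 0 := by
  classical
  let x (α : Fin (2 * n + 1)) : F := φ (X α)
  have hx : Function.Injective x := φ.injective.comp X_injective
  let σ (i : Fin (n + 2)) : F := φ (const (sing t i))
  have hσ : Function.Injective σ :=
    φ.injective.comp ((algebraMap ℂ (RatField (2 * n + 1))).injective.comp hs)
  have hP (α) : φ (ratP t α) = (Lagrange.nodal Finset.univ σ).eval (x α) := by
    simp [ratP, Lagrange.eval_nodal, σ, x]
  have hP0 (α) : φ (ratP t α) ≠ 0 := by
    rw [map_ne_zero, ratP, Finset.prod_ne_zero_iff]
    intro i _ h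
    have h1 : algebraMap _ (RatField (2 * n + 1))
        (MvPolynomial.X α - MvPolynomial.C (sing t i)) = 0 := by
      rw [map_sub]
      exact h
    have h2 := (injective_iff_map_eq_zero _).1 (IsFractionRing.injective _ _) _ h1
    have h3 := congrArg (MvPolynomial.eval fun _ => sing t i + 1) h2
    simp at h3
  -- The symbols are divided differences of P ξ over n+2 nodes and of P ξ² over n+1 nodes.
  obtain ⟨g, hg, hgx⟩ := exists_polynomial_of_divided_difference (m := n + 1) (by omega) hx
    (y := fun α => φ (ratP t α) * ξ α) fun T hT => by
      rw [← hM T hT]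
      refine Finset.sum_congr rfl fun α _ => ?_
      simp only [map_div₀, map_prod, map_sub, x]
      ring
  obtain ⟨h, hh, hhx⟩ := exists_polynomial_of_divided_difference (m := n) (by omega) hx
    (y := fun α => φ (ratP t α) * ξ α ^ 2) fun T hT => by
      rw [← hL T hT]
      refine Finset.sum_congr rfl fun α _ => ?_
      simp only [map_mul, map_inv₀, map_prod, map_sub, x]
      ring
  suffices hg0 : g = 0 by
    funext α
    have := hgx α
    rw [hg0, Polynomial.eval_zero] at this
    exact (mul_eq_zero.1 this.symm).resolve_left (hP0 α)
  -- At each `x α` both terms of `E` equal P² ξ².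
  let E := g ^ 2 - Lagrange.nodal Finset.univ σ * h
  let c := E.coeff (2 * n + 1)
  have hgn : g.degree ≤ n := by
    rw [Polynomial.degree_lt_iff_coeff_zero] at hg
    exact (Polynomial.degree_le_iff_coeff_zero _ _).2 fun m hm => hg m (by exact_mod_cast hm)
  have hEd : E.degree ≤ (2 * n + 1 : ℕ) := by
    refine (Polynomial.degree_sub_le _ _).trans (max_le ?_ ?_)
    · refine (Polynomial.degree_pow_le g 2).trans ((nsmul_le_nsmul_right hgn 2).trans ?_)
      rw [nsmul_eq_mul]; norm_cast; omega
    · by_cases h0 : h = 0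
      · simp [h0]
      rw [Polynomial.degree_mul, Lagrange.degree_nodal, Polynomial.degree_eq_natDegree h0]
      rw [Polynomial.degree_eq_natDegree h0] at hh
      simp only [Finset.card_univ, Fintype.card_fin]
      norm_cast at hh ⊢
      omega
  have hEc : E = Polynomial.C c * Lagrange.nodal Finset.univ x := by
    rw [← sub_eq_zero]
    refine Polynomial.eq_zero_of_degree_lt_of_eval_index_eq_zero (s := Finset.univ) (v := x) hx.injOn
      ?_ ?_
    · rw [Finset.card_univ, Fintype.card_fin, Polynomial.degree_lt_iff_coeff_zero]
      intro m hm
      rcases hm.eq_or_lt with rfl | hm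
      · have hmon := Lagrange.nodal_monic (s := Finset.univ) (v := x)
        have := hmon.coeff_natDegree
        rw [Lagrange.natDegree_nodal, Finset.card_univ, Fintype.card_fin] at this
        rw [Polynomial.coeff_sub, Polynomial.coeff_C_mul, this, mul_one, sub_self]
      · rw [Polynomial.coeff_sub, Polynomial.coeff_C_mul, Polynomial.coeff_eq_zero_of_degree_lt
          (hEd.trans_lt (by exact_mod_cast hm)), Polynomial.coeff_eq_zero_of_natDegree_lt
          (by simpa [Lagrange.natDegree_nodal] using hm), mul_zero, sub_zero]
    · intro α _
      simp only [E, Polynomial.eval_sub, Polynomial.eval_pow, Polynomial.eval_mul, hgx, hhx,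
        Lagrange.eval_nodal_at_node (Finset.mem_univ α), mul_zero, sub_zero, ← hP]
      ring
  have hgσ (i) : g.eval (σ i) ^ 2 = c * ∏ α, (σ i - x α) := by
    have := congrArg (Polynomial.eval (σ i)) hEc
    simpa [E, Lagrange.eval_nodal_at_node (Finset.mem_univ i), Lagrange.eval_nodal] using this
  -- This is the coefficient of degree n+1 of `g`, computed by interpolation at the n+2 singular
  -- points.
  have hgs : ∑ i, (∏ j ∈ Finset.univ.erase i, (σ i - σ j))⁻¹ * g.eval (σ i) = 0 := by
    have h1 := Lagrange.coeff_eq_sum (s := Finset.univ) (v := σ) hσ.injOn (P := g)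
      (by rw [Finset.card_univ, Fintype.card_fin]; exact hg.trans (by norm_cast; omega))
    rw [Finset.card_univ, Fintype.card_fin, show n + 2 - 1 = n + 1 by omega,
      Polynomial.coeff_eq_zero_of_degree_lt hg] at h1
    rw [h1]
    exact Finset.sum_congr rfl fun i _ => by ring
  have hc : c = 0 := by
    let ψ : MvPolynomial (Fin (2 * n + 1)) ℂ →+* F :=
      φ.comp (algebraMap (MvPolynomial (Fin (2 * n + 1)) ℂ) (RatField (2 * n + 1)))
    let : Algebra (MvPolynomial (Fin (2 * n + 1)) ℂ) F := ψ.toAlgebra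
    have hψX (α) : ψ (MvPolynomial.X α) = x α := rfl
    have hψC (r) : ψ (MvPolynomial.C r) = φ (const r) := rfl
    -- The specialization lets the first n+1 variables run through the singular points other than 0
    -- and puts the remaining ones at the nonzero point `sing t 0`. Then ∏ (τ_i - x_α) vanishes for
    -- every i except the last, where τ_i = 0.
    let pt (α : Fin (2 * n + 1)) : ℂ :=
      if h : (α : ℕ) < n + 1 then sing t (Fin.castSucc ⟨α, h⟩) else sing t 0
    have hpt (α) : pt α ≠ 0 := by
      simp only [pt, ← sing_last t]
      split_ifs with h
      · exact hs.ne (Fin.castSucc_lt_last _).ne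
      · exact hs.ne (Fin.last_pos.ne)
    refine eq_zero_of_sum_sqrt_eq_zero (φ.injective.comp (IsFractionRing.injective _ _))
      (MvPolynomial.eval pt)
      (fun i => ∏ α, (MvPolynomial.C (sing t i) - MvPolynomial.X α))
      (fun i => MvPolynomial.C (∏ j ∈ Finset.univ.erase i, (sing t i - sing t j))⁻¹)
      (Fin.last (n + 1)) ?_ ?_ ?_ (z := fun i => g.eval (σ i)) (c := c) ?_ ?_
    · simp [sing_last, Finset.prod_eq_zero_iff, hpt]
    · rw [MvPolynomial.eval_C]
      exact inv_ne_zero (Finset.prod_ne_zero_iff.2 fun j hj => sub_ne_zero.2 fun e =>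
        (Finset.mem_erase.1 hj).1 (hs e).symm)
    · intro i
      refine Fin.lastCases (fun h => (h rfl).elim) (fun j _ => ?_) i
      rw [map_prod]
      refine Finset.prod_eq_zero (Finset.mem_univ (⟨j, by omega⟩ : Fin (2 * n + 1))) ?_
      have : pt ⟨j, by omega⟩ = sing t j.castSucc := by
        simp only [pt]
        rw [dif_pos j.2]
      simp [this]
    · intro i
      change _ = c * ψ _
      rw [hgσ, map_prod]
      simp_rw [map_sub, hψX, hψC]
      rfl
    · rw [← hgs]
      refine Finset.sum_congr rfl fun i _ => ?_
      change ψ _ * _ = _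
      rw [hψC]
      simp [const, σ]
  refine Polynomial.eq_zero_of_degree_lt_of_eval_index_eq_zero (s := Finset.univ) (v := σ) hσ.injOn
    ?_ ?_
  · rw [Finset.card_univ, Fintype.card_fin]
    exact hg.trans (by norm_cast; omega)
  · intro i _
    have := hgσ i
    rw [hc, zero_mul] at this
    exact pow_eq_zero_iff two_ne_zero |>.1 this

/-! ### The ring of differential operators -/

theorem ratPartial_apply_div {N : ℕ} (α : Fin N) (a b : MvPolynomial (Fin N) ℂ) (hb : b ≠ 0) :
    ratPartial α (algebraMap _ (RatField N) a / algebraMap _ (RatField N) b) = quotRule α a b :=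
  ratPartialFun_div α a b hb

theorem ratPartial_mul {N : ℕ} (α : Fin N) (f g : RatField N) :
    ratPartial α (f * g) = f * ratPartial α g + g * ratPartial α f := by
  obtain ⟨a, b, hb, rfl⟩ := exists_rep f
  obtain ⟨c, d, hd, rfl⟩ := exists_rep g
  have hb' := algebraMap_ne_zero hb
  have hd' := algebraMap_ne_zero hd
  rw [div_mul_div_comm, ← map_mul, ← map_mul, ratPartial_apply_div _ _ _ (mul_ne_zero hb hd),
    ratPartial_apply_div _ _ _ hb, ratPartial_apply_div _ _ _ hd]
  unfold quotRule
  simp only [Derivation.leibniz, smul_eq_mul, map_sub, map_add, map_mul]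
  field_simp
  ring

/-- The partial derivative as a derivation of the field of rational functions. -/
def ratDerivation {N : ℕ} (α : Fin N) : Derivation ℂ (RatField N) (RatField N) :=
  Derivation.mk' (ratPartial α) fun f g => by
    rw [ratPartial_mul, smul_eq_mul, smul_eq_mul]

theorem ratPartial_algebraMap {N : ℕ} (α : Fin N) (p : MvPolynomial (Fin N) ℂ) :
    ratPartial α (algebraMap _ (RatField N) p) = algebraMap _ _ (MvPolynomial.pderiv α p) := by
  have := ratPartial_apply_div α p 1 one_ne_zero
  rw [map_one, div_one] at this
  rw [this]
  simp [quotRule]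

/-- The commutator of two derivations is again a derivation. It kills polynomials, hence by the
quotient rule it kills fractions. -/
theorem ratPartial_comm {N : ℕ} (α β : Fin N) (f : RatField N) :
    ratPartial α (ratPartial β f) = ratPartial β (ratPartial α f) := by
  have hp (p : MvPolynomial (Fin N) ℂ) :
      ⁅ratDerivation α, ratDerivation β⁆ (algebraMap _ (RatField N) p) = 0 := by
    have : MvPolynomial.pderiv α (MvPolynomial.pderiv β p)
        = MvPolynomial.pderiv β (MvPolynomial.pderiv α p) := by
      have h0 : ⁅MvPolynomial.pderiv (R := ℂ) α, MvPolynomial.pderiv β⁆ = 0 :=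
        MvPolynomial.derivation_ext fun i => by
          rw [Derivation.commutator_apply, MvPolynomial.pderiv_X, MvPolynomial.pderiv_X]
          simp [Pi.single_apply, apply_ite]
      have := congrArg (· p) h0
      simpa [Derivation.commutator_apply, sub_eq_zero] using this
    rw [Derivation.commutator_apply]
    change ratPartial α (ratPartial β _) - ratPartial β (ratPartial α _) = 0
    simp only [ratPartial_algebraMap, this, sub_self]
  have h : ⁅ratDerivation α, ratDerivation β⁆ f = 0 := by
    obtain ⟨a, b, -, rfl⟩ := exists_rep f
    rw [Derivation.leibniz_div, hp, hp]
    simp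
  rw [Derivation.commutator_apply] at h
  exact sub_eq_zero.1 h

/-- Rational functions as operators of order zero. -/
def mulHom (N : ℕ) : RatField N →+* RatDiff N where
  toFun := mulOp
  map_one' := Subtype.ext (LinearMap.ext fun f => one_mul f)
  map_mul' f g := Subtype.ext (LinearMap.ext fun h => mul_assoc f g h)
  map_zero' := Subtype.ext (LinearMap.ext fun f => zero_mul f)
  map_add' f g := Subtype.ext (LinearMap.ext fun h => add_mul f g h)

instance ratDiffModule (N : ℕ) : Module (RatField N) (RatDiff N) :=
  Module.compHom (RatDiff N) (mulHom N)

theorem ratDiff_smul_def {N : ℕ} (f : RatField N) (A : RatDiff N) : f • A = mulOp f * A := rfl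

theorem neg_mem_ratDiff {N : ℕ} {W : Submodule (RatField N) (RatDiff N)} {A : RatDiff N}
    (h : A ∈ W) : -A ∈ W := by
  have : (-1 : RatField N) • A = -A :=
    Subtype.ext (LinearMap.ext fun f => neg_one_mul (A.1 f))
  exact this ▸ W.smul_mem (-1) h

theorem dOp_mul_smul {N : ℕ} (α : Fin N) (f : RatField N) (A : RatDiff N) :
    dOp α * (f • A) = f • (dOp α * A) + ratPartial α f • A := by
  apply Subtype.ext
  refine LinearMap.ext fun g => ?_
  change ratPartial α (f * A.1 g) = f * ratPartial α (A.1 g) + ratPartial α f * A.1 g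
  rw [ratPartial_mul, mul_comm (A.1 g)]

theorem dOp_comm {N : ℕ} (α β : Fin N) : (dOp α * dOp β : RatDiff N) = dOp β * dOp α :=
  Subtype.ext (LinearMap.ext fun f => ratPartial_comm α β f)

theorem commute_dOp_pow {N : ℕ} (m : Fin N →₀ ℕ) (α β : Fin N) :
    Commute (dOp α ^ m α : RatDiff N) (dOp β ^ m β) :=
  Commute.pow_pow (dOp_comm α β) _ _

theorem ratDiff_add_sub_cancel {N : ℕ} (A B : RatDiff N) : A + B - B = A := add_sub_cancel_right A B

theorem ratDiff_sub_add_cancel_left {N : ℕ} (A B : RatDiff N) : A - (A + B) = -B :=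
  sub_add_cancel_left A B

theorem ratDiff_sum_sub_sum {N : ℕ} {ι : Type*} (s : Finset ι) (f g : ι → RatDiff N) :
    ∑ i ∈ s, f i - ∑ i ∈ s, g i = ∑ i ∈ s, (f i - g i) := (Finset.sum_sub_distrib f g).symm

/-- The monomial `∂^m`. -/
def dMon {N : ℕ} (m : Fin N →₀ ℕ) : RatDiff N :=
  Finset.univ.noncommProd (fun α => dOp α ^ m α) fun α _ β _ _ => commute_dOp_pow m α β

theorem dMon_zero {N : ℕ} : (dMon 0 : RatDiff N) = 1 := by
  refine (Finset.noncommProd_eq_pow_card _ _ _ 1 fun _ _ => ?_).trans (one_pow _)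
  exact pow_zero _

theorem dMon_single_add {N : ℕ} (α : Fin N) (m : Fin N →₀ ℕ) :
    dMon (Finsupp.single α 1 + m) = dOp α * dMon m := by
  have h (m : Fin N →₀ ℕ) := Finset.mul_noncommProd_erase Finset.univ (Finset.mem_univ α)
    (fun β => (dOp β : RatDiff N) ^ m β) fun α _ β _ _ => commute_dOp_pow m α β
  refine (h _).symm.trans (Eq.trans ?_ (congrArg (dOp α * ·) (h m)))
  rw [← mul_assoc, ← pow_succ']
  congr 1
  · simp [add_comm]
  · refine Finset.noncommProd_congr rfl (fun β hβ => ?_) _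
    simp [(Finset.ne_of_mem_erase hβ).symm]

/-! ### The order filtration -/

/-- Operators of order less than `d`. -/
def ordLT (N d : ℕ) : Submodule (RatField N) (RatDiff N) :=
  Submodule.span _ (dMon '' {m | m.degree < d})

theorem dMon_mem_ordLT {N d : ℕ} {m : Fin N →₀ ℕ} (h : m.degree < d) : dMon m ∈ ordLT N d :=
  Submodule.subset_span ⟨m, h, rfl⟩

theorem ordLT_mono {N d e : ℕ} (h : d ≤ e) : ordLT N d ≤ ordLT N e :=
  Submodule.span_mono (Set.image_mono fun _ hm => lt_of_lt_of_le hm h)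

theorem dOp_mul_mem_ordLT {N d : ℕ} (α : Fin N) {A : RatDiff N} (hA : A ∈ ordLT N d) :
    dOp α * A ∈ ordLT N (d + 1) := by
  induction hA using Submodule.span_induction with
  | mem A h =>
    obtain ⟨m, hm, rfl⟩ := h
    rw [← dMon_single_add]
    refine dMon_mem_ordLT ?_
    rw [map_add, Finsupp.degree_single]
    have : m.degree < d := hm
    omega
  | zero => rw [mul_zero]; exact zero_mem _
  | add A B _ _ hA hB => rw [mul_add]; exact add_mem hA hB
  | smul f A hA h =>
    rw [dOp_mul_smul]
    exact add_mem (Submodule.smul_mem _ _ h)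
      (Submodule.smul_mem _ _ (ordLT_mono (Nat.le_succ d) hA))

theorem exists_mem_ordLT {N : ℕ} (A : RatDiff N) : ∃ d, A ∈ ordLT N d := by
  let W : Submodule (RatField N) (RatDiff N) := ⨆ d, ordLT N d
  have hdir : Directed (· ≤ ·) (ordLT N) := (monotone_nat_of_le_succ fun d =>
    ordLT_mono (Nat.le_succ d)).directed_le
  have hW {B : RatDiff N} : B ∈ W ↔ ∃ d, B ∈ ordLT N d := Submodule.mem_iSup_of_directed _ hdir
  -- The union of the filtration contains 1 and is stable under left multiplication by the
  -- generators, hence by the whole ring.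
  have key (A' : Module.End ℂ (RatField N)) (hA' : A' ∈ RatDiff N) :
      ∀ B ∈ W, (⟨A', hA'⟩ : RatDiff N) * B ∈ W := by
    induction hA' using Algebra.adjoin_induction with
    | mem x hx =>
      rintro B hB
      rcases hx with ⟨f, rfl⟩ | ⟨α, rfl⟩
      · exact W.smul_mem f hB
      · obtain ⟨d, hd⟩ := hW.1 hB
        exact hW.2 ⟨d + 1, dOp_mul_mem_ordLT α hd⟩
    | algebraMap r =>
      intro B hB
      convert! W.smul_mem (const r) hB using 1
      refine Subtype.ext (LinearMap.ext fun f => ?_)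
      exact Algebra.smul_def r _
    | add x y hx hy h1 h2 =>
      intro B hB
      have := add_mem (h1 B hB) (h2 B hB)
      rwa [← add_mul] at this
    | mul x y hx hy h1 h2 =>
      intro B hB
      have := h1 _ (h2 B hB)
      rwa [← mul_assoc] at this
  have h1 : (1 : RatDiff N) ∈ W :=
    hW.2 ⟨1, dMon_zero (N := N) ▸ dMon_mem_ordLT (by simp)⟩
  have := key A.1 A.2 1 h1
  rw [mul_one] at this
  exact hW.1 this

/-! ### Symbols of a left ideal -/

/-- A left ideal as a space over the rational functions. -/
def idealSpace {N : ℕ} (I : Ideal (RatDiff N)) : Submodule (RatField N) (RatDiff N) where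
  carrier := I
  add_mem' := I.add_mem
  zero_mem' := I.zero_mem
  smul_mem' f _ h := I.mul_mem_left (mulOp f) h

theorem mem_idealSpace {N : ℕ} {I : Ideal (RatDiff N)} {A : RatDiff N} :
    A ∈ idealSpace I ↔ A ∈ I := Iff.rfl

/-- The operator obtained from a polynomial in `N` variables over the rational functions by
substituting the partial derivatives, coefficients on the left. -/
def quantize (N : ℕ) : MvPolynomial (Fin N) (RatField N) →ₗ[RatField N] RatDiff N :=
  (MvPolynomial.basisMonomials (Fin N) (RatField N)).constr (RatField N) dMon

theorem quantize_monomial {N : ℕ} (m : Fin N →₀ ℕ) (f : RatField N) :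
    quantize N (MvPolynomial.monomial m f) = f • dMon m := by
  have := (MvPolynomial.basisMonomials (Fin N) (RatField N)).constr_basis (RatField N) dMon m
  rw [MvPolynomial.coe_basisMonomials] at this
  rw [← this, quantize, ← map_smul, MvPolynomial.smul_monomial, smul_eq_mul, mul_one]

/-- The symbol is multiplicative up to lower order: moving ∂_α past a coefficient f costs only f',
which lowers the order by one. This is what makes `symbolIdeal` an ideal of a commutative ring. -/
theorem quantize_X_mul {N d : ℕ} (α : Fin N) {p : MvPolynomial (Fin N) (RatField N)}
    (hp : p.IsHomogeneous d) :
    quantize N (MvPolynomial.X α * p) - dOp α * quantize N p ∈ ordLT N (d + 1) := by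
  rw [p.as_sum, Finset.mul_sum, map_sum, map_sum, Finset.mul_sum]
  rw [ratDiff_sum_sub_sum]
  refine sum_mem fun m hm => ?_
  rw [MvPolynomial.X, MvPolynomial.monomial_mul, one_mul, quantize_monomial, quantize_monomial,
    dOp_mul_smul, dMon_single_add, ratDiff_sub_add_cancel_left]
  refine neg_mem_ratDiff (Submodule.smul_mem _ _ (dMon_mem_ordLT ?_))
  have := hp (MvPolynomial.mem_support_iff.1 hm)
  have hdeg : m.degree = Finsupp.weight 1 m := by rw [Finsupp.degree_eq_weight_one]; rfl
  omega

theorem homogeneousComponent_X_mul {σ R : Type*} [CommSemiring R] (d : ℕ) (i : σ)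
    (p : MvPolynomial σ R) : MvPolynomial.homogeneousComponent (d + 1) (MvPolynomial.X i * p) =
      MvPolynomial.X i * MvPolynomial.homogeneousComponent d p := by
  classical
  ext m
  rw [MvPolynomial.coeff_homogeneousComponent, MvPolynomial.coeff_X_mul', MvPolynomial.coeff_X_mul',
    MvPolynomial.coeff_homogeneousComponent]
  by_cases hi : i ∈ m.support
  · have hm : m = (m - Finsupp.single i 1) + Finsupp.single i 1 :=
      (tsub_add_cancel_of_le (Finsupp.single_le_iff.2
        (Nat.one_le_iff_ne_zero.2 (Finsupp.mem_support_iff.1 hi)))).symm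
    have hdeg : m.degree = (m - Finsupp.single i 1).degree + 1 := by
      conv_lhs => rw [hm]
      rw [map_add, Finsupp.degree_single]
    simp [hi, hdeg]
  · simp [hi]

theorem homogeneousComponent_zero_X_mul {σ R : Type*} [CommSemiring R] (i : σ)
    (p : MvPolynomial σ R) :
    MvPolynomial.homogeneousComponent 0 (MvPolynomial.X i * p) = 0 := by
  rw [MvPolynomial.homogeneousComponent_zero, ← MvPolynomial.constantCoeff_eq]
  simp

/-- The polynomials all of whose homogeneous components are symbols of elements of `I`. -/
def symbolIdeal {N : ℕ} (I : Ideal (RatDiff N)) : Ideal (MvPolynomial (Fin N) (RatField N)) where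
  carrier := {p | ∀ d, quantize N (MvPolynomial.homogeneousComponent d p) ∈
    idealSpace I ⊔ ordLT N d}
  zero_mem' d := by simp
  add_mem' hp hq d := by
    rw [map_add, map_add]
    exact add_mem (hp d) (hq d)
  smul_mem' r p hp := by
    change ∀ d, quantize N (MvPolynomial.homogeneousComponent d (r * p)) ∈ _
    induction r using MvPolynomial.induction_on generalizing p with
    | C f =>
      intro d
      rw [MvPolynomial.homogeneousComponent_C_mul, ← MvPolynomial.smul_eq_C_mul, map_smul]
      exact Submodule.smul_mem _ _ (hp d)
    | add q r hq hr =>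
      intro d
      rw [add_mul, map_add, map_add]
      exact add_mem (hq p hp d) (hr p hp d)
    -- Multiplication by a variable shifts the homogeneous components by one degree. On operators it
    -- corresponds, up to lower order, to left multiplication by ∂_i, which preserves the left
    -- ideal.
    | mul_X q i hq =>
      rw [mul_assoc]
      refine hq _ fun d => ?_
      cases d with
      | zero => rw [homogeneousComponent_zero_X_mul, map_zero]; exact zero_mem _
      | succ d =>
        rw [homogeneousComponent_X_mul, ← sub_add_cancel (quantize N _)
          (dOp i * quantize N (MvPolynomial.homogeneousComponent d p))]
        refine add_mem (Submodule.mem_sup_right (quantize_X_mul i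
          (MvPolynomial.homogeneousComponent_isHomogeneous d p))) ?_
        obtain ⟨A, hA, B, hB, hAB⟩ := Submodule.mem_sup.1 (hp d)
        rw [← hAB, mul_add]
        exact add_mem (Submodule.mem_sup_left (I.mul_mem_left _ hA))
          (Submodule.mem_sup_right (dOp_mul_mem_ordLT i hB))

theorem mem_symbolIdeal_of_isHomogeneous {N d : ℕ} {I : Ideal (RatDiff N)}
    {p : MvPolynomial (Fin N) (RatField N)} (hp : p.IsHomogeneous d) {A : RatDiff N} (hA : A ∈ I)
    (h : quantize N p - A ∈ ordLT N d) : p ∈ symbolIdeal I := by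
  classical
  intro e
  rw [MvPolynomial.homogeneousComponent_of_mem hp]
  split_ifs with hde
  · subst hde
    rw [← sub_add_cancel (quantize N p) A]
    exact add_mem (Submodule.mem_sup_right h) (Submodule.mem_sup_left hA)
  · rw [map_zero]
    exact zero_mem _

/-- A left ideal is holonomic if its symbols have no common zero but the origin. -/
theorem isHolonomic_of_X_mem_radical {N : ℕ} {I : Ideal (RatDiff N)}
    (h : ∀ α, MvPolynomial.X α ∈ (symbolIdeal I).radical) : IsHolonomic I := by
  classical
  choose e he using h
  -- By the pigeonhole principle a monomial of degree at least `D` is divisible by some X_α ^ e_α,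
  -- so it lies in the symbol ideal.
  let D := ∑ α, e α + 1
  have hmon (m : Fin N →₀ ℕ) (hm : D ≤ m.degree) : dMon m ∈ idealSpace I ⊔ ordLT N m.degree := by
    by_cases hlt : ∃ α, e α ≤ m α
    · obtain ⟨α, hα⟩ := hlt
      have hmem : MvPolynomial.monomial m 1 ∈ symbolIdeal I := by
        have : m = (m - Finsupp.single α (e α)) + Finsupp.single α (e α) :=
          (tsub_add_cancel_of_le (Finsupp.single_le_iff.2 hα)).symm
        rw [this, ← one_mul (1 : RatField N), ← MvPolynomial.monomial_mul,
          ← MvPolynomial.X_pow_eq_monomial]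
        exact Ideal.mul_mem_left _ _ (he α)
      have := hmem m.degree
      rwa [MvPolynomial.homogeneousComponent_of_mem (MvPolynomial.isHomogeneous_monomial 1 rfl),
        if_pos rfl, quantize_monomial, one_smul] at this
    · push Not at hlt
      have : m.degree ≤ ∑ α, e α := by
        rw [Finsupp.degree_eq_sum]
        exact Finset.sum_le_sum fun i _ => (hlt i).le
      omega
  -- Modulo `I`, a monomial of degree at least `D` can be replaced by an operator of smaller order;
  -- repeating this brings every operator below order `D`.
  have hstep (d : ℕ) : ordLT N d ≤ idealSpace I ⊔ ordLT N D := by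
    induction d with
    | zero => exact (ordLT_mono (Nat.zero_le _)).trans le_sup_right
    | succ d ih =>
      refine Submodule.span_le.2 ?_
      rintro _ ⟨m, hm, rfl⟩
      rcases lt_or_ge m.degree D with h1 | h1
      · exact Submodule.mem_sup_right (dMon_mem_ordLT h1)
      · refine (sup_le le_sup_left ?_ : _ ≤ idealSpace I ⊔ ordLT N D) (hmon m h1)
        exact (ordLT_mono (Nat.lt_succ_iff.1 hm)).trans ih
  have hfin : {m : Fin N →₀ ℕ | m.degree < D}.Finite := Finsupp.finite_of_degree_lt D
  refine ⟨hfin.toFinset.image dMon, fun A => ?_⟩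
  obtain ⟨d, hd⟩ := exists_mem_ordLT A
  obtain ⟨B, hB, C, hC, rfl⟩ := Submodule.mem_sup.1 (hstep d hd)
  rw [ordLT, ← hfin.coe_toFinset, ← Finset.coe_image, Submodule.mem_span_finset] at hC
  obtain ⟨c, -, rfl⟩ := hC
  exact ⟨c, by simpa only [← ratDiff_smul_def, ratDiff_add_sub_cancel] using! mem_idealSpace.1 hB⟩

/-! ### Symbols of the operators L and M, and holonomicity -/

theorem dMon_single {N : ℕ} (α : Fin N) : dMon (Finsupp.single α 1) = dOp α := by
  rw [← add_zero (Finsupp.single α 1), dMon_single_add, dMon_zero, mul_one]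

theorem dMon_single_two {N : ℕ} (α : Fin N) : dMon (Finsupp.single α 2) = dOp α * dOp α := by
  rw [show Finsupp.single α 2 = Finsupp.single α 1 + Finsupp.single α 1 by
    rw [← Finsupp.single_add], dMon_single_add, dMon_single]

theorem mulOp_mem_ordLT {N d : ℕ} (hd : 0 < d) (f : RatField N) : mulOp f ∈ ordLT N d := by
  have := (ordLT N d).smul_mem f (dMon_mem_ordLT (m := 0) (by simpa using hd))
  rwa [dMon_zero, ratDiff_smul_def, mul_one] at this

theorem symbol_ratM_mem {n : ℕ} (t : Fin n → ℂ) (s : ℂ) (k : Fin (n + 2) → ℂ)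
    {T : Finset (Fin (2 * n + 1))} (hT : T.card = n + 2) :
    ∑ α ∈ T, MvPolynomial.monomial (Finsupp.single α 1)
      (ratP t α / ∏ β ∈ T.erase α, (X α - X β)) ∈ symbolIdeal (systemIdeal t s k) := by
  refine mem_symbolIdeal_of_isHomogeneous (d := 1) (A := ratM t s T)
    (MvPolynomial.IsHomogeneous.sum _ _ _ fun α _ =>
      MvPolynomial.isHomogeneous_monomial _ (by simp))
    (Ideal.subset_span (Or.inr ⟨T, hT, rfl⟩)) ?_
  have : quantize (2 * n + 1) (∑ α ∈ T, MvPolynomial.monomial (Finsupp.single α 1)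
      (ratP t α / ∏ β ∈ T.erase α, (X α - X β))) - ratM t s T = mulOp (const s) := by
    rw [map_sum]
    simp only [quantize_monomial, dMon_single]
    exact sub_sub_cancel (∑ α ∈ T, mulOp (ratP t α / ∏ β ∈ T.erase α, (X α - X β)) * dOp α)
      (mulOp (const s))
  rw [this]
  exact mulOp_mem_ordLT one_pos _

/-- Expanding ∂ f ∂ = f ∂² + f' ∂ shows that w (∂ f ∂ - g) has symbol w f ξ²; the other terms have
order at most one. -/
theorem quantize_sub_second_order_mem {N : ℕ} (α : Fin N) (w f g : RatField N) :
    quantize N (MvPolynomial.monomial (Finsupp.single α 2) (w * f)) -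
      mulOp w * (dOp α * mulOp f * dOp α - mulOp g) ∈ ordLT N 2 := by
  have hd : (dOp α : RatDiff N) ∈ ordLT N 2 := by
    rw [← dMon_single]
    exact dMon_mem_ordLT (by simp)
  have h1 : dOp α * mulOp f * dOp α = mulOp f * (dOp α * dOp α) + ratPartial α f • dOp α := by
    rw [mul_assoc, ← ratDiff_smul_def, dOp_mul_smul, ← ratDiff_smul_def]
  have h2 (w a b c : RatDiff N) : w * a - w * (a + b - c) = w * (c + -b) :=
    (mul_sub w a _).symm.trans (congrArg (w * ·) (by abel))
  rw [quantize_monomial, dMon_single_two, mul_smul, ratDiff_smul_def, ratDiff_smul_def f, h1, h2,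
    ← ratDiff_smul_def]
  exact Submodule.smul_mem _ _
    (add_mem (mulOp_mem_ordLT two_pos g) (neg_mem_ratDiff (Submodule.smul_mem _ _ hd)))

theorem symbol_ratL_mem {n : ℕ} (t : Fin n → ℂ) (s : ℂ) (k : Fin (n + 2) → ℂ)
    {S : Finset (Fin (2 * n + 1))} (hS : S.card = n + 1) :
    ∑ α ∈ S, MvPolynomial.monomial (Finsupp.single α 2)
      ((∏ β ∈ S.erase α, (X α - X β))⁻¹ * ratP t α) ∈ symbolIdeal (systemIdeal t s k) := by
  refine mem_symbolIdeal_of_isHomogeneous (d := 2) (A := ratL t s k S)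
    (MvPolynomial.IsHomogeneous.sum _ _ _ fun α _ =>
      MvPolynomial.isHomogeneous_monomial _ (by simp))
    (Ideal.subset_span (Or.inl ⟨S, hS, rfl⟩)) ?_
  rw [map_sum, ratL, ratDiff_sum_sub_sum]
  exact sum_mem fun α _ => quantize_sub_second_order_mem α _ _ _

/-- The radical is the intersection of the primes above the symbol ideal. Modulo such a prime, the
classes of the variables in the residue field form a common zero of the symbols, so they vanish.
Allowing an arbitrary extension field in `eq_zero_of_symbols_eq_zero` serves exactly this argument.
-/
theorem isHolonomic_systemIdeal {n : ℕ} {t : Fin n → ℂ} (ht : Function.Injective t)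
    (ht0 : ∀ i, t i ≠ 0) (ht1 : ∀ i, t i ≠ 1) (s : ℂ) (k : Fin (n + 2) → ℂ) :
    IsHolonomic (systemIdeal t s k) := by
  refine isHolonomic_of_X_mem_radical fun α => ?_
  rw [Ideal.radical_eq_sInf, Ideal.mem_sInf]
  rintro p ⟨hp, hprime⟩
  let ψ : MvPolynomial (Fin (2 * n + 1)) (RatField (2 * n + 1)) →+* p.ResidueField :=
    algebraMap _ _
  have hψ {q} : ψ q = 0 ↔ q ∈ p := Ideal.algebraMap_residueField_eq_zero
  have hmon (α : Fin (2 * n + 1)) (e : ℕ) (f : RatField (2 * n + 1)) :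
      ψ (MvPolynomial.monomial (Finsupp.single α e) f) =
        (ψ.comp MvPolynomial.C) f * ψ (MvPolynomial.X α) ^ e := by
    rw [← MvPolynomial.C_mul_X_pow_eq_monomial, map_mul, map_pow, RingHom.comp_apply]
  have := eq_zero_of_symbols_eq_zero (sing_injective ht ht0 ht1) (ψ.comp MvPolynomial.C)
    (fun α => ψ (MvPolynomial.X α))
    (fun T hT => by
      have := hψ.2 (hp (symbol_ratM_mem t s k hT))
      simpa only [map_sum, hmon, pow_one] using this)
    (fun S hS => by
      have := hψ.2 (hp (symbol_ratL_mem t s k hS))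
      simpa only [map_sum, hmon] using this)
  exact hψ.1 (congrFun this α)

section

/-! ### Parameter integrals over the cube -/

open MeasureTheory Filter Topology

theorem isCompact_cube (m : ℕ) : IsCompact (cube m) := isCompact_Icc

/-- A continuous logarithm of a differentiable function is differentiable. -/
theorem hasFDerivAt_of_exp_eq {𝕜 E : Type*} [NontriviallyNormedField 𝕜] [NormedAlgebra 𝕜 ℂ]
    [NormedAddCommGroup E] [NormedSpace 𝕜 E] {l f : E → ℂ} {f' : E →L[𝕜] ℂ} {x : E}
    (hl : ContinuousAt l x) (hexp : ∀ᶠ y in 𝓝 x, Complex.exp (l y) = f y)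
    (hf : HasFDerivAt f f' x) : HasFDerivAt l ((f x)⁻¹ • f') x := by
  have hfx : f x ≠ 0 := hexp.self_of_nhds ▸ Complex.exp_ne_zero _
  have hlog : HasFDerivAt (fun y => Complex.log (f y / f x)) ((f x)⁻¹ • f') x := by
    have h1 : HasFDerivAt (fun y => f y / f x) ((f x)⁻¹ • f') x := by
      simpa [div_eq_inv_mul] using! hf.const_smul (f x)⁻¹
    have h2 : HasFDerivAt Complex.log (ContinuousLinearMap.id 𝕜 ℂ) (f x / f x) := by
      have := (Complex.hasDerivAt_log (z := f x / f x)
        (by rw [div_self hfx]; exact Complex.one_mem_slitPlane)).hasFDerivAt.restrictScalars 𝕜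
      convert! this using 1
      ext
      simp [div_self hfx]
    have := HasFDerivAt.comp (g := Complex.log) x h2 h1
    simpa using! this
  -- By continuity the imaginary part of `l y - l x` stays below π in absolute value, so the
  -- principal logarithm of `f y / f x` is this difference and not a translate by a period.
  have heq : ∀ᶠ y in 𝓝 x, l y = Complex.log (f y / f x) + l x := by
    have hnear : ∀ᶠ y in 𝓝 x, dist (l y) (l x) < Real.pi :=
      hl.eventually (Metric.ball_mem_nhds _ Real.pi_pos)
    filter_upwards [hexp, hnear] with y hy hd
    have him : |(l y - l x).im| < Real.pi := (Complex.abs_im_le_norm _).trans_lt (by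
      rwa [dist_eq_norm] at hd)
    rw [← hy, ← hexp.self_of_nhds, ← Complex.exp_sub,
      Complex.log_exp (abs_lt.1 him).1 (abs_lt.1 him).2.le, sub_add_cancel]
  exact (hlog.add_const (l x)).congr_of_eventuallyEq heq

theorem continuousOn_slice {X Y Z : Type*} [TopologicalSpace X] [TopologicalSpace Y]
    [TopologicalSpace Z] {g : X → Y → Z} {s : Set X} {t : Set Y}
    (hg : ContinuousOn (Function.uncurry g) (s ×ˢ t)) {x : X} (hx : x ∈ s) :
    ContinuousOn (g x) t :=
  hg.comp (f := fun y => (x, y)) (by fun_prop) fun _ hy => ⟨hx, hy⟩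

/-- A closed ball around `x` times the cube is compact, so the derivative of the integrand has there
a constant bound, which serves for dominated convergence. -/
theorem hasFDerivAt_integral_cube {m : ℕ} {E F : Type*} [NormedAddCommGroup E] [NormedSpace ℂ E]
    [ProperSpace E] [NormedAddCommGroup F] [NormedSpace ℂ F] {U : Set E}
    (hU : IsOpen U) {G : E → (Fin m → ℝ) → F} {G' : E → (Fin m → ℝ) → E →L[ℂ] F}
    (hG : ContinuousOn (Function.uncurry G) (U ×ˢ cube m))
    (hG' : ContinuousOn (Function.uncurry G') (U ×ˢ cube m))
    (hd : ∀ x ∈ U, ∀ τ ∈ cube m, HasFDerivAt (G · τ) (G' x τ) x) {x : E} (hx : x ∈ U) :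
    HasFDerivAt (fun y => ∫ τ in cube m, G y τ) (∫ τ in cube m, G' x τ) x := by
  obtain ⟨r, hr, hrU⟩ := Metric.nhds_basis_closedBall.mem_iff.1 (hU.mem_nhds hx)
  obtain ⟨C, hC⟩ :=
    ((isCompact_closedBall x r).prod (isCompact_cube m)).exists_bound_of_continuousOn
    (hG'.mono (Set.prod_mono hrU subset_rfl))
  have hmeas : MeasurableSet (cube m) := measurableSet_Icc
  refine hasFDerivAt_integral_of_dominated_of_fderiv_le (𝕜 := ℂ) (bound := fun _ => C)
    (Metric.closedBall_mem_nhds x hr) ?_ ?_ ?_ ?_ ?_ ?_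
  · filter_upwards [hU.mem_nhds hx] with y hy
    exact (continuousOn_slice hG hy).aestronglyMeasurable_of_isCompact (isCompact_cube m) hmeas
  · exact (continuousOn_slice hG hx).integrableOn_compact (isCompact_cube m)
  · exact (continuousOn_slice hG' hx).aestronglyMeasurable_of_isCompact (isCompact_cube m) hmeas
  · exact (ae_restrict_iff' hmeas).2 (Eventually.of_forall fun τ hτ y hy => hC (y, τ) ⟨hy, hτ⟩)
  · exact (continuousOn_const).integrableOn_compact (isCompact_cube m)
  · exact (ae_restrict_iff' hmeas).2 (Eventually.of_forall fun τ hτ y hy => hd y (hrU hy) τ hτ)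

/-- The integral over a singular cube `σ` of a density `φ`, times a function `h` of the parameter
and the point of the cube. -/
def paramIntegral {m : ℕ} {E Q F : Type*} [NormedAddCommGroup F] [NormedSpace ℂ F]
    (σ : (Fin m → ℝ) → Q) (φ : E → (Fin m → ℝ) → ℂ) (h : E × Q → F) (x : E) : F :=
  ∫ τ in cube m, φ x τ • h (x, σ τ)

section ParamIntegral

variable {m : ℕ} {E Q : Type} [NormedAddCommGroup E] [NormedSpace ℂ E]
  [NormedAddCommGroup Q] [NormedSpace ℂ Q] {U : Set E} {Ω : Set (E × Q)}
  {σ : (Fin m → ℝ) → Q} {φ : E → (Fin m → ℝ) → ℂ} {R : E × Q → E →L[ℂ] ℂ}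

/-- The function whose integral against a density with logarithmic derivative `R` is the derivative
of the integral of `h`. -/
def twistedFDeriv {F : Type*} [NormedAddCommGroup F] [NormedSpace ℂ F] (R : E × Q → E →L[ℂ] ℂ)
    (h : E × Q → F) (p : E × Q) : E →L[ℂ] F :=
  (R p).smulRight (h p) + (fderiv ℂ h p).comp (ContinuousLinearMap.inl ℂ E Q)

theorem ContDiffOn.twistedFDeriv {F : Type*} [NormedAddCommGroup F] [NormedSpace ℂ F]
    (hΩ : IsOpen Ω) (hR : ContDiffOn ℂ ∞ R Ω) {h : E × Q → F} (hh : ContDiffOn ℂ ∞ h Ω) :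
    ContDiffOn ℂ ∞ (twistedFDeriv R h) Ω := by
  have h1 : ContDiffOn ℂ ∞ (fderiv ℂ h) Ω := hh.fderiv_of_isOpen hΩ (by simp)
  exact (hR.smulRight hh).add (h1.clm_comp contDiffOn_const)

/-- The derivative of φ h is φ times `twistedFDeriv R h`, so the integrals of this form are closed
under differentiation and the multivalued density is never differentiated again. -/
theorem hasFDerivAt_paramIntegral [ProperSpace E] {F : Type*} [NormedAddCommGroup F]
    [NormedSpace ℂ F]
    (hU : IsOpen U) (hΩ : IsOpen Ω) (hσ : ContinuousOn σ (cube m))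
    (hφ : ContinuousOn (Function.uncurry φ) (U ×ˢ cube m))
    (hmem : ∀ x ∈ U, ∀ τ ∈ cube m, (x, σ τ) ∈ Ω) (hR : ContDiffOn ℂ ∞ R Ω)
    (hφ' : ∀ x ∈ U, ∀ τ ∈ cube m, HasFDerivAt (φ · τ) (φ x τ • R (x, σ τ)) x)
    {h : E × Q → F} (hh : ContDiffOn ℂ ∞ h Ω) {x : E} (hx : x ∈ U) :
    HasFDerivAt (paramIntegral σ φ h) (paramIntegral σ φ (twistedFDeriv R h) x) x := by
  have hpair : ContinuousOn (fun p : E × (Fin m → ℝ) => (p.1, σ p.2)) (U ×ˢ cube m) :=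
    continuousOn_fst.prodMk (hσ.comp continuousOn_snd fun p hp => hp.2)
  have hmaps : Set.MapsTo (fun p : E × (Fin m → ℝ) => (p.1, σ p.2)) (U ×ˢ cube m) Ω :=
    fun p hp => hmem _ hp.1 _ hp.2
  refine hasFDerivAt_integral_cube (G := fun x τ => φ x τ • h (x, σ τ))
    (G' := fun x τ => φ x τ • EulerKernel.twistedFDeriv R h (x, σ τ)) hU
    (hφ.smul (hh.continuousOn.comp hpair hmaps))
    (hφ.smul ((ContDiffOn.twistedFDeriv hΩ hR hh).continuousOn.comp hpair hmaps)) ?_ hx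
  intro y hy τ hτ
  have hin : HasFDerivAt (fun z : E => (z, σ τ)) (ContinuousLinearMap.inl ℂ E Q) y :=
    hasFDerivAt_prodMk_left y (σ τ)
  have h1 : HasFDerivAt h (fderiv ℂ h (y, σ τ)) (y, σ τ) :=
    ((hh.differentiableOn (by simp)).differentiableAt (hΩ.mem_nhds (hmem y hy τ hτ))).hasFDerivAt
  have h2 := (hφ' y hy τ hτ).smul (HasFDerivAt.comp (g := h) y h1 hin)
  convert! h2 using 1
  ext v
  simp [twistedFDeriv, smul_smul, add_comm]

/-- Induction on the order of differentiability. The target space `F` has to vary, because each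
derivative takes values in linear maps into the previous target. -/
theorem contDiffOn_paramIntegral [ProperSpace E]
    (hU : IsOpen U) (hΩ : IsOpen Ω) (hσ : ContinuousOn σ (cube m))
    (hφ : ContinuousOn (Function.uncurry φ) (U ×ˢ cube m))
    (hmem : ∀ x ∈ U, ∀ τ ∈ cube m, (x, σ τ) ∈ Ω) (hR : ContDiffOn ℂ ∞ R Ω)
    (hφ' : ∀ x ∈ U, ∀ τ ∈ cube m, HasFDerivAt (φ · τ) (φ x τ • R (x, σ τ)) x)
    {F : Type} [NormedAddCommGroup F] [NormedSpace ℂ F]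
    {h : E × Q → F} (hh : ContDiffOn ℂ ∞ h Ω) : ContDiffOn ℂ ∞ (paramIntegral σ φ h) U := by
  rw [contDiffOn_infty]
  intro d
  have hD {F : Type} [NormedAddCommGroup F] [NormedSpace ℂ F] {h : E × Q → F}
      (hh : ContDiffOn ℂ ∞ h Ω) {x : E} (hx : x ∈ U) :=
    hasFDerivAt_paramIntegral hU hΩ hσ hφ hmem hR hφ' hh hx
  induction d generalizing F with
  | zero =>
    exact contDiffOn_zero.2 fun x hx => (hD hh hx).continuousAt.continuousWithinAt
  | succ d ih =>
    push_cast
    rw [contDiffOn_succ_iff_hasFDerivWithinAt_of_uniqueDiffOn hU.uniqueDiffOn]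
    exact ⟨fun h => absurd h (by simp), _, ih (ContDiffOn.twistedFDeriv hΩ hR hh),
      fun x hx => (hD hh hx).hasFDerivWithinAt⟩

end ParamIntegral

end

section

/-! ### Stokes' theorem for twisted chains -/

open MeasureTheory Filter Topology

/-- The determinant as a continuous real multilinear function of the rows. -/
def detRows (m : ℕ) : ContinuousMultilinearMap ℝ (fun _ : Fin m => Fin m → ℂ) ℂ where
  toMultilinearMap :=
    (Matrix.detRowAlternating (R := ℂ) (n := Fin m)).toMultilinearMap.restrictScalars ℝ
  cont := by
    change Continuous fun M : Matrix (Fin m) (Fin m) ℂ => M.det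
    exact continuous_id.matrix_det

theorem detRows_apply {m : ℕ} (M : Fin m → Fin m → ℂ) : detRows m M = (Matrix.of M).det := rfl

theorem jac_eq_detRows {m : ℕ} (σ : (Fin m → ℝ) → (Fin m → ℂ)) (τ : Fin m → ℝ) :
    jac σ τ = detRows m fun l => fderiv ℝ σ τ (Pi.single l 1) := by
  rw [detRows_apply, ← Matrix.det_transpose]
  rfl

/-- Cramer's rule expands each determinant through the adjugate, and adjugate times matrix is the
determinant times the identity. It turns the divergence upstairs into the divergence in q times the
Jacobian. -/
theorem sum_detRows_update_eq_trace_mul {m : ℕ} (J : Fin m → Fin m → ℂ)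
    (A : (Fin m → ℂ) →L[ℂ] (Fin m → ℂ)) :
    ∑ i, detRows m (Function.update J i (A (J i))) =
      (∑ j, A (Pi.single j 1) j) * detRows m J := by
  have h1 (i : Fin m) : detRows m (Function.update J i (A (J i))) =
      ∑ j, A (J i) j * (Matrix.of J).adjugate j i := by
    have := Matrix.cramer_transpose_apply (Matrix.of J) (A (J i)) i
    rw [Matrix.cramer_eq_adjugate_mulVec, ← Matrix.adjugate_transpose] at this
    rw [detRows_apply]
    refine Eq.trans ?_ (this.symm.trans ?_)
    · rfl
    · simp [Matrix.mulVec, dotProduct, mul_comm]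
  have h2 (v : Fin m → ℂ) (j : Fin m) : A v j = ∑ l, v l * A (Pi.single l 1) j := by
    conv_lhs => rw [← Finset.univ_sum_single v]
    rw [map_sum, Finset.sum_apply]
    refine Finset.sum_congr rfl fun l _ => ?_
    rw [show Pi.single l (v l) = v l • (Pi.single l 1 : Fin m → ℂ) by
      rw [← Pi.single_smul, smul_eq_mul, mul_one], map_smul, Pi.smul_apply, smul_eq_mul]
  have h3 (j l : Fin m) : ∑ i, (Matrix.of J).adjugate j i * J i l =
      if j = l then detRows m J else 0 := by
    have := congrFun (congrFun (Matrix.adjugate_mul (Matrix.of J)) j) l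
    simpa [Matrix.mul_apply, Matrix.one_apply, detRows_apply] using this
  simp_rw [h1]
  calc ∑ i, ∑ j, A (J i) j * (Matrix.of J).adjugate j i
      = ∑ i, ∑ j, ∑ l, A (Pi.single l 1) j * ((Matrix.of J).adjugate j i * J i l) := by
        refine Finset.sum_congr rfl fun i _ => Finset.sum_congr rfl fun j _ => ?_
        rw [h2, Finset.sum_mul]
        exact Finset.sum_congr rfl fun l _ => by ring
    _ = ∑ j, ∑ l, A (Pi.single l 1) j * ∑ i, (Matrix.of J).adjugate j i * J i l := by
        rw [Finset.sum_comm]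
        refine Finset.sum_congr rfl fun j _ => ?_
        rw [Finset.sum_comm]
        simp_rw [Finset.mul_sum]
    _ = _ := by
        simp_rw [h3]
        simp [Finset.sum_mul]

/-- The terms (i, l) and (l, i) differ by a swap of two rows, so they cancel. With `H` the second
derivative of a map, this is the compatibility of pullback with the exterior derivative. -/
theorem sum_detRows_update_update_eq_zero {m : ℕ} (J : Fin m → Fin m → ℂ) (W : Fin m → ℂ)
    (H : Fin m → Fin m → Fin m → ℂ) (hH : ∀ i l, H i l = H l i) :
    ∑ i, ∑ l ∈ Finset.univ.erase i,
      detRows m (Function.update (Function.update J i W) l (H i l)) = 0 := by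
  have hanti (i l : Fin m) (hil : i ≠ l) :
      detRows m (Function.update (Function.update J i W) l (H i l)) =
        - detRows m (Function.update (Function.update J l W) i (H l i)) := by
    have := (Matrix.detRowAlternating (R := ℂ) (n := Fin m)).map_swap
      (Function.update (Function.update J l W) i (H l i)) hil
    have hswap : Function.update (Function.update J i W) l (H i l) =
        Function.update (Function.update J l W) i (H l i) ∘ Equiv.swap i l := ?_
    · rw [hswap]
      exact this
    funext r
    by_cases h1 : r = i
    · subst h1; simp [hil, hil.symm]
    by_cases h2 : r = l
    · subst h2; simp [hH i r]
    · simp [h1, h2, Equiv.swap_apply_of_ne_of_ne]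
  set S := ∑ i, ∑ l ∈ Finset.univ.erase i,
      detRows m (Function.update (Function.update J i W) l (H i l)) with hS
  have h : S = -S := by
    conv_lhs => rw [hS]
    rw [Finset.sum_comm' (t' := Finset.univ) (s' := fun l => Finset.univ.erase l)
      (by simp [eq_comm])]
    rw [hS, ← Finset.sum_neg_distrib]
    refine Finset.sum_congr rfl fun i _ => ?_
    rw [← Finset.sum_neg_distrib]
    exact Finset.sum_congr rfl fun l hl => hanti l i (Finset.ne_of_mem_erase hl)
  exact self_eq_neg.1 h

/-- The components of the pullback along `σ` of the form dual to the vector field `W`. -/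
def pullbackField {m : ℕ} (σ : (Fin m → ℝ) → (Fin m → ℂ)) (W : (Fin m → ℝ) → (Fin m → ℂ))
    (τ : Fin m → ℝ) (i : Fin m) : ℂ :=
  detRows m (Function.update (fun l => fderiv ℝ σ τ (Pi.single l 1)) i (W τ))

/-- The derivative of `pullbackField`, in terms of the derivative `W'` of `W`. -/
def pullbackFieldDeriv {m : ℕ} (σ : (Fin m → ℝ) → (Fin m → ℂ)) (W : (Fin m → ℝ) → (Fin m → ℂ))
    (W' : (Fin m → ℝ) →L[ℝ] (Fin m → ℂ)) (τ : Fin m → ℝ) :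
    (Fin m → ℝ) →L[ℝ] (Fin m → ℂ) :=
  ContinuousLinearMap.pi fun i =>
    ((detRows m).linearDeriv (Function.update (fun l => fderiv ℝ σ τ (Pi.single l 1)) i (W τ))).comp
      (ContinuousLinearMap.pi (Function.update
        (fun l => (fderiv ℝ (fderiv ℝ σ) τ).flip (Pi.single l 1)) i W'))

theorem hasFDerivAt_pullbackField {m : ℕ} {σ : (Fin m → ℝ) → (Fin m → ℂ)} (hσ : ContDiff ℝ ∞ σ)
    {W : (Fin m → ℝ) → (Fin m → ℂ)} {W' : (Fin m → ℝ) →L[ℝ] (Fin m → ℂ)} {τ : Fin m → ℝ}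
    (hW : HasFDerivAt W W' τ) :
    HasFDerivAt (pullbackField σ W) (pullbackFieldDeriv σ W W' τ) τ := by
  refine hasFDerivAt_pi.2 fun i => ?_
  have hrows : HasFDerivAt
      (fun τ => Function.update (fun l => fderiv ℝ σ τ (Pi.single l 1)) i (W τ))
      (ContinuousLinearMap.pi (Function.update
        (fun l => (fderiv ℝ (fderiv ℝ σ) τ).flip (Pi.single l 1)) i W')) τ := by
    refine hasFDerivAt_pi.2 fun l => ?_
    rcases eq_or_ne l i with rfl | h
    · simpa using hW
    · have h1 : HasFDerivAt (fderiv ℝ σ) (fderiv ℝ (fderiv ℝ σ) τ) τ :=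
        ((hσ.fderiv_right (m := ∞) (by simp)).differentiable (by simp) τ).hasFDerivAt
      simpa [h] using! h1.clm_apply (hasFDerivAt_const (Pi.single l (1 : ℝ)) τ)
  exact ((detRows m).hasFDerivAt _).comp τ hrows

/-- Differentiating the determinant row by row, the terms in which another row is differentiated
carry second derivatives of `σ` and cancel by symmetry. -/
theorem sum_pullbackFieldDeriv {m : ℕ} {σ : (Fin m → ℝ) → (Fin m → ℂ)} (hσ : ContDiff ℝ ∞ σ)
    (W : (Fin m → ℝ) → (Fin m → ℂ)) (W' : (Fin m → ℝ) →L[ℝ] (Fin m → ℂ)) (τ : Fin m → ℝ) :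
    ∑ i, pullbackFieldDeriv σ W W' τ (Pi.single i 1) i =
      ∑ i, detRows m (Function.update (fun l => fderiv ℝ σ τ (Pi.single l 1)) i
        (W' (Pi.single i 1))) := by
  have hsymm : IsSymmSndFDerivAt ℝ σ τ :=
    (contDiff_infty.1 hσ 2).contDiffAt.isSymmSndFDerivAt (by simp)
  have hz := sum_detRows_update_update_eq_zero (fun l => fderiv ℝ σ τ (Pi.single l 1)) (W τ)
    (fun i l => fderiv ℝ (fderiv ℝ σ) τ (Pi.single i 1) (Pi.single l 1)) fun i l => hsymm _ _
  rw [← add_zero (∑ i, detRows m _), ← hz, ← Finset.sum_add_distrib]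
  refine Finset.sum_congr rfl fun i _ => ?_
  simp only [pullbackFieldDeriv, ContinuousLinearMap.pi_apply, ContinuousLinearMap.comp_apply,
    ContinuousMultilinearMap.linearDeriv_apply]
  rw [← Finset.add_sum_erase _ _ (Finset.mem_univ i)]
  congr 1
  · simp
  · refine Finset.sum_congr rfl fun l hl => ?_
    simp [Finset.ne_of_mem_erase hl]

/-- The open unit cube. -/
def openCube (m : ℕ) : Set (Fin m → ℝ) := Set.univ.pi fun _ => Set.Ioo 0 1

theorem isOpen_openCube (m : ℕ) : IsOpen (openCube m) :=
  isOpen_set_pi Set.finite_univ fun _ _ => isOpen_Ioo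

theorem openCube_subset (m : ℕ) : openCube m ⊆ cube m := fun _ h =>
  ⟨fun i => (h i trivial).1.le, fun i => (h i trivial).2.le⟩

theorem openCube_ae_eq (m : ℕ) : openCube m =ᵐ[volume] cube m := Measure.univ_pi_Ioo_ae_eq_Icc

/-- The Jacobian determinant of a singular `n`-cube completed by the vector `v`. -/
def faceDet {n : ℕ} (c : (Fin n → ℝ) → (Fin (n + 1) → ℂ)) (v : Fin (n + 1) → ℂ)
    (τ : Fin n → ℝ) : ℂ :=
  detRows (n + 1) (Fin.cons v fun l => fderiv ℝ c τ (Pi.single l 1))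

theorem hasFDerivAt_insertNth {n : ℕ} (i : Fin (n + 1)) (ε : ℝ) (τ : Fin n → ℝ) :
    HasFDerivAt (fun τ' : Fin n → ℝ => (i.insertNth ε τ' : Fin (n + 1) → ℝ))
      (ContinuousLinearMap.pi (i.insertNth (α := fun _ => (Fin n → ℝ) →L[ℝ] ℝ) 0
        fun l => ContinuousLinearMap.proj l)) τ := by
  refine hasFDerivAt_pi.2 fun j => ?_
  refine Fin.succAboveCases i ?_ (fun l => ?_) j
  · simpa using hasFDerivAt_const ε τ
  · simpa using! hasFDerivAt_apply l τ

theorem contDiff_insertNth {n : ℕ} (i : Fin (n + 1)) (ε : ℝ) :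
    ContDiff ℝ ∞ (fun τ' : Fin n → ℝ => (i.insertNth ε τ' : Fin (n + 1) → ℝ)) := by
  refine contDiff_pi.2 fun j => ?_
  refine Fin.succAboveCases i ?_ (fun l => ?_) j
  · simpa using contDiff_const
  · simpa using contDiff_apply ℝ ℝ l

theorem insertNth_mem_cube {n : ℕ} (i : Fin (n + 1)) {ε : ℝ} (hε : ε ∈ Set.Icc (0 : ℝ) 1)
    {τ : Fin n → ℝ} (hτ : τ ∈ cube n) : (i.insertNth ε τ : Fin (n + 1) → ℝ) ∈ cube (n + 1) := by
  have h (j : Fin (n + 1)) : (i.insertNth ε τ : Fin (n + 1) → ℝ) j ∈ Set.Icc (0 : ℝ) 1 := by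
    refine Fin.succAboveCases i ?_ (fun l => ?_) j
    · simpa using hε
    · simpa using ⟨hτ.1 l, hτ.2 l⟩
  exact ⟨fun j => (h j).1, fun j => (h j).2⟩

/-- Moving row `i` to the front produces the sign. Afterwards the determinant depends only on the
face as a singular cube, so that equal faces can be compared. -/
theorem pullbackField_insertNth {n : ℕ} {σ : (Fin (n + 1) → ℝ) → (Fin (n + 1) → ℂ)}
    (hσ : ContDiff ℝ ∞ σ) (W : (Fin (n + 1) → ℝ) → (Fin (n + 1) → ℂ)) (i : Fin (n + 1)) (ε : ℝ)
    (τ : Fin n → ℝ) :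
    pullbackField σ W (i.insertNth ε τ) i = (-1) ^ (i : ℕ) *
      faceDet (fun τ' => σ (i.insertNth ε τ')) (W (i.insertNth ε τ)) τ := by
  have hrow (l : Fin n) : fderiv ℝ (fun τ' => σ (i.insertNth ε τ')) τ (Pi.single l 1) =
      fderiv ℝ σ (i.insertNth ε τ) (Pi.single (i.succAbove l) 1) := by
    have h1 : HasFDerivAt σ (fderiv ℝ σ (i.insertNth ε τ)) (i.insertNth ε τ) :=
      (hσ.differentiable (by simp) _).hasFDerivAt
    have h2 : HasFDerivAt (fun τ' => σ (i.insertNth ε τ')) _ τ :=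
      HasFDerivAt.comp (g := σ) τ h1 (hasFDerivAt_insertNth i ε τ)
    rw [h2.fderiv, ContinuousLinearMap.comp_apply]
    congr 1
    funext j
    refine Fin.succAboveCases i ?_ (fun r => ?_) j
    · simp
    · simp [Pi.single_apply, Fin.succAbove_right_injective.eq_iff]
  have hupd : Function.update (fun l => fderiv ℝ σ (i.insertNth ε τ) (Pi.single l 1)) i
      (W (i.insertNth ε τ)) = i.insertNth (α := fun _ => Fin (n + 1) → ℂ) (W (i.insertNth ε τ))
        fun l => fderiv ℝ (fun τ' => σ (i.insertNth ε τ')) τ (Pi.single l 1) := by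
    funext j
    refine Fin.succAboveCases i ?_ (fun r => ?_) j
    · simp
    · simp [hrow]
  rw [pullbackField, hupd]
  refine ((Matrix.detRowAlternating (R := ℂ) (n := Fin (n + 1))).map_insertNth i _ _).trans ?_
  rw [zsmul_eq_mul]
  push_cast
  rfl

/-- Faces are known to agree on the closed cube only, so their derivatives are compared at interior
points. -/
theorem faceDet_congr {n : ℕ} {c c' : (Fin n → ℝ) → (Fin (n + 1) → ℂ)} (h : Set.EqOn c c' (cube n))
    (v : Fin (n + 1) → ℂ) {τ : Fin n → ℝ} (hτ : τ ∈ openCube n) :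
    faceDet c v τ = faceDet c' v τ := by
  have : c =ᶠ[𝓝 τ] c' :=
    ((h.mono (openCube_subset n)).eventuallyEq_of_mem ((isOpen_openCube n).mem_nhds hτ))
  rw [faceDet, faceDet, this.fderiv_eq]

/-- The partial derivative in the idle coordinate is a zero row. -/
theorem faceDet_eq_zero_of_isDegenerate {n : ℕ} {c : (Fin n → ℝ) → (Fin (n + 1) → ℂ)}
    (hc : IsDegenerate c) (hdiff : Differentiable ℝ c) (v : Fin (n + 1) → ℂ) {τ : Fin n → ℝ}
    (hτ : τ ∈ openCube n) : faceDet c v τ = 0 := by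
  obtain ⟨i, hi⟩ := hc
  have h1 : HasDerivAt (fun r => c (Function.update τ i r)) (fderiv ℝ c τ (Pi.single i 1))
      (τ i) := by
    have := (hdiff (Function.update τ i (τ i))).hasFDerivAt.comp_hasDerivAt (τ i)
      (hasDerivAt_update τ i (τ i))
    rwa [Function.update_eq_self] at this
  have h2 : (fun r => c (Function.update τ i r)) =ᶠ[𝓝 (τ i)] fun _ => c τ := by
    filter_upwards [isOpen_Ioo.mem_nhds (hτ i trivial)] with r hr
    exact hi τ (openCube_subset n hτ) r ⟨hr.1.le, hr.2.le⟩
  have h3 : fderiv ℝ c τ (Pi.single i 1) = 0 :=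
    h1.unique ((hasDerivAt_const (τ i) (c τ)).congr_of_eventuallyEq h2)
  exact (detRows (n + 1)).map_coord_zero i.succ (by simp [h3])

/-- The contributions of the faces of a cycle cancel. -/
theorem sum_integral_faces_eq_zero {n : ℕ} {ι : Type*} [Fintype ι]
    (c : ι → (Fin n → ℝ) → (Fin (n + 1) → ℂ)) (hc : ∀ e, ContDiff ℝ ∞ (c e))
    (φ : ι → (Fin n → ℝ) → ℂ) (hφ : ∀ e, ContinuousOn (φ e) (cube n)) (sg : ι → ℂ)
    (w : (Fin (n + 1) → ℂ) → (Fin (n + 1) → ℂ))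
    (hw : ∀ e, ContinuousOn (fun τ => w (c e τ)) (cube n))
    (hclosed : ∀ c₀ : (Fin n → ℝ) → (Fin (n + 1) → ℂ), ¬ IsDegenerate c₀ → ∀ τ ∈ cube n,
      ∑ e, sg e * (open Classical in if Set.EqOn (c e) c₀ (cube n) then φ e τ else 0) = 0) :
    ∑ e, sg e * ∫ τ in cube n, φ e τ * faceDet (c e) (w (c e τ)) τ = 0 := by
  classical
  have hint (e : ι) : IntegrableOn (fun τ => φ e τ * faceDet (c e) (w (c e τ)) τ) (cube n) := by
    refine ((hφ e).mul ?_).integrableOn_compact (isCompact_cube n)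
    refine (detRows (n + 1)).cont.comp_continuousOn (continuousOn_pi.2 fun j => ?_)
    refine Fin.cases ?_ (fun l => ?_) j
    · exact hw e
    · exact (((hc e).continuous_fderiv (by simp)).clm_apply continuous_const).continuousOn
  -- Faces are grouped by their restriction to the cube; within a group the determinant is common
  -- and the branches add up as in the cycle condition.
  let key (e : ι) : cube n → (Fin (n + 1) → ℂ) := fun τ => c e τ
  have hkey {e e' : ι} : key e = key e' ↔ Set.EqOn (c e) (c e') (cube n) :=
    ⟨fun h τ hτ => congrFun h ⟨τ, hτ⟩, fun h => funext fun τ => h τ.2⟩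
  rw [← Finset.sum_fiberwise_of_maps_to (t := Finset.univ.image key) (g := key)
    fun e _ => Finset.mem_image_of_mem _ (Finset.mem_univ e)]
  refine Finset.sum_eq_zero fun k hk => ?_
  obtain ⟨e₀, -, rfl⟩ := Finset.mem_image.1 hk
  have hswap : ∑ e with key e = key e₀, sg e * ∫ τ in cube n, φ e τ * faceDet (c e) (w (c e τ)) τ =
      ∫ τ in cube n, ∑ e with key e = key e₀, sg e * (φ e τ * faceDet (c e) (w (c e τ)) τ) := by
    rw [integral_finsetSum _ fun e _ => (hint e).const_mul _]
    exact Finset.sum_congr rfl fun e _ => (integral_const_mul _ _).symm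
  -- The boundary of the cube is negligible, and in the interior the determinants within a group
  -- coincide.
  rw [hswap, ← setIntegral_congr_set (openCube_ae_eq n)]
  refine setIntegral_eq_zero_of_forall_eq_zero fun τ hτ => ?_
  have hτ' := openCube_subset n hτ
  have hsame : ∑ e with key e = key e₀, sg e * (φ e τ * faceDet (c e) (w (c e τ)) τ) =
      (∑ e with key e = key e₀, sg e * φ e τ) * faceDet (c e₀) (w (c e₀ τ)) τ := by
    rw [Finset.sum_mul]
    refine Finset.sum_congr rfl fun e he => ?_
    have := hkey.1 (Finset.mem_filter.1 he).2
    rw [this hτ', faceDet_congr this _ hτ, mul_assoc]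
  rw [hsame]
  by_cases hdeg : IsDegenerate (c e₀)
  · rw [faceDet_eq_zero_of_isDegenerate hdeg ((hc e₀).differentiable (by simp)) _ hτ, mul_zero]
  · have := hclosed _ hdeg τ hτ'
    simp only [mul_ite, mul_zero, ← hkey] at this
    rw [Finset.sum_filter, this, zero_mul]

/-- Stokes' theorem: the integral of the divergence of a vector field over a twisted cycle vanishes.
The densities `φ a` have logarithmic derivative `ρ`. -/
theorem sum_integral_divergence_eq_zero {n size : ℕ}
    (σ : Fin size → (Fin (n + 1) → ℝ) → (Fin (n + 1) → ℂ)) (hσ : ∀ a, ContDiff ℝ ∞ (σ a))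
    (φ : Fin size → (Fin (n + 1) → ℝ) → ℂ) (hφ : ∀ a, ContinuousOn (φ a) (cube (n + 1)))
    (ρ : (Fin (n + 1) → ℂ) → (Fin (n + 1) → ℂ) →L[ℂ] ℂ)
    (hφ' : ∀ a, ∀ τ ∈ openCube (n + 1), HasFDerivAt (φ a)
      (φ a τ • ((ρ (σ a τ)).restrictScalars ℝ).comp (fderiv ℝ (σ a) τ)) τ)
    (w : (Fin (n + 1) → ℂ) → (Fin (n + 1) → ℂ))
    (w' : (Fin (n + 1) → ℂ) → (Fin (n + 1) → ℂ) →L[ℂ] (Fin (n + 1) → ℂ))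
    (hw : ∀ a, ∀ τ ∈ cube (n + 1), HasFDerivAt w (w' (σ a τ)) (σ a τ))
    (hdiv : ∀ a, ContinuousOn (fun τ => ∑ j, (ρ (σ a τ) (Pi.single j 1) * w (σ a τ) j +
      w' (σ a τ) (Pi.single j 1) j)) (cube (n + 1)))
    (hclosed : ∀ c : (Fin n → ℝ) → (Fin (n + 1) → ℂ), ¬ IsDegenerate c → ∀ τ ∈ cube n,
      ∑ a, ∑ i : Fin (n + 1), (-1 : ℂ) ^ (i : ℕ) *
        (faceCoeff (σ a) (φ a) i 1 c τ - faceCoeff (σ a) (φ a) i 0 c τ) = 0) :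
    ∑ a, ∫ τ in cube (n + 1), φ a τ * (∑ j, (ρ (σ a τ) (Pi.single j 1) * w (σ a τ) j +
      w' (σ a τ) (Pi.single j 1) j)) * jac (σ a) τ = 0 := by
  classical
  let W (a : Fin size) (τ : Fin (n + 1) → ℝ) : Fin (n + 1) → ℂ := φ a τ • w (σ a τ)
  -- The derivative of the field φ w, pulled back by `σ a`, is φ A composed with the derivative of
  -- `σ a`. The trace of `A` is the twisted divergence ρ(w) + div w.
  let A (a : Fin size) (τ : Fin (n + 1) → ℝ) : (Fin (n + 1) → ℂ) →L[ℂ] (Fin (n + 1) → ℂ) :=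
    (ρ (σ a τ)).smulRight (w (σ a τ)) + w' (σ a τ)
  let W' (a : Fin size) (τ : Fin (n + 1) → ℝ) : (Fin (n + 1) → ℝ) →L[ℝ] (Fin (n + 1) → ℂ) :=
    φ a τ • ((A a τ).restrictScalars ℝ).comp (fderiv ℝ (σ a) τ)
  have hwc (a : Fin size) : ContinuousOn (fun τ => w (σ a τ)) (cube (n + 1)) := fun τ hτ =>
    ((hw a τ hτ).continuousAt.comp (hσ a).continuous.continuousAt).continuousWithinAt
  have hW' (a : Fin size) {τ} (hτ : τ ∈ openCube (n + 1)) : HasFDerivAt (W a) (W' a τ) τ := by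
    have h1 : HasFDerivAt (σ a) (fderiv ℝ (σ a) τ) τ :=
      ((hσ a).differentiable (by simp) τ).hasFDerivAt
    have h2 := ((hw a τ (openCube_subset _ hτ)).restrictScalars ℝ).comp τ h1
    convert! (hφ' a τ hτ).smul h2 using 1
    refine ContinuousLinearMap.ext fun v => funext fun j => ?_
    simp [W', A, mul_assoc, add_comm]
  have hdivW (a : Fin size) (τ : Fin (n + 1) → ℝ) :
      ∑ i, pullbackFieldDeriv (σ a) (W a) (W' a τ) τ (Pi.single i 1) i =
        φ a τ * (∑ j, (ρ (σ a τ) (Pi.single j 1) * w (σ a τ) j +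
      w' (σ a τ) (Pi.single j 1) j)) * jac (σ a) τ := by
    rw [sum_pullbackFieldDeriv (hσ a), jac_eq_detRows, mul_assoc]
    have := sum_detRows_update_eq_trace_mul (fun l => fderiv ℝ (σ a) τ (Pi.single l 1)) (A a τ)
    refine Eq.trans ?_ (congrArg (φ a τ * ·) this)
    rw [Finset.mul_sum]
    refine Finset.sum_congr rfl fun i _ => ?_
    exact (Matrix.detRowAlternating (R := ℂ) (n := Fin (n + 1))).map_update_smul _ i _ _
  have hbox (a : Fin size) : ∫ τ in cube (n + 1), φ a τ *
      (∑ j, (ρ (σ a τ) (Pi.single j 1) * w (σ a τ) j + w' (σ a τ) (Pi.single j 1) j)) *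
        jac (σ a) τ = ∑ i : Fin (n + 1),
      ((∫ τ in cube n, pullbackField (σ a) (W a) (i.insertNth 1 τ) i) -
        ∫ τ in cube n, pullbackField (σ a) (W a) (i.insertNth 0 τ) i) := by
    simp_rw [← hdivW]
    refine integral_divergence_of_hasFDerivAt_off_countable (0 : Fin (n + 1) → ℝ) 1
      (by intro i; simp) (pullbackField (σ a) (W a))
      (fun τ => pullbackFieldDeriv (σ a) (W a) (W' a τ) τ) ∅ Set.countable_empty ?_ ?_ ?_
    · refine continuousOn_pi.2 fun i => (detRows (n + 1)).cont.comp_continuousOn ?_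
      refine continuousOn_pi.2 fun l => ?_
      rcases eq_or_ne l i with rfl | hl
      · simpa using! (hφ a).smul (hwc a)
      simp only [Function.update_of_ne hl]
      exact (((hσ a).continuous_fderiv (by simp)).clm_apply continuous_const).continuousOn
    · intro τ hτ
      exact hasFDerivAt_pullbackField (hσ a) (hW' a hτ.1)
    · simp_rw [hdivW]
      refine (((hφ a).mul (hdiv a)).mul (Continuous.continuousOn ?_)).integrableOn_compact
        (isCompact_cube _)
      rw [funext (jac_eq_detRows (σ a))]
      exact (detRows (n + 1)).cont.comp (continuous_pi fun l =>
        ((hσ a).continuous_fderiv (by simp)).clm_apply continuous_const)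
  -- Faces are indexed by the cube, the direction and the end. Both the cycle condition and the move
  -- of row `i` to the front contribute the sign (-1)^i.
  have hfaces := sum_integral_faces_eq_zero (ι := (Fin size × Fin (n + 1)) × Bool)
    (fun e τ => σ e.1.1 (e.1.2.insertNth (if e.2 then 1 else 0) τ))
    (fun e => (hσ _).comp (contDiff_insertNth _ _))
    (fun e τ => φ e.1.1 (e.1.2.insertNth (if e.2 then 1 else 0) τ))
    (fun e => (hφ _).comp (contDiff_insertNth _ _).continuous.continuousOn fun τ hτ =>
      insertNth_mem_cube _ (by split_ifs <;> simp) hτ)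
    (fun e => (-1) ^ (e.1.2 : ℕ) * if e.2 then 1 else -1) w
    (fun e => (hwc _).comp (contDiff_insertNth _ _).continuous.continuousOn fun τ hτ =>
      insertNth_mem_cube _ (by split_ifs <;> simp) hτ)
    (fun c hc τ hτ => by
      refine Eq.trans ?_ (hclosed c hc τ hτ)
      rw [Fintype.sum_prod_type, Fintype.sum_prod_type]
      refine Finset.sum_congr rfl fun a _ => Finset.sum_congr rfl fun i _ => ?_
      rw [Fintype.sum_bool]
      simp only [faceCoeff, if_true, Bool.false_eq_true, if_false]
      ring)
  rw [← hfaces, Fintype.sum_prod_type, Fintype.sum_prod_type]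
  refine Finset.sum_congr rfl fun a _ => ?_
  rw [hbox]
  refine Finset.sum_congr rfl fun i _ => ?_
  have hface (ε : ℝ) : ∫ τ in cube n, pullbackField (σ a) (W a) (i.insertNth ε τ) i =
      (-1) ^ (i : ℕ) * ∫ τ in cube n, φ a (i.insertNth ε τ) *
        faceDet (fun τ' => σ a (i.insertNth ε τ')) (w (σ a (i.insertNth ε τ))) τ := by
    rw [← integral_const_mul]
    refine integral_congr_ae (Eventually.of_forall fun τ => ?_)
    change pullbackField (σ a) (W a) (i.insertNth ε τ) i = _
    rw [pullbackField_insertNth (hσ a)]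
    congr 1
    have := (Matrix.detRowAlternating (R := ℂ) (n := Fin (n + 1))).map_update_smul
      (Fin.cons (w (σ a (i.insertNth ε τ)))
        fun l => fderiv ℝ (fun τ' => σ a (i.insertNth ε τ')) τ (Pi.single l 1)) 0
      (φ a (i.insertNth ε τ)) (w (σ a (i.insertNth ε τ)))
    simpa only [Fin.update_cons_zero] using! this
  rw [hface, hface]
  simp
  ring

end

section

/-! ### The factors of the integrand -/

open MeasureTheory Filter Topology

/-- The index type of the factors of the integrand. -/
abbrev FactorIdx (n : ℕ) : Type :=
  Fin (2 * n + 1) ⊕ Fin (n + 1) ⊕ Fin (n + 1) ⊕ Unit ⊕ Unit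

/-- The spaces of the variables `x` and `q` together. -/
abbrev VarSpace (n : ℕ) : Type := (Fin (2 * n + 1) → ℂ) × (Fin (n + 1) → ℂ)

/-- The functions whose powers make up the integrand. -/
def factor {n : ℕ} (t : Fin n → ℂ) : FactorIdx n → VarSpace n → ℂ :=
  Sum.elim (fun α p => p.1 α) <| Sum.elim (fun j p => uVar t j p.1) <|
    Sum.elim (fun j p => p.2 j) <| Sum.elim (fun _ p => 1 + ∑ j, p.2 j)
      (fun _ p => 1 + ∑ j, uVar t j p.1 / p.2 j)

/-- The exponents in the integrand. -/
def exponent {n : ℕ} (s : ℂ) (k : Fin (n + 2) → ℂ) : FactorIdx n → ℂ :=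
  Sum.elim (fun _ => s) <| Sum.elim (fun j => -k j.castSucc) <|
    Sum.elim (fun j => 2 * k j.castSucc - 1) <| Sum.elim (fun _ => s - ∑ i, k i)
      (fun _ => s + ∑ i, k i)

/-- The set where no factor vanishes. -/
def regularSet {n : ℕ} (t : Fin n → ℂ) : Set (VarSpace n) := {p | ∀ e, factor t e p ≠ 0}

/-- The set where the factors are smooth. -/
def smoothSet (n : ℕ) : Set (VarSpace n) := {p | (∀ α, p.1 α ≠ 0) ∧ ∀ j, p.2 j ≠ 0}

theorem isOpen_smoothSet (n : ℕ) : IsOpen (smoothSet n) := by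
  have : smoothSet n = (⋂ α, {p : VarSpace n | p.1 α ≠ 0}) ∩ ⋂ j, {p : VarSpace n | p.2 j ≠ 0} := by
    ext p
    simp [smoothSet]
  rw [this]
  refine (isOpen_iInter_of_finite fun α => ?_).inter (isOpen_iInter_of_finite fun j => ?_)
  · exact isOpen_ne.preimage (by fun_prop : Continuous fun p : VarSpace n => p.1 α)
  · exact isOpen_ne.preimage (by fun_prop : Continuous fun p : VarSpace n => p.2 j)

theorem contDiffOn_uVar {n : ℕ} (t : Fin n → ℂ) (j : Fin (n + 1)) :
    ContDiffOn ℂ ∞ (fun p : VarSpace n => uVar t j p.1) (smoothSet n) := by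
  unfold uVar
  simp_rw [mul_div_mul_comm]
  refine (ContDiffOn.div (f := fun p : VarSpace n => ∏ α, (p.1 α - node t j))
    (g := fun p => ∏ α, p.1 α) ?_ ?_ ?_).mul contDiffOn_const
  · exact ContDiff.contDiffOn (contDiff_prod fun α _ => by fun_prop)
  · exact ContDiff.contDiffOn (contDiff_prod fun α _ => by fun_prop)
  · exact fun p hp => Finset.prod_ne_zero_iff.2 fun α _ => hp.1 α

theorem contDiffOn_factor {n : ℕ} (t : Fin n → ℂ) (e : FactorIdx n) :
    ContDiffOn ℂ ∞ (factor t e) (smoothSet n) := by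
  rcases e with α | j | j | _ | _
  · exact ContDiff.contDiffOn (by change ContDiff ℂ ∞ fun p : VarSpace n => p.1 α; fun_prop)
  · exact contDiffOn_uVar t j
  · exact ContDiff.contDiffOn (by change ContDiff ℂ ∞ fun p : VarSpace n => p.2 j; fun_prop)
  · exact ContDiff.contDiffOn
      (by change ContDiff ℂ ∞ fun p : VarSpace n => 1 + ∑ j, p.2 j; fun_prop)
  · refine contDiffOn_const.add (ContDiffOn.sum fun j _ => ?_)
    exact (contDiffOn_uVar t j).div
      (ContDiff.contDiffOn (by change ContDiff ℂ ∞ fun p : VarSpace n => p.2 j; fun_prop))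
      fun p hp => hp.2 j

theorem regularSet_subset {n : ℕ} (t : Fin n → ℂ) : regularSet t ⊆ smoothSet n := fun _ hp =>
  ⟨fun α => hp (.inl α), fun j => hp (.inr (.inr (.inl j)))⟩

theorem isOpen_regularSet {n : ℕ} (t : Fin n → ℂ) : IsOpen (regularSet t) := by
  have : regularSet t = ⋂ e, smoothSet n ∩ factor t e ⁻¹' {0}ᶜ := by
    ext p
    simp only [Set.mem_iInter, Set.mem_inter_iff, Set.mem_preimage, Set.mem_compl_iff,
      Set.mem_singleton_iff]
    exact ⟨fun h e => ⟨regularSet_subset t h, h e⟩, fun h e => (h e).2⟩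
  rw [this]
  exact isOpen_iInter_of_finite fun e =>
    (contDiffOn_factor t e).continuousOn.isOpen_inter_preimage (isOpen_smoothSet n)
      isOpen_compl_singleton

theorem differentiableAt_factor {n : ℕ} {t : Fin n → ℂ} {p : VarSpace n} (hp : p ∈ smoothSet n)
    (e : FactorIdx n) : DifferentiableAt ℂ (factor t e) p :=
  ((contDiffOn_factor t e).differentiableOn (by simp)).differentiableAt
    ((isOpen_smoothSet n).mem_nhds hp)

/-- The logarithmic derivative of the integrand. -/
def logDeriv {n : ℕ} (t : Fin n → ℂ) (s : ℂ) (k : Fin (n + 2) → ℂ) (p : VarSpace n) :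
    VarSpace n →L[ℂ] ℂ :=
  ∑ e, exponent s k e • (factor t e p)⁻¹ • fderiv ℂ (factor t e) p

theorem contDiffOn_logDeriv {n : ℕ} (t : Fin n → ℂ) (s : ℂ) (k : Fin (n + 2) → ℂ) :
    ContDiffOn ℂ ∞ (logDeriv t s k) (regularSet t) := by
  refine ContDiffOn.sum fun e _ => ContDiffOn.const_smul _ (ContDiffOn.smul
    (f := fun p => (factor t e p)⁻¹) (g := fun p => fderiv ℂ (factor t e) p) ?_ ?_)
  · exact ((contDiffOn_factor t e).mono (regularSet_subset t)).inv fun p hp => hp e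
  · exact ((contDiffOn_factor t e).fderiv_of_isOpen (isOpen_smoothSet n) (by simp)).mono
      (regularSet_subset t)

/-! ### Branches of the integrand -/

/-- Collecting the five families of logarithms under a single index type lets every factor be
treated alike. -/
theorem IsBranch.exists_logs {n : ℕ} {t : Fin n → ℂ} {s : ℂ} {k : Fin (n + 2) → ℂ}
    {U : Set (Fin (2 * n + 1) → ℂ)} {σ : (Fin (n + 1) → ℝ) → (Fin (n + 1) → ℂ)}
    {Φ : (Fin (2 * n + 1) → ℂ) → (Fin (n + 1) → ℝ) → ℂ} (h : IsBranch t s k U σ Φ) :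
    ∃ (c : ℂ) (l : FactorIdx n → (Fin (2 * n + 1) → ℂ) × (Fin (n + 1) → ℝ) → ℂ),
      (∀ e, ContinuousOn (l e) (U ×ˢ cube (n + 1))) ∧ ∀ x ∈ U, ∀ τ ∈ cube (n + 1),
        (∀ e, Complex.exp (l e (x, τ)) = factor t e (x, σ τ)) ∧
        Φ x τ = c * ∏ e, Complex.exp (exponent s k e * l e (x, τ)) := by
  obtain ⟨c, lx, lu, lq, lA, lB, h1, h2, h3, h4, h5, h⟩ := h
  refine ⟨c, Sum.elim lx (Sum.elim lu (Sum.elim lq (Sum.elim (fun _ => lA) fun _ => lB))), ?_, ?_⟩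
  · rintro (α | j | j | _ | _)
    exacts [h1 α, h2 j, h3 j, h4, h5]
  · intro x hx τ hτ
    obtain ⟨g1, g2, g3, g4, g5, g⟩ := h x hx τ hτ
    refine ⟨?_, ?_⟩
    · rintro (α | j | j | _ | _)
      exacts [g1 α, g2 j, g3 j, g4, g5]
    · rw [g]
      simp only [Fintype.prod_sum_type, exponent, Sum.elim_inl, Sum.elim_inr, Finset.univ_unique,
        Finset.prod_singleton]
      ring

theorem hasFDerivAt_prod_exp {𝕜 E ι : Type*} [NontriviallyNormedField 𝕜] [NormedAlgebra 𝕜 ℂ]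
    [NormedAddCommGroup E] [NormedSpace 𝕜 E] [Fintype ι] {l f : ι → E → ℂ} {f' : ι → E →L[𝕜] ℂ}
    {x : E} (c : ℂ) (w : ι → ℂ) (hl : ∀ e, ContinuousAt (l e) x)
    (hexp : ∀ e, ∀ᶠ y in 𝓝 x, Complex.exp (l e y) = f e y)
    (hf : ∀ e, HasFDerivAt (f e) (f' e) x) :
    HasFDerivAt (fun y => c * ∏ e, Complex.exp (w e * l e y))
      ((c * ∏ e, Complex.exp (w e * l e x)) • ∑ e, w e • (f e x)⁻¹ • f' e) x := by
  simp_rw [← Complex.exp_sum]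
  have h1 : HasFDerivAt (fun y => ∑ e, w e * l e y) (∑ e, w e • (f e x)⁻¹ • f' e) x :=
    HasFDerivAt.fun_sum fun e _ => (hasFDerivAt_of_exp_eq (hl e) (hexp e) (hf e)).const_smul (w e)
  have h2 : HasFDerivAt Complex.exp
      (Complex.exp (∑ e, w e * l e x) • ContinuousLinearMap.id 𝕜 ℂ) (∑ e, w e * l e x) := by
    convert! (Complex.hasDerivAt_exp (∑ e, w e * l e x)).hasFDerivAt.restrictScalars 𝕜 using 1
    ext
    simp [mul_comm]
  have h3 := (HasFDerivAt.comp (g := Complex.exp) x h2 h1).const_smul c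
  convert! h3 using 1
  ext v
  simp [mul_assoc]

section Branch

variable {n : ℕ} {t : Fin n → ℂ} {s : ℂ} {k : Fin (n + 2) → ℂ}
  {U : Set (Fin (2 * n + 1) → ℂ)} {σ : (Fin (n + 1) → ℝ) → (Fin (n + 1) → ℂ)}
  {Φ : (Fin (2 * n + 1) → ℂ) → (Fin (n + 1) → ℝ) → ℂ}

theorem IsBranch.mem_regularSet (h : IsBranch t s k U σ Φ) {x : Fin (2 * n + 1) → ℂ} (hx : x ∈ U)
    {τ : Fin (n + 1) → ℝ} (hτ : τ ∈ cube (n + 1)) : (x, σ τ) ∈ regularSet t := by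
  obtain ⟨c, l, -, hl⟩ := h.exists_logs
  exact fun e => (hl x hx τ hτ).1 e ▸ Complex.exp_ne_zero _

theorem IsBranch.continuousOn (h : IsBranch t s k U σ Φ) :
    ContinuousOn (Function.uncurry Φ) (U ×ˢ cube (n + 1)) := by
  obtain ⟨c, l, hc, hl⟩ := h.exists_logs
  refine ContinuousOn.congr (f := fun p => c * ∏ e, Complex.exp (exponent s k e * l e p)) ?_
    fun p hp => (hl p.1 hp.1 p.2 hp.2).2
  refine continuousOn_const.mul (continuousOn_finsetProd _ fun e _ => ?_)
  exact (continuousOn_const.mul (hc e)).cexp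

theorem IsBranch.hasFDerivAt_left (h : IsBranch t s k U σ Φ) (hU : IsOpen U)
    {x : Fin (2 * n + 1) → ℂ} (hx : x ∈ U) {τ : Fin (n + 1) → ℝ} (hτ : τ ∈ cube (n + 1)) :
    HasFDerivAt (Φ · τ) (Φ x τ • (logDeriv t s k (x, σ τ)).comp (ContinuousLinearMap.inl ℂ _ _))
      x := by
  have hreg := h.mem_regularSet hx hτ
  obtain ⟨c, l, hc, hl⟩ := h.exists_logs
  have hfac (e : FactorIdx n) : HasFDerivAt (fun y => factor t e (y, σ τ))
      ((fderiv ℂ (factor t e) (x, σ τ)).comp (ContinuousLinearMap.inl ℂ _ _)) x :=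
    HasFDerivAt.comp (g := factor t e) x
      (differentiableAt_factor (regularSet_subset t hreg) e).hasFDerivAt
      (hasFDerivAt_prodMk_left x (σ τ))
  have hmain := hasFDerivAt_prod_exp (l := fun e y => l e (y, τ))
    (f := fun e y => factor t e (y, σ τ)) c (exponent s k)
    (fun e => ((hc e).comp (f := fun y => (y, τ)) (by fun_prop) fun y hy =>
      (⟨hy, hτ⟩ : (y, τ) ∈ U ×ˢ cube (n + 1))).continuousAt (hU.mem_nhds hx))
    (fun e => by
      filter_upwards [hU.mem_nhds hx] with y hy using (hl y hy τ hτ).1 e) hfac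
  rw [← (hl x hx τ hτ).2] at hmain
  refine (hmain.congr_of_eventuallyEq ?_).congr_fderiv ?_
  · filter_upwards [hU.mem_nhds hx] with y hy using (hl y hy τ hτ).2
  · ext v
    simp [logDeriv]

theorem IsBranch.hasFDerivAt_right (h : IsBranch t s k U σ Φ) (hσ : ContDiff ℝ ∞ σ)
    {x : Fin (2 * n + 1) → ℂ} (hx : x ∈ U) {τ : Fin (n + 1) → ℝ} (hτ : τ ∈ openCube (n + 1)) :
    HasFDerivAt (Φ x) (Φ x τ • (((logDeriv t s k (x, σ τ)).comp
      (ContinuousLinearMap.inr ℂ _ _)).restrictScalars ℝ).comp (fderiv ℝ σ τ)) τ := by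
  have hreg := h.mem_regularSet hx (openCube_subset _ hτ)
  have hnhds : openCube (n + 1) ∈ 𝓝 τ := (isOpen_openCube _).mem_nhds hτ
  obtain ⟨c, l, hc, hl⟩ := h.exists_logs
  have hfac (e : FactorIdx n) : HasFDerivAt (fun τ => factor t e (x, σ τ))
      ((((fderiv ℂ (factor t e) (x, σ τ)).comp
        (ContinuousLinearMap.inr ℂ _ _)).restrictScalars ℝ).comp (fderiv ℝ σ τ)) τ := by
    have h1 : HasFDerivAt (fun q => factor t e (x, q)) _ (σ τ) :=
      HasFDerivAt.comp (g := factor t e) (σ τ)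
        (differentiableAt_factor (regularSet_subset t hreg) e).hasFDerivAt
        (hasFDerivAt_prodMk_right x (σ τ))
    exact (h1.restrictScalars ℝ).comp τ (hσ.differentiable (by simp) τ).hasFDerivAt
  have hmain := hasFDerivAt_prod_exp (l := fun e τ => l e (x, τ))
    (f := fun e τ => factor t e (x, σ τ)) c (exponent s k)
    (fun e => ((hc e).comp (f := fun τ => (x, τ)) (t := U ×ˢ cube (n + 1)) (by fun_prop)
      fun τ hτ => ⟨hx, openCube_subset _ hτ⟩).continuousAt hnhds)
    (fun e => by
      filter_upwards [hnhds] with τ hτ using (hl x hx τ (openCube_subset _ hτ)).1 e) hfac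
  rw [← (hl x hx τ (openCube_subset _ hτ)).2] at hmain
  refine (hmain.congr_of_eventuallyEq ?_).congr_fderiv ?_
  · filter_upwards [hnhds] with τ hτ using (hl x hx τ (openCube_subset _ hτ)).2
  · ext v
    simp [logDeriv]

end Branch

end

/-! ### Interpolation identities -/

open Polynomial in
-- The two sums together form the divided difference of `N` over all nodes, that is its coefficient
-- of degree |S| + |T| - 1, which is zero.
theorem sum_eval_div_eq_neg {ι κ : Type*} [DecidableEq ι] [DecidableEq κ] (S : Finset ι)
    (T : Finset κ) (x : ι → ℂ) (c : κ → ℂ) (hx : Set.InjOn x S) (hc : Function.Injective c)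
    (hxc : ∀ α ∈ S, ∀ i, x α ≠ c i) (N : ℂ[X]) (hN : N.degree < (S.card + T.card : ℕ))
    (h0 : N.coeff (S.card + T.card - 1) = 0) :
    ∑ α ∈ S, N.eval (x α) / ((∏ β ∈ S.erase α, (x α - x β)) * ∏ i ∈ T, (x α - c i)) =
      -∑ i ∈ T, N.eval (c i) / ((∏ α ∈ S, (c i - x α)) * ∏ j ∈ T.erase i, (c i - c j)) := by
  have hcard : (S.disjSum T).card = S.card + T.card := Finset.card_disjSum _ _
  have hinj : Set.InjOn (Sum.elim x c) (S.disjSum T : Finset (ι ⊕ κ)) := by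
    rintro (α | i) hα (β | j) hβ h
    · rw [hx (by simpa using hα) (by simpa using hβ) h]
    · exact absurd h (hxc α (by simpa using hα) j)
    · exact absurd h.symm (hxc β (by simpa using hβ) i)
    · rw [hc h]
  have key := Lagrange.coeff_eq_sum hinj (P := N) (by rwa [hcard])
  rw [hcard, h0, Finset.sum_disjSum] at key
  rw [eq_neg_iff_add_eq_zero, key]
  congr 1
  · refine Finset.sum_congr rfl fun α hα => ?_
    have : (S.disjSum T).erase (.inl α) = (S.erase α).disjSum T := by
      ext (_ | _) <;> simp
    rw [this, Finset.prod_disjSum]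
    simp
  · refine Finset.sum_congr rfl fun i hi => ?_
    have : (S.disjSum T).erase (.inr i) = S.disjSum (T.erase i) := by
      ext (_ | _) <;> simp
    rw [this, Finset.prod_disjSum]
    simp

section Interpolation

open Polynomial Lagrange

variable {n : ℕ} (t : Fin n → ℂ)

/-- The polynomial `∑ᵢ mᵢ ∏_{j ≠ i} (X - τⱼ)`, the product of `P` and `∑ᵢ mᵢ / (X - τᵢ)`. -/
def partialFrac (m : Fin (n + 2) → ℂ) : ℂ[X] :=
  ∑ i, C (m i) * nodal (Finset.univ.erase i) (sing t)

theorem natDegree_nodal_erase (i : Fin (n + 2)) :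
    (nodal (Finset.univ.erase i) (sing t)).natDegree = n + 1 := by
  rw [natDegree_nodal, Finset.card_erase_of_mem (Finset.mem_univ _)]
  simp

theorem coeff_nodal_erase (i : Fin (n + 2)) :
    (nodal (Finset.univ.erase i) (sing t)).coeff (n + 1) = 1 := by
  have := nodal_monic (s := Finset.univ.erase i) (v := sing t)
  rwa [Monic, leadingCoeff, natDegree_nodal_erase] at this

theorem natDegree_partialFrac_le (m : Fin (n + 2) → ℂ) : (partialFrac t m).natDegree ≤ n + 1 :=
  natDegree_sum_le_of_forall_le _ _ fun i _ =>
    (natDegree_C_mul_le _ _).trans (natDegree_nodal_erase t i).le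

theorem coeff_partialFrac (m : Fin (n + 2) → ℂ) :
    (partialFrac t m).coeff (n + 1) = ∑ i, m i := by
  simp [partialFrac, coeff_nodal_erase]

theorem eval_nodal_erase_of_ne {i l : Fin (n + 2)} (h : i ≠ l) :
    (nodal (Finset.univ.erase l) (sing t)).eval (sing t i) = 0 :=
  eval_nodal_at_node (Finset.mem_erase.2 ⟨h, Finset.mem_univ _⟩)

theorem eval_nodal_erase_self (i : Fin (n + 2)) :
    (nodal (Finset.univ.erase i) (sing t)).eval (sing t i) = singDiff t i := by
  rw [eval_nodal, singDiff]

theorem eval_partialFrac_sing (m : Fin (n + 2) → ℂ) (i : Fin (n + 2)) :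
    (partialFrac t m).eval (sing t i) = m i * singDiff t i := by
  rw [partialFrac, eval_finsetSum, Finset.sum_eq_single i]
  · rw [eval_mul, eval_C, eval_nodal_erase_self]
  · intro l _ hl
    rw [eval_mul, eval_nodal_erase_of_ne t hl.symm, mul_zero]
  · simp

theorem eval_nodal_univ (y : ℂ) : (nodal Finset.univ (sing t)).eval y = polyP t y := by
  rw [eval_nodal, polyP]

theorem eval_nodal_erase {y : ℂ} (i : Fin (n + 2)) (hy : y ≠ sing t i) :
    (nodal (Finset.univ.erase i) (sing t)).eval y = polyP t y / (y - sing t i) := by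
  rw [eq_div_iff (sub_ne_zero.2 hy), eval_nodal, polyP, Finset.prod_erase_mul _ _
    (Finset.mem_univ i)]

theorem eval_partialFrac (m : Fin (n + 2) → ℂ) {y : ℂ} (hy : ∀ i, y ≠ sing t i) :
    (partialFrac t m).eval y = polyP t y * ∑ i, m i / (y - sing t i) := by
  rw [partialFrac, eval_finsetSum, Finset.mul_sum]
  refine Finset.sum_congr rfl fun i _ => ?_
  rw [eval_mul, eval_C, eval_nodal_erase t i (hy i)]
  ring

/-- The numerator of `e^{-φ} D e^φ`, when the logarithmic derivative of `e^φ` is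
`∑ᵢ (b Vᵢ - kᵢ) / (y - τᵢ)`. -/
def riccatiPoly (s b : ℂ) (k V : Fin (n + 2) → ℂ) : ℂ[X] :=
  partialFrac t (fun i => b * V i - k i) ^ 2 +
    nodal Finset.univ (sing t) * derivative (partialFrac t (fun i => b * V i - k i)) +
    C b * (∑ i, C (V i) * nodal (Finset.univ.erase i) (sing t) ^ 2 - partialFrac t V ^ 2) -
    C (s * (s + n + 1)) * (Polynomial.X ^ n * nodal Finset.univ (sing t)) -
    ∑ i, C (k i ^ 2 * singDiff t i) * nodal (Finset.univ.erase i) (sing t)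

variable {t} {s b : ℂ} {k V : Fin (n + 2) → ℂ}

theorem natDegree_riccatiPoly_le : (riccatiPoly t s b k V).natDegree ≤ 2 * n + 2 := by
  have h1 (m) := natDegree_partialFrac_le t m
  have h2 (m) : (partialFrac t m ^ 2).natDegree ≤ 2 * n + 2 :=
    (natDegree_pow_le_of_le 2 (h1 m)).trans (by omega)
  have h3 : (nodal Finset.univ (sing t)).natDegree ≤ n + 2 := by simp [natDegree_nodal]
  have hsub {p q : ℂ[X]} (hp : p.natDegree ≤ 2 * n + 2) (hq : q.natDegree ≤ 2 * n + 2) :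
      (p - q).natDegree ≤ 2 * n + 2 := (natDegree_sub_le_of_le hp hq).trans (by simp)
  refine hsub (hsub (natDegree_add_le_of_degree_le
    (natDegree_add_le_of_degree_le (h2 _) ?_) ?_) ?_) ?_
  · refine (natDegree_mul_le_of_le h3 ((natDegree_derivative_le _).trans
      (Nat.sub_le_sub_right (h1 _) 1))).trans (by omega)
  · refine (natDegree_C_mul_le _ _).trans 
      (hsub (natDegree_sum_le_of_forall_le _ _ fun i _ => ?_) (h2 _))
    exact (natDegree_C_mul_le _ _).trans ((natDegree_pow_le_of_le 2
      (natDegree_nodal_erase t i).le).trans (by omega))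
  · exact (natDegree_C_mul_le _ _).trans ((natDegree_mul_le_of_le (natDegree_X_pow_le n) h3).trans
      (by omega))
  · exact natDegree_sum_le_of_forall_le _ _ fun i _ =>
      ((natDegree_C_mul_le _ _).trans (natDegree_nodal_erase t i).le).trans (by omega)

/-- The contributions are s² from the square, (n+1) s from the derivative, b (1 - 1²) from the
variation of the V_i and -s (s + n + 1) from the potential. This is what fixes the constant in D. -/
theorem coeff_riccatiPoly (hn : 0 < n) (hb : b = s + ∑ i, k i) (hV : ∑ i, V i = 1) :
    (riccatiPoly t s b k V).coeff (2 * n + 2) = 0 := by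
  have hm : ∑ i, (b * V i - k i) = s := by
    rw [Finset.sum_sub_distrib, ← Finset.mul_sum, hV, hb]; ring
  have hsq (m) : (partialFrac t m ^ 2).coeff (2 * n + 2) = (∑ i, m i) ^ 2 := by
    rw [← coeff_partialFrac, ← coeff_pow_of_natDegree_le (natDegree_partialFrac_le t m)]
    rfl
  have hsq' (i) : (nodal (Finset.univ.erase i) (sing t) ^ 2).coeff (2 * n + 2) = 1 := by
    rw [show 2 * n + 2 = 2 * (n + 1) by ring, coeff_pow_of_natDegree_le
      (natDegree_nodal_erase t i).le, coeff_nodal_erase, one_pow]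
  have hdeg : (nodal Finset.univ (sing t)).natDegree = n + 2 := by simp [natDegree_nodal]
  have hmon : (nodal Finset.univ (sing t)).coeff (n + 2) = 1 := by
    have := nodal_monic (s := Finset.univ) (v := sing t)
    rwa [Monic, leadingCoeff, hdeg] at this
  have hder (m) : (nodal Finset.univ (sing t) * derivative (partialFrac t m)).coeff (2 * n + 2) =
      (n + 1) * ∑ i, m i := by
    rw [show 2 * n + 2 = (n + 2) + n by ring, coeff_mul_add_eq_of_natDegree_le hdeg.le
      ((natDegree_derivative_le _).trans
        (Nat.sub_le_sub_right (natDegree_partialFrac_le t m) 1) : _ ≤ n),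
      hmon, coeff_derivative, coeff_partialFrac]
    ring
  have hX : (Polynomial.X ^ n * nodal Finset.univ (sing t)).coeff (2 * n + 2) = 1 := by
    rw [show 2 * n + 2 = (n + 2) + n by ring, coeff_X_pow_mul, hmon]
  have hz (i) : (nodal (Finset.univ.erase i) (sing t)).coeff (2 * n + 2) = 0 :=
    coeff_eq_zero_of_natDegree_lt (by rw [natDegree_nodal_erase]; omega)
  simp only [riccatiPoly, coeff_sub, coeff_add, hsq, hder, hm, coeff_C_mul, finsetSum_coeff, hsq',
    hX, hz, hV, mul_one, mul_zero, Finset.sum_const_zero]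
  ring

/-- The residue term of D cancels the k_i² in (b V_i - k_i)², and what remains is divisible by b. -/
theorem eval_riccatiPoly_sing (i : Fin (n + 2)) :
    (riccatiPoly t s b k V).eval (sing t i) =
      singDiff t i ^ 2 * (b * ((b - 1) * V i ^ 2 + (1 - 2 * k i) * V i)) := by
  have h0 : (nodal Finset.univ (sing t)).eval (sing t i) = 0 :=
    eval_nodal_at_node (Finset.mem_univ i)
  have h1 (f : Fin (n + 2) → ℂ) :
      ∑ l, f l * (nodal (Finset.univ.erase l) (sing t)).eval (sing t i) = f i * singDiff t i := by
    rw [← eval_partialFrac_sing, partialFrac, eval_finsetSum]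
    simp
  have h2 : ∑ l, V l * (nodal (Finset.univ.erase l) (sing t)).eval (sing t i) ^ 2 =
      V i * singDiff t i ^ 2 := by
    rw [Finset.sum_eq_single i, eval_nodal_erase_self]
    · intro l _ hl
      rw [eval_nodal_erase_of_ne t hl.symm]
      ring
    · simp
  simp only [riccatiPoly, eval_sub, eval_add, eval_pow, eval_mul, h0, eval_C, eval_finsetSum,
    eval_partialFrac_sing, h1, h2]
  ring

theorem sum_partialFrac_div (T : Finset (Fin (2 * n + 1))) (hT : T.card = n + 2)
    {x : Fin (2 * n + 1) → ℂ} (hx : Set.InjOn x T) (m : Fin (n + 2) → ℂ) :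
    ∑ α ∈ T, (partialFrac t m).eval (x α) / ∏ β ∈ T.erase α, (x α - x β) = ∑ i, m i := by
  rw [← coeff_eq_sum hx, hT, ← coeff_partialFrac t m]
  · rfl
  · rw [hT]
    exact (degree_le_of_natDegree_le (natDegree_partialFrac_le t m)).trans_lt
      (by exact_mod_cast Nat.lt_succ_self _)

/-- The weight `P'(τᵢ) / ∏_{α ∈ S} (x_α - τᵢ)`. -/
def boundaryWeight {N : ℕ} (t : Fin n → ℂ) (S : Finset (Fin N)) (x : Fin N → ℂ)
    (i : Fin (n + 2)) : ℂ := singDiff t i / ∏ α ∈ S, (x α - sing t i)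

theorem singDiff_ne_zero (hs : Function.Injective (sing t)) (i : Fin (n + 2)) :
    singDiff t i ≠ 0 :=
  Finset.prod_ne_zero_iff.2 fun _ hj => sub_ne_zero.2 fun h => (Finset.mem_erase.1 hj).1 (hs h).symm

/-- There are (n+1) + (n+2) nodes and the coefficient of degree 2n+2 vanishes, so the sum over the
variables is minus the sum over the singular points. The sign comes from reversing n+1 differences.
-/
theorem sum_riccatiPoly_div (hn : 0 < n) (hs : Function.Injective (sing t)) {N : ℕ}
    (S : Finset (Fin N)) (hS : S.card = n + 1) {x : Fin N → ℂ} (hx : Set.InjOn x S)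
    (hxs : ∀ α ∈ S, ∀ i, x α ≠ sing t i) (hb : b = s + ∑ i, k i) (hV : ∑ i, V i = 1) :
    ∑ α ∈ S, (riccatiPoly t s b k V).eval (x α) /
      ((∏ β ∈ S.erase α, (x α - x β)) * polyP t (x α)) =
    (-1) ^ n * ∑ i, boundaryWeight t S x i *
      (b * ((b - 1) * V i ^ 2 + (1 - 2 * k i) * V i)) := by
  have := sum_eval_div_eq_neg S Finset.univ x (sing t) hx hs hxs (riccatiPoly t s b k V) ?_ ?_
  · simp only [polyP, this, eval_riccatiPoly_sing]
    rw [Finset.mul_sum, ← Finset.sum_neg_distrib]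
    refine Finset.sum_congr rfl fun i _ => ?_
    have hne := singDiff_ne_zero hs i
    have hp : ∏ α ∈ S, (x α - sing t i) ≠ 0 :=
      Finset.prod_ne_zero_iff.2 fun α hα => sub_ne_zero.2 (hxs α hα i)
    have hneg : ∏ α ∈ S, (sing t i - x α) = (-1) ^ (n + 1) * ∏ α ∈ S, (x α - sing t i) := by
      rw [← hS, ← Finset.prod_const, ← Finset.prod_mul_distrib]
      exact Finset.prod_congr rfl fun α _ => by ring
    rw [hneg, ← singDiff, boundaryWeight]
    rcases neg_one_pow_eq_or ℂ n with h | h <;>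
    · rw [pow_succ, h]
      field_simp
      rw [pow_succ, h]
      ring
  · rw [hS]
    exact (degree_le_of_natDegree_le natDegree_riccatiPoly_le).trans_lt
      (by simp; norm_cast; omega)
  · rw [hS, Finset.card_univ, Fintype.card_fin, ← coeff_riccatiPoly (t := t) hn hb hV]
    congr 1
    omega

/-- The functions `uⱼ`, completed by `1` at the singular point `0`. -/
def uExt {n : ℕ} (t : Fin n → ℂ) (x : Fin (2 * n + 1) → ℂ) : Fin (n + 2) → ℂ :=
  Fin.snoc (fun j => uVar t j x) 1

theorem singDiff_castSucc (j : Fin (n + 1)) : singDiff t j.castSucc =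
    node t j * ∏ l ∈ Finset.univ.erase j, (node t j - node t l) := by
  have : Finset.univ.erase j.castSucc =
      insert (Fin.last (n + 1)) ((Finset.univ.erase j).map Fin.castSuccEmb) := by
    ext i
    induction i using Fin.lastCases <;> simp [Fin.ext_iff, (Fin.is_lt _).ne, (Fin.is_lt _).ne']
  rw [singDiff, this, Finset.prod_insert (by simp), Finset.prod_map]
  simp [sing_castSucc, sing_last]

theorem singDiff_last : singDiff t (Fin.last (n + 1)) = ∏ j, (0 - node t j) := by
  have : Finset.univ.erase (Fin.last (n + 1)) = Finset.univ.map Fin.castSuccEmb := by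
    ext i
    induction i using Fin.lastCases <;> simp [Fin.ext_iff, (Fin.is_lt _).ne]
  rw [singDiff, this, Finset.prod_map]
  simp [sing_castSucc, sing_last]

/-- The normalization of the u_j makes all of them, and the added value 1 at the point 0, one common
factor times ∏ (x_α - τ_i) / P'(τ_i)². -/
theorem uExt_eq (hs : Function.Injective (sing t)) {x : Fin (2 * n + 1) → ℂ} (hx : ∀ α, x α ≠ 0)
    (i : Fin (n + 2)) : uExt t x i =
      (∏ l, node t l ^ 2) / (∏ α, x α) * ((∏ α, (x α - sing t i)) / singDiff t i ^ 2) := by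
  have hX : ∏ α, x α ≠ 0 := Finset.prod_ne_zero_iff.2 fun α _ => hx α
  have hd := singDiff_ne_zero hs i
  induction i using Fin.lastCases with
  | last =>
    rw [singDiff_last] at hd ⊢
    simp only [uExt, Fin.snoc_last, sing_last, sub_zero]
    rw [← Finset.prod_pow] at *
    simp only [zero_sub, neg_sq]
    have hp : ∏ l, node t l ^ 2 ≠ 0 := by
      rw [Finset.prod_pow]
      refine pow_ne_zero 2 fun h => hd ?_
      simp [Finset.prod_neg, h]
    field_simp
  | cast j =>
    rw [singDiff_castSucc] at hd ⊢
    simp only [uExt, Fin.snoc_castSucc, sing_castSucc, uVar]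
    rw [← Finset.mul_prod_erase _ _ (Finset.mem_univ j), Finset.prod_pow _ _ fun l =>
      node t j - node t l]
    have h1 := left_ne_zero_of_mul hd
    have h2 := right_ne_zero_of_mul hd
    field_simp

/-- After cancellation of the variables in `S`, this is a multiple of the divided difference, over
the n+2 singular points, of the polynomial ∏ (x_α - X) over the n remaining variables, whose degree
is too small. The number 2n+1 of variables enters here. -/
theorem sum_uExt_mul_boundaryWeight (hs : Function.Injective (sing t)) {x : Fin (2 * n + 1) → ℂ}
    (hx : ∀ α, x α ≠ 0) (S : Finset (Fin (2 * n + 1))) (hS : S.card = n + 1)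
    (hxs : ∀ α ∈ S, ∀ i, x α ≠ sing t i) : ∑ i, uExt t x i * boundaryWeight t S x i = 0 := by
  have hcard : (Finset.univ \ S).card = n := by
    rw [Finset.card_sdiff_of_subset (Finset.subset_univ _), hS, Finset.card_univ, Fintype.card_fin]
    omega
  let f : ℂ[X] := ∏ α ∈ Finset.univ \ S, (C (x α) - Polynomial.X)
  have hf : f.natDegree ≤ n := by
    refine (natDegree_prod_le _ _).trans ((Finset.sum_le_card_nsmul _ _ 1 fun α _ => ?_).trans
      (by simp [hcard]))
    compute_degree
  have hdeg : f.degree < (Finset.univ : Finset (Fin (n + 2))).card :=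
    (degree_le_of_natDegree_le hf).trans_lt (by simp; norm_cast; omega)
  have key := coeff_eq_sum (s := Finset.univ) (v := sing t) hs.injOn hdeg
  rw [coeff_eq_zero_of_natDegree_lt (by simp; omega)] at key
  rw [← mul_zero ((∏ l, node t l ^ 2) / (∏ α, x α)), key, Finset.mul_sum]
  refine Finset.sum_congr rfl fun i _ => ?_
  have hp : ∏ α ∈ S, (x α - sing t i) ≠ 0 :=
    Finset.prod_ne_zero_iff.2 fun α hα => sub_ne_zero.2 (hxs α hα i)
  have hd := singDiff_ne_zero hs i
  have heval : f.eval (sing t i) = ∏ α ∈ Finset.univ \ S, (x α - sing t i) := by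
    simp [f, eval_prod]
  rw [uExt_eq hs hx, boundaryWeight, heval, ← singDiff,
    ← Finset.prod_sdiff (f := fun α => x α - sing t i) (Finset.subset_univ S)]
  field_simp

end Interpolation

/-! ### Logarithmic derivatives of the integrand -/

section LogDeriv

variable {n : ℕ} {t : Fin n → ℂ} {s : ℂ} {k : Fin (n + 2) → ℂ} {p : VarSpace n}

theorem fderiv_single_left {f : VarSpace n → ℂ} (hf : DifferentiableAt ℂ f p)
    {α : Fin (2 * n + 1)} {d : ℂ}
    (h : HasDerivAt (fun z => f (Function.update p.1 α z, p.2)) d (p.1 α)) :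
    fderiv ℂ f p (Pi.single α 1, 0) = d := by
  have h1 : HasDerivAt (fun z => (Function.update p.1 α z, p.2)) (Pi.single α (1 : ℂ), 0)
      (p.1 α) := (hasDerivAt_update p.1 α (p.1 α)).prodMk (hasDerivAt_const _ _)
  have h2 : HasFDerivAt f (fderiv ℂ f p) (Function.update p.1 α (p.1 α), p.2) := by
    rw [Function.update_eq_self]
    exact hf.hasFDerivAt
  exact (h2.comp_hasDerivAt (p.1 α) h1).unique h

theorem fderiv_single_right {f : VarSpace n → ℂ} (hf : DifferentiableAt ℂ f p)
    {j : Fin (n + 1)} {d : ℂ}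
    (h : HasDerivAt (fun z => f (p.1, Function.update p.2 j z)) d (p.2 j)) :
    fderiv ℂ f p (0, Pi.single j 1) = d := by
  have h1 : HasDerivAt (fun z => (p.1, Function.update p.2 j z)) (0, Pi.single j (1 : ℂ))
      (p.2 j) := (hasDerivAt_const _ _).prodMk (hasDerivAt_update p.2 j (p.2 j))
  have h2 : HasFDerivAt f (fderiv ℂ f p) (p.1, Function.update p.2 j (p.2 j)) := by
    rw [Function.update_eq_self]
    exact hf.hasFDerivAt
  exact (h2.comp_hasDerivAt (p.2 j) h1).unique h

theorem ne_sing_of_mem_regularSet (hp : p ∈ regularSet t) (α : Fin (2 * n + 1)) (i : Fin (n + 2)) :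
    p.1 α ≠ sing t i := by
  induction i using Fin.lastCases with
  | last => rw [sing_last]; exact hp (.inl α)
  | cast j =>
    rw [sing_castSucc]
    intro h
    refine hp (.inr (.inl j)) ?_
    change uVar t j p.1 = 0
    rw [uVar, Finset.prod_eq_zero (Finset.mem_univ α) (sub_eq_zero.2 h), zero_mul, zero_div]

theorem hasDerivAt_uVar {x : Fin (2 * n + 1) → ℂ} {α : Fin (2 * n + 1)} {j : Fin (n + 1)}
    (h0 : ∀ β, x β ≠ 0) (h1 : x α ≠ node t j) :
    HasDerivAt (fun z => uVar t j (Function.update x α z))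
      (uVar t j x * ((x α - node t j)⁻¹ - (x α)⁻¹)) (x α) := by
  have hprod (c z : ℂ) : ∏ β, (Function.update x α z β - c) =
      (z - c) * ∏ β ∈ Finset.univ.erase α, (x β - c) := by
    rw [← Finset.mul_prod_erase _ _ (Finset.mem_univ α), Function.update_self]
    congr 1
    exact Finset.prod_congr rfl fun β hβ => by
      rw [Function.update_of_ne (Finset.ne_of_mem_erase hβ)]
  have hprod0 (z : ℂ) : ∏ β, Function.update x α z β =
      z * ∏ β ∈ Finset.univ.erase α, x β := by simpa using hprod 0 z
  have hx (c : ℂ) := hprod c (x α)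
  have hx0 := hprod0 (x α)
  simp only [Function.update_eq_self] at hx hx0
  unfold uVar
  simp only [hprod, hprod0, hx, hx0]
  have hne : ∏ β ∈ Finset.univ.erase α, x β ≠ 0 := Finset.prod_ne_zero_iff.2 fun β _ => h0 β
  have h1' := sub_ne_zero.2 h1
  have ha := h0 α
  have hd := ((((hasDerivAt_id (x α)).sub_const (node t j)).mul_const
    (∏ β ∈ Finset.univ.erase α, (x β - node t j))).div
    ((hasDerivAt_id (x α)).mul_const (∏ β ∈ Finset.univ.erase α, x β))
    (mul_ne_zero ha hne)).mul_const ((∏ l ∈ Finset.univ.erase j, node t l ^ 2) /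
      ∏ l ∈ Finset.univ.erase j, (node t j - node t l) ^ 2)
  simp_rw [mul_div_mul_comm _ (∏ l ∈ Finset.univ.erase j, node t l ^ 2)]
  convert! hd using 1
  simp only [id]
  field_simp

/-- The summands `uⱼ / qⱼ` and `1` of the last factor. -/
def vExt (t : Fin n → ℂ) (p : VarSpace n) : Fin (n + 2) → ℂ :=
  Fin.snoc (fun j => uVar t j p.1 / p.2 j) 1

/-- The summands of the last factor, normalized to have sum `1`. -/
def vFrac (t : Fin n → ℂ) (p : VarSpace n) (i : Fin (n + 2)) : ℂ :=
  vExt t p i / ∑ l, vExt t p l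

theorem sum_vExt (t : Fin n → ℂ) (p : VarSpace n) :
    ∑ i, vExt t p i = 1 + ∑ j, uVar t j p.1 / p.2 j := by
  rw [Fin.sum_univ_castSucc, add_comm]
  simp [vExt]

theorem sum_vExt_ne_zero (hp : p ∈ regularSet t) : ∑ i, vExt t p i ≠ 0 := by
  rw [sum_vExt]
  exact hp (.inr (.inr (.inr (.inr ()))))

theorem sum_vFrac (hp : p ∈ regularSet t) : ∑ i, vFrac t p i = 1 := by
  simp only [vFrac]
  rw [← Finset.sum_div, div_self (sum_vExt_ne_zero hp)]

theorem hasDerivAt_vExt (hp : p ∈ regularSet t) (α : Fin (2 * n + 1)) (i : Fin (n + 2)) :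
    HasDerivAt (fun z => vExt t (Function.update p.1 α z, p.2) i)
      (vExt t p i * ((p.1 α - sing t i)⁻¹ - (p.1 α)⁻¹)) (p.1 α) := by
  have h := ne_sing_of_mem_regularSet hp α i
  induction i using Fin.lastCases with
  | last => simpa [vExt, sing_last] using hasDerivAt_const (p.1 α) (1 : ℂ)
  | cast j =>
    rw [sing_castSucc] at h
    simpa [vExt, sing_castSucc, div_mul_eq_mul_div] using
      (hasDerivAt_uVar (x := p.1) (fun β => hp (.inl β)) h).div_const (p.2 j)

/-- The logarithmic derivative of v_i is 1/(x_α - τ_i) - 1/x_α, and the common term -1/x_α drops out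
of the quotient. -/
theorem hasDerivAt_vFrac (hp : p ∈ regularSet t) (α : Fin (2 * n + 1)) (i : Fin (n + 2)) :
    HasDerivAt (fun z => vFrac t (Function.update p.1 α z, p.2) i)
      (vFrac t p i * ((p.1 α - sing t i)⁻¹ - ∑ l, vFrac t p l * (p.1 α - sing t l)⁻¹))
      (p.1 α) := by
  have hB := sum_vExt_ne_zero hp
  have h := (hasDerivAt_vExt hp α i).div (HasDerivAt.fun_sum fun l _ => hasDerivAt_vExt hp α l)
    (by simpa using hB)
  simp only [Function.update_eq_self, Prod.mk.eta] at h
  convert! h using 1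
  simp only [vFrac, div_mul_eq_mul_div, mul_sub, Finset.sum_sub_distrib, ← Finset.sum_mul,
    ← Finset.sum_div]
  field_simp
  ring

theorem hasDerivAt_last_factor (hp : p ∈ regularSet t) (α : Fin (2 * n + 1)) :
    HasDerivAt (fun z => factor t (.inr (.inr (.inr (.inr ())))) (Function.update p.1 α z, p.2))
      (∑ i, vExt t p i * ((p.1 α - sing t i)⁻¹ - (p.1 α)⁻¹)) (p.1 α) := by
  have h := HasDerivAt.fun_sum (u := Finset.univ) fun l _ => hasDerivAt_vExt hp α l
  simpa [sum_vExt, factor] using h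

theorem logDeriv_apply (v : VarSpace n) : logDeriv t s k p v =
    ∑ e, exponent s k e * ((factor t e p)⁻¹ * fderiv ℂ (factor t e) p v) := by
  simp [logDeriv]

/-- The extra terms 1/x_α come with coefficient s from the power of x_α, Σ k_i from the powers of
the u_j and -b from the last factor, and they add up to zero. -/
theorem logDeriv_left (hp : p ∈ regularSet t) (α : Fin (2 * n + 1)) :
    logDeriv t s k p (Pi.single α 1, 0) =
      ∑ i, ((s + ∑ l, k l) * vFrac t p i - k i) / (p.1 α - sing t i) := by
  have hd (e) := differentiableAt_factor (t := t) (regularSet_subset t hp) e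
  have h1 (β) : fderiv ℂ (factor t (.inl β)) p (Pi.single α 1, 0) =
      (Pi.single α 1 : Fin (2 * n + 1) → ℂ) β :=
    fderiv_single_left (hd _) ((hasDerivAt_pi.1 (hasDerivAt_update p.1 α (p.1 α))) β)
  have h2 (j) : fderiv ℂ (factor t (.inr (.inl j))) p (Pi.single α 1, 0) = _ :=
    fderiv_single_left (hd _) (hasDerivAt_uVar (fun β => hp (.inl β))
      (sing_castSucc t j ▸ ne_sing_of_mem_regularSet hp α j.castSucc))
  have h3 (j) : fderiv ℂ (factor t (.inr (.inr (.inl j)))) p (Pi.single α 1, 0) = 0 :=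
    fderiv_single_left (hd _) (hasDerivAt_const _ (p.2 j))
  have h4 : fderiv ℂ (factor t (.inr (.inr (.inr (.inl ()))))) p (Pi.single α 1, 0) = 0 :=
    fderiv_single_left (hd _) (hasDerivAt_const _ (1 + ∑ j, p.2 j))
  have h5 : fderiv ℂ (factor t (.inr (.inr (.inr (.inr ()))))) p (Pi.single α 1, 0) = _ :=
    fderiv_single_left (hd _) (hasDerivAt_last_factor hp α)
  have f1 : factor t (.inl α) p = p.1 α := rfl
  have f2 (j) : factor t (.inr (.inl j)) p = uVar t j p.1 := rfl
  have f5 : factor t (.inr (.inr (.inr (.inr ())))) p = ∑ i, vExt t p i := (sum_vExt t p).symm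
  have hB := sum_vExt_ne_zero hp
  have hu (j) : uVar t j p.1 ≠ 0 := hp (.inr (.inl j))
  rw [logDeriv_apply]
  simp only [Fintype.sum_sum_type, h1, h2, h3, h4, h5, Finset.univ_unique, Finset.sum_singleton,
    exponent, Sum.elim_inl, Sum.elim_inr, mul_zero, Finset.sum_const_zero, zero_add, f2, f5]
  have e1 : ∑ β, s * ((factor t (.inl β) p)⁻¹ * (Pi.single α 1 : Fin (2 * n + 1) → ℂ) β) =
      s * (p.1 α)⁻¹ := by
    rw [Finset.sum_eq_single α]
    · simp [f1]
    · intro β _ hβ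
      simp [hβ]
    · simp
  have e2 : ∑ j : Fin (n + 1), -k j.castSucc * ((uVar t j p.1)⁻¹ *
        (uVar t j p.1 * ((p.1 α - node t j)⁻¹ - (p.1 α)⁻¹))) =
      -∑ i, k i * ((p.1 α - sing t i)⁻¹ - (p.1 α)⁻¹) := by
    rw [Fin.sum_univ_castSucc (n := n + 1), sing_last, sub_zero, sub_self, mul_zero, add_zero,
      ← Finset.sum_neg_distrib]
    refine Finset.sum_congr rfl fun j _ => ?_
    rw [inv_mul_cancel_left₀ (hu j), sing_castSucc, neg_mul]
  have e3 : (∑ i, vExt t p i)⁻¹ * ∑ i, vExt t p i * ((p.1 α - sing t i)⁻¹ - (p.1 α)⁻¹) =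
      ∑ i, vFrac t p i * (p.1 α - sing t i)⁻¹ - (p.1 α)⁻¹ := by
    simp only [mul_sub, Finset.sum_sub_distrib, ← Finset.sum_mul, vFrac, div_mul_eq_mul_div,
      ← Finset.sum_div]
    field_simp
  rw [e1, e2, e3]
  simp only [div_eq_mul_inv, sub_mul, mul_sub, Finset.sum_sub_distrib, ← Finset.sum_mul, mul_assoc,
    ← Finset.mul_sum]
  ring

theorem hasDerivAt_last_factor_right (hp : p ∈ regularSet t) (j : Fin (n + 1)) :
    HasDerivAt (fun z => factor t (.inr (.inr (.inr (.inr ())))) (p.1, Function.update p.2 j z))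
      (-(uVar t j p.1 / p.2 j ^ 2)) (p.2 j) := by
  have hupd (l) : HasDerivAt (fun z => Function.update p.2 j z l)
      ((Pi.single j 1 : Fin (n + 1) → ℂ) l) (p.2 j) :=
    (hasDerivAt_pi.1 (hasDerivAt_update p.2 j (p.2 j))) l
  have := (HasDerivAt.fun_sum (u := Finset.univ) fun l _ =>
    (hasDerivAt_const (p.2 j) (uVar t l p.1)).div (hupd l)
      (by simpa using! hp (.inr (.inr (.inl l))))).const_add 1
  convert! this using 1
  rw [Finset.sum_eq_single j]
  · simp [neg_div]
  · intro l _ hl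
    simp [hl]
  · simp

theorem logDeriv_right (hp : p ∈ regularSet t) (j : Fin (n + 1)) :
    logDeriv t s k p (0, Pi.single j 1) =
      (2 * k j.castSucc - 1) / p.2 j + (s - ∑ l, k l) / (1 + ∑ l, p.2 l) -
        (s + ∑ l, k l) / (∑ i, vExt t p i) * (uVar t j p.1 / p.2 j ^ 2) := by
  have hd (e) := differentiableAt_factor (t := t) (regularSet_subset t hp) e
  have hupd (l) : HasDerivAt (fun z => Function.update p.2 j z l)
      ((Pi.single j 1 : Fin (n + 1) → ℂ) l) (p.2 j) :=
    (hasDerivAt_pi.1 (hasDerivAt_update p.2 j (p.2 j))) l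
  have h1 (β) : fderiv ℂ (factor t (.inl β)) p (0, Pi.single j 1) = 0 :=
    fderiv_single_right (hd _) (hasDerivAt_const _ (p.1 β))
  have h2 (l) : fderiv ℂ (factor t (.inr (.inl l))) p (0, Pi.single j 1) = 0 :=
    fderiv_single_right (hd _) (hasDerivAt_const _ (uVar t l p.1))
  have h3 (l) : fderiv ℂ (factor t (.inr (.inr (.inl l)))) p (0, Pi.single j 1) =
      (Pi.single j 1 : Fin (n + 1) → ℂ) l :=
    fderiv_single_right (hd _) (hupd l)
  have h4 : fderiv ℂ (factor t (.inr (.inr (.inr (.inl ()))))) p (0, Pi.single j 1) = 1 := by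
    refine fderiv_single_right (hd _) ?_
    simpa [factor] using (HasDerivAt.fun_sum (u := Finset.univ) fun l _ => hupd l).const_add 1
  have h5 : fderiv ℂ (factor t (.inr (.inr (.inr (.inr ()))))) p (0, Pi.single j 1) = _ :=
    fderiv_single_right (hd _) (hasDerivAt_last_factor_right hp j)
  have f3 (l) : factor t (.inr (.inr (.inl l))) p = p.2 l := rfl
  have f4 : factor t (.inr (.inr (.inr (.inl ())))) p = 1 + ∑ l, p.2 l := rfl
  have f5 : factor t (.inr (.inr (.inr (.inr ())))) p = ∑ i, vExt t p i := (sum_vExt t p).symm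
  rw [logDeriv_apply]
  simp only [Fintype.sum_sum_type, h1, h2, h3, h4, h5, Finset.univ_unique, Finset.sum_singleton,
    exponent, Sum.elim_inl, Sum.elim_inr, mul_zero, Finset.sum_const_zero, zero_add, f3, f4, f5]
  rw [Finset.sum_eq_single j]
  · simp only [Pi.single_eq_same]
    ring
  · intro l _ hl
    simp [hl]
  · simp

end LogDeriv

/-! ### The operators and the divergence on the integrand -/

section Integrand

open Filter Topology

variable {n : ℕ} {t : Fin n → ℂ} {s : ℂ} {k : Fin (n + 2) → ℂ} {p : VarSpace n}

/-- The derivative along `x_α`, conjugated by the integrand. -/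
def leftDeriv (t : Fin n → ℂ) (s : ℂ) (k : Fin (n + 2) → ℂ) (α : Fin (2 * n + 1))
    (h : VarSpace n → ℂ) (p : VarSpace n) : ℂ :=
  logDeriv t s k p (Pi.single α 1, 0) * h p + fderiv ℂ h p (Pi.single α 1, 0)

/-- `P(x_α)` times the logarithmic derivative of the integrand along `x_α`. -/
def scaledLogDeriv (t : Fin n → ℂ) (s : ℂ) (k : Fin (n + 2) → ℂ) (α : Fin (2 * n + 1))
    (p : VarSpace n) : ℂ := polyP t (p.1 α) * logDeriv t s k p (Pi.single α 1, 0)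

theorem contDiffOn_logDeriv_apply (v : VarSpace n) :
    ContDiffOn ℂ ∞ (fun p => logDeriv t s k p v) (regularSet t) :=
  (contDiffOn_logDeriv t s k).clm_apply contDiffOn_const

theorem contDiffOn_leftDeriv {h : VarSpace n → ℂ} (hh : ContDiffOn ℂ ∞ h (regularSet t))
    (α : Fin (2 * n + 1)) : ContDiffOn ℂ ∞ (leftDeriv t s k α h) (regularSet t) :=
  ((contDiffOn_logDeriv_apply _).mul hh).add
    ((hh.fderiv_of_isOpen (isOpen_regularSet t) (by simp)).clm_apply contDiffOn_const)

theorem contDiffOn_scaledLogDeriv (α : Fin (2 * n + 1)) :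
    ContDiffOn ℂ ∞ (scaledLogDeriv t s k α) (regularSet t) := by
  refine ContDiffOn.mul (ContDiff.contDiffOn ?_) (contDiffOn_logDeriv_apply _)
  unfold polyP
  exact contDiff_prod fun i _ => by fun_prop

theorem polyP_ne_zero (hp : p ∈ regularSet t) (α : Fin (2 * n + 1)) : polyP t (p.1 α) ≠ 0 :=
  Finset.prod_ne_zero_iff.2 fun i _ => sub_ne_zero.2 (ne_sing_of_mem_regularSet hp α i)

theorem scaledLogDeriv_eq_eval (hp : p ∈ regularSet t) (α : Fin (2 * n + 1)) :
    scaledLogDeriv t s k α p =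
      (partialFrac t (fun i => (s + ∑ l, k l) * vFrac t p i - k i)).eval (p.1 α) := by
  rw [scaledLogDeriv, logDeriv_left hp, eval_partialFrac _ _ (ne_sing_of_mem_regularSet hp α)]

open Polynomial in
-- The polynomial depends on x_α both through its argument and through its coefficients V_i; the two
-- sums are these two contributions.
theorem fderiv_scaledLogDeriv (hp : p ∈ regularSet t) (α : Fin (2 * n + 1)) :
    fderiv ℂ (scaledLogDeriv t s k α) p (Pi.single α 1, 0) =
      ∑ i, ((s + ∑ l, k l) * (vFrac t p i * ((p.1 α - sing t i)⁻¹ -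
        ∑ l, vFrac t p l * (p.1 α - sing t l)⁻¹))) *
        (Lagrange.nodal (Finset.univ.erase i) (sing t)).eval (p.1 α) +
      (derivative (partialFrac t
        (fun i => (s + ∑ l, k l) * vFrac t p i - k i))).eval (p.1 α) := by
  have hnhds := (isOpen_regularSet t).mem_nhds hp
  refine fderiv_single_left (((contDiffOn_scaledLogDeriv α).differentiableOn
    (by simp)).differentiableAt hnhds) ?_
  have hev : ∀ᶠ z in 𝓝 (p.1 α), (Function.update p.1 α z, p.2) ∈ regularSet t := by
    have hc : ContinuousAt (fun z => (Function.update p.1 α z, p.2)) (p.1 α) := by fun_prop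
    exact hc (by simpa using hnhds)
  have hmain : HasDerivAt (fun z => ∑ i, ((s + ∑ l, k l) *
      vFrac t (Function.update p.1 α z, p.2) i - k i) *
        (Lagrange.nodal (Finset.univ.erase i) (sing t)).eval z) _ (p.1 α) :=
    HasDerivAt.fun_sum fun i _ => (((hasDerivAt_vFrac hp α i).const_mul (s + ∑ l, k l)).sub_const
      (k i)).mul ((Lagrange.nodal (Finset.univ.erase i) (sing t)).hasDerivAt (p.1 α))
  have hmain' := hmain.congr_of_eventuallyEq (f₁ := fun z => scaledLogDeriv t s k α
    (Function.update p.1 α z, p.2)) (by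
      filter_upwards [hev] with z hz
      rw [scaledLogDeriv_eq_eval hz, partialFrac, eval_finsetSum]
      simp only [eval_mul, eval_C, Function.update_self])
  convert! hmain' using 1
  rw [Finset.sum_add_distrib]
  simp [partialFrac, eval_finsetSum]

/-- The effect of the operator `D` in the variable `x_α` on the integrand, divided by the
integrand. -/
def riccati (t : Fin n → ℂ) (s : ℂ) (k : Fin (n + 2) → ℂ) (α : Fin (2 * n + 1))
    (p : VarSpace n) : ℂ :=
  (riccatiPoly t s (s + ∑ l, k l) k (vFrac t p)).eval (p.1 α) / polyP t (p.1 α)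

/-- With K = e^φ and G = P φ', one has K⁻¹ ∂(P ∂K) = G' + G²/P, where G' is the total derivative.
Multiplying by P gives the numerator `riccatiPoly`. -/
theorem leftDeriv_scaledLogDeriv (hp : p ∈ regularSet t) (α : Fin (2 * n + 1)) :
    leftDeriv t s k α (scaledLogDeriv t s k α) p -
      (s * (s + n + 1) * p.1 α ^ n + ∑ i, k i ^ 2 * singDiff t i / (p.1 α - sing t i)) =
    riccati t s k α p := by
  have hne := ne_sing_of_mem_regularSet hp α
  have hP := polyP_ne_zero hp α
  have hb := scaledLogDeriv_eq_eval (s := s) (k := k) hp α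
  have hG : logDeriv t s k p (Pi.single α 1, 0) = scaledLogDeriv t s k α p / polyP t (p.1 α) := by
    rw [scaledLogDeriv, mul_div_cancel_left₀ _ hP]
  rw [leftDeriv, fderiv_scaledLogDeriv hp, riccati, riccatiPoly, hG, hb]
  simp only [Polynomial.eval_add, Polynomial.eval_sub, Polynomial.eval_mul, Polynomial.eval_pow,
    Polynomial.eval_C, Polynomial.eval_X, Polynomial.eval_finsetSum, eval_nodal_univ,
    fun i => eval_nodal_erase t i (hne i), eval_partialFrac t (vFrac t p) hne]
  generalize (partialFrac t fun i => (s + ∑ l, k l) * vFrac t p i - k i) = G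
  have e1 : ∑ i, ((s + ∑ l, k l) * (vFrac t p i * ((p.1 α - sing t i)⁻¹ -
      ∑ l, vFrac t p l * (p.1 α - sing t l)⁻¹))) * (polyP t (p.1 α) / (p.1 α - sing t i)) =
      (s + ∑ l, k l) * (polyP t (p.1 α) * ∑ i, vFrac t p i * ((p.1 α - sing t i)⁻¹) ^ 2 -
        polyP t (p.1 α) * (∑ i, vFrac t p i * (p.1 α - sing t i)⁻¹) ^ 2) := by
    rw [sq (∑ i, vFrac t p i * (p.1 α - sing t i)⁻¹)]
    generalize hE : ∑ i, vFrac t p i * (p.1 α - sing t i)⁻¹ = E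
    nth_rewrite 3 [← hE]
    simp only [Finset.mul_sum (s := Finset.univ), ← Finset.sum_sub_distrib]
    refine Finset.sum_congr rfl fun i _ => ?_
    ring
  have e2 : ∑ i, vFrac t p i * (polyP t (p.1 α) / (p.1 α - sing t i)) ^ 2 =
      polyP t (p.1 α) ^ 2 * ∑ i, vFrac t p i * ((p.1 α - sing t i)⁻¹) ^ 2 := by
    rw [Finset.mul_sum]
    exact Finset.sum_congr rfl fun i _ => by ring
  have e3 : ∑ i, k i ^ 2 * singDiff t i * (polyP t (p.1 α) / (p.1 α - sing t i)) =
      polyP t (p.1 α) * ∑ i, k i ^ 2 * singDiff t i / (p.1 α - sing t i) := by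
    rw [Finset.mul_sum]
    exact Finset.sum_congr rfl fun i _ => by ring
  rw [e1, e2, e3]
  simp only [← div_eq_mul_inv]
  field_simp
  ring

theorem continuousOn_riccati (α : Fin (2 * n + 1)) :
    ContinuousOn (riccati t s k α) (regularSet t) := by
  refine ContinuousOn.congr (f := fun p => leftDeriv t s k α (scaledLogDeriv t s k α) p -
      (s * (s + n + 1) * p.1 α ^ n + ∑ i, k i ^ 2 * singDiff t i / (p.1 α - sing t i)))
    ?_ fun p hp => (leftDeriv_scaledLogDeriv hp α).symm
  refine (contDiffOn_leftDeriv (contDiffOn_scaledLogDeriv α) α).continuousOn.sub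
    (ContinuousOn.add (by fun_prop) ?_)
  exact continuousOn_finsetSum _ fun i _ => ContinuousOn.div (by fun_prop) (by fun_prop)
    fun p hp => sub_ne_zero.2 (ne_sing_of_mem_regularSet hp α i)

/-- A vector field on the `q`-space whose twisted divergence is the effect of the operator `L` on
the integrand, up to a constant. -/
def boundaryField (t : Fin n → ℂ) (W : Fin (n + 2) → ℂ) (x : Fin (2 * n + 1) → ℂ)
    (q : Fin (n + 1) → ℂ) (j : Fin (n + 1)) : ℂ :=
  (W (Fin.last (n + 1)) * q j - W j.castSucc * uVar t j x) /
    factor t (.inr (.inr (.inr (.inr ())))) (x, q)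

theorem differentiableAt_boundaryField (hp : p ∈ regularSet t) (W : Fin (n + 2) → ℂ) :
    DifferentiableAt ℂ (boundaryField t W p.1) p.2 := by
  refine differentiableAt_pi.2 fun j => ?_
  have hB : DifferentiableAt ℂ
      (fun q => factor t (.inr (.inr (.inr (.inr ())))) (p.1, q)) p.2 :=
    DifferentiableAt.comp (g := factor t (.inr (.inr (.inr (.inr ()))))) p.2
      (differentiableAt_factor (regularSet_subset t hp) _)
      (hasFDerivAt_prodMk_right p.1 p.2).differentiableAt
  have hnum : DifferentiableAt ℂ (fun q : Fin (n + 1) → ℂ =>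
      W (Fin.last (n + 1)) * q j - W j.castSucc * uVar t j p.1) p.2 := by fun_prop
  have hne : factor t (.inr (.inr (.inr (.inr ())))) (p.1, p.2) ≠ 0 := hp _
  simp only [boundaryField, div_eq_mul_inv]
  exact hnum.fun_mul (hB.fun_inv hne)

theorem fderiv_boundaryField (hp : p ∈ regularSet t) (W : Fin (n + 2) → ℂ) (j : Fin (n + 1)) :
    fderiv ℂ (boundaryField t W p.1) p.2 (Pi.single j 1) j =
      (W (Fin.last (n + 1)) * (∑ i, vExt t p i) -
        (W (Fin.last (n + 1)) * p.2 j - W j.castSucc * uVar t j p.1) *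
          (-(uVar t j p.1 / p.2 j ^ 2))) / (∑ i, vExt t p i) ^ 2 := by
  have h1 : HasFDerivAt (boundaryField t W p.1) (fderiv ℂ (boundaryField t W p.1) p.2)
      (Function.update p.2 j (p.2 j)) := by
    rw [Function.update_eq_self]
    exact (differentiableAt_boundaryField hp W).hasFDerivAt
  have h2 := hasDerivAt_pi.1 (h1.comp_hasDerivAt (p.2 j) (hasDerivAt_update p.2 j (p.2 j))) j
  have h3 := (((hasDerivAt_id (p.2 j)).const_mul (W (Fin.last (n + 1)))).sub_const
    (W j.castSucc * uVar t j p.1)).div (hasDerivAt_last_factor_right hp j)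
    (by simpa using! hp (.inr (.inr (.inr (.inr ())))))
  have h4 := h2.unique (h3.congr_of_eventuallyEq (Eventually.of_forall fun z => by
    simp [boundaryField]))
  have f5 : factor t (.inr (.inr (.inr (.inr ())))) p = ∑ i, vExt t p i := (sum_vExt t p).symm
  simpa [f5] using! h4

/-- The factor (1 + Σ q_j)^(s - Σ k) contributes Σ_j (W_{n+2} q_j - W_j u_j) over 1 + Σ q_j. By the
hypothesis on `W` this numerator is W_{n+2} (1 + Σ q_j), so the pole disappears. -/
theorem divergence_boundaryField (hp : p ∈ regularSet t) {W : Fin (n + 2) → ℂ}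
    (hW : ∑ i, uExt t p.1 i * W i = 0) :
    ∑ j, (logDeriv t s k p (0, Pi.single j 1) * boundaryField t W p.1 p.2 j +
      fderiv ℂ (boundaryField t W p.1) p.2 (Pi.single j 1) j) =
    ∑ i, W i * ((s + ∑ l, k l - 1) * vFrac t p i ^ 2 + (1 - 2 * k i) * vFrac t p i) := by
  have hB := sum_vExt_ne_zero hp
  have hA : 1 + ∑ j, p.2 j ≠ 0 := hp (.inr (.inr (.inr (.inl ()))))
  have hq (j) : p.2 j ≠ 0 := hp (.inr (.inr (.inl j)))
  have f5 : factor t (.inr (.inr (.inr (.inr ())))) p = ∑ i, vExt t p i := (sum_vExt t p).symm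
  have hu : ∑ j, W j.castSucc * uVar t j p.1 = -W (Fin.last (n + 1)) := by
    rw [Fin.sum_univ_castSucc] at hW
    simp only [uExt, Fin.snoc_castSucc, Fin.snoc_last, one_mul] at hW
    rw [← add_eq_zero_iff_eq_neg, ← hW]
    simp only [mul_comm]
  have hv : ∑ j, uVar t j p.1 / p.2 j = ∑ i, vExt t p i - 1 := by rw [sum_vExt]; ring
  have hk : ∑ j : Fin (n + 1), k j.castSucc = ∑ i, k i - k (Fin.last (n + 1)) := by
    rw [Fin.sum_univ_castSucc (f := k)]; ring
  -- Each direction yields its own summand of the result plus a remainder; the remainders add up to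
  -- the summand of the last index.
  have hterm (j : Fin (n + 1)) :
      logDeriv t s k p (0, Pi.single j 1) * boundaryField t W p.1 p.2 j +
        fderiv ℂ (boundaryField t W p.1) p.2 (Pi.single j 1) j =
      W j.castSucc * ((s + ∑ l, k l - 1) * vFrac t p j.castSucc ^ 2 +
        (1 - 2 * k j.castSucc) * vFrac t p j.castSucc) +
      (2 * W (Fin.last (n + 1)) / (∑ i, vExt t p i) * k j.castSucc +
        (s - ∑ l, k l) / ((1 + ∑ l, p.2 l) * ∑ i, vExt t p i) *
          (W (Fin.last (n + 1)) * p.2 j - W j.castSucc * uVar t j p.1) -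
        (s + ∑ l, k l - 1) * W (Fin.last (n + 1)) / (∑ i, vExt t p i) ^ 2 *
          (uVar t j p.1 / p.2 j)) := by
    rw [logDeriv_right hp, fderiv_boundaryField hp, boundaryField, Prod.mk.eta, f5]
    have hV : vFrac t p j.castSucc = uVar t j p.1 / p.2 j / ∑ i, vExt t p i := by
      simp [vFrac, vExt]
    rw [hV]
    have := hq j
    generalize ∑ i, vExt t p i = B at *
    generalize ∑ l, k l = κ at *
    generalize 1 + ∑ l, p.2 l = A at *
    field_simp
    ring
  have hlast : vFrac t p (Fin.last (n + 1)) = 1 / ∑ i, vExt t p i := by simp [vFrac, vExt]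
  rw [Finset.sum_congr rfl fun j _ => hterm j, Finset.sum_add_distrib, Finset.sum_sub_distrib,
    Finset.sum_add_distrib, ← Finset.mul_sum, ← Finset.mul_sum, ← Finset.mul_sum,
    Finset.sum_sub_distrib, ← Finset.mul_sum, hu, hv, hk, Fin.sum_univ_castSucc (n := n + 1)
      (f := fun i => W i * _), hlast]
  congr 1
  generalize ∑ i, vExt t p i = B at *
  generalize ∑ l, k l = κ at *
  have hA' : ∑ j, p.2 j = (1 + ∑ j, p.2 j) - 1 := by ring
  generalize 1 + ∑ l, p.2 l = A at *
  rw [hA']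
  field_simp
  ring

end Integrand

/-! ### Integrals over twisted cycles -/

section Kernel

open MeasureTheory Filter Topology

variable {n : ℕ} {t : Fin n → ℂ} {s : ℂ} {k : Fin (n + 2) → ℂ} {U : Set (Fin (2 * n + 1) → ℂ)}

theorem continuous_jac {m : ℕ} {σ : (Fin m → ℝ) → (Fin m → ℂ)} (hσ : ContDiff ℝ ∞ σ) :
    Continuous (jac σ) :=
  Continuous.matrix_det (continuous_pi fun i => continuous_pi fun _ =>
    (continuous_apply i).comp ((hσ.continuous_fderiv (by simp)).clm_apply continuous_const))

/-- The integral of the integrand times `h` over a twisted cycle. -/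
def kernelInt (Γ : TwistedCycle t s k U) {F : Type} [NormedAddCommGroup F] [NormedSpace ℂ F]
    (h : VarSpace n → F) (x : Fin (2 * n + 1) → ℂ) : F :=
  ∑ a, paramIntegral (Γ.map a) (fun x τ => Γ.branch a x τ * jac (Γ.map a) τ) h x

variable (Γ : TwistedCycle t s k U)

theorem kernel_eq_kernelInt : kernel Γ = kernelInt Γ fun _ => (1 : ℂ) := by
  ext x
  simp [kernel, kernelInt, paramIntegral]

/-- The part of the logarithmic derivative in the direction of `x`. -/
def logDerivLeft (t : Fin n → ℂ) (s : ℂ) (k : Fin (n + 2) → ℂ) (p : VarSpace n) :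
    (Fin (2 * n + 1) → ℂ) →L[ℂ] ℂ :=
  (logDeriv t s k p).comp (ContinuousLinearMap.inl ℂ _ _)

theorem contDiffOn_logDerivLeft : ContDiffOn ℂ ∞ (logDerivLeft t s k) (regularSet t) :=
  (contDiffOn_logDeriv t s k).clm_comp contDiffOn_const

theorem continuousOn_density (a : Fin Γ.size) : ContinuousOn
    (Function.uncurry fun x τ => Γ.branch a x τ * jac (Γ.map a) τ) (U ×ˢ cube (n + 1)) :=
  (Γ.isBranch a).continuousOn.mul
    ((continuous_jac (Γ.smooth a)).comp continuous_snd).continuousOn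

theorem hasFDerivAt_density (hU : IsOpen U) (a : Fin Γ.size) {x : Fin (2 * n + 1) → ℂ}
    (hx : x ∈ U) {τ : Fin (n + 1) → ℝ} (hτ : τ ∈ cube (n + 1)) :
    HasFDerivAt (fun x => Γ.branch a x τ * jac (Γ.map a) τ)
      ((Γ.branch a x τ * jac (Γ.map a) τ) • logDerivLeft t s k (x, Γ.map a τ)) x := by
  convert! ((Γ.isBranch a).hasFDerivAt_left hU hx hτ).mul_const (jac (Γ.map a) τ) using 1
  ext v
  simp [logDerivLeft]
  ring

theorem continuousOn_integrand {F : Type} [NormedAddCommGroup F] [NormedSpace ℂ F]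
    {h : VarSpace n → F} (hh : ContinuousOn h (regularSet t)) (a : Fin Γ.size)
    {x : Fin (2 * n + 1) → ℂ} (hx : x ∈ U) :
    ContinuousOn (fun τ => (Γ.branch a x τ * jac (Γ.map a) τ) • h (x, Γ.map a τ))
      (cube (n + 1)) :=
  (continuousOn_slice (continuousOn_density Γ a) hx).smul
    (hh.comp (f := fun τ => (x, Γ.map a τ))
      (continuous_const.prodMk (Γ.smooth a).continuous).continuousOn
      fun _ hτ => (Γ.isBranch a).mem_regularSet hx hτ)

theorem contDiffOn_kernelInt (hU : IsOpen U) {F : Type} [NormedAddCommGroup F] [NormedSpace ℂ F]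
    {h : VarSpace n → F} (hh : ContDiffOn ℂ ∞ h (regularSet t)) :
    ContDiffOn ℂ ∞ (kernelInt Γ h) U :=
  ContDiffOn.sum fun a _ => contDiffOn_paramIntegral hU (isOpen_regularSet t)
    (Γ.smooth a).continuous.continuousOn (continuousOn_density Γ a)
    (fun _ hx _ hτ => (Γ.isBranch a).mem_regularSet hx hτ) contDiffOn_logDerivLeft
    (fun _ hx _ hτ => hasFDerivAt_density Γ hU a hx hτ) hh

theorem hasFDerivAt_kernelInt (hU : IsOpen U) {F : Type} [NormedAddCommGroup F]
    [NormedSpace ℂ F] {h : VarSpace n → F} (hh : ContDiffOn ℂ ∞ h (regularSet t))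
    {x : Fin (2 * n + 1) → ℂ} (hx : x ∈ U) :
    HasFDerivAt (kernelInt Γ h) (kernelInt Γ (twistedFDeriv (logDerivLeft t s k) h) x) x :=
  HasFDerivAt.fun_sum fun a _ => hasFDerivAt_paramIntegral hU (isOpen_regularSet t)
    (Γ.smooth a).continuous.continuousOn (continuousOn_density Γ a)
    (fun _ hx _ hτ => (Γ.isBranch a).mem_regularSet hx hτ) contDiffOn_logDerivLeft
    (fun _ hx _ hτ => hasFDerivAt_density Γ hU a hx hτ) hh hx

theorem kernelInt_apply {E F : Type} [NormedAddCommGroup E] [NormedSpace ℂ E]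
    [NormedAddCommGroup F] [NormedSpace ℂ F] [CompleteSpace F] {h : VarSpace n → E →L[ℂ] F}
    (hh : ContinuousOn h (regularSet t)) {x : Fin (2 * n + 1) → ℂ} (hx : x ∈ U) (v : E) :
    kernelInt Γ h x v = kernelInt Γ (fun p => h p v) x := by
  simp only [kernelInt, paramIntegral, sum_apply]
  refine Finset.sum_congr rfl fun a _ => ?_
  rw [ContinuousLinearMap.integral_apply
    ((continuousOn_integrand Γ hh a hx).integrableOn_compact (isCompact_cube _))]
  rfl

theorem kernelInt_congr {F : Type} [NormedAddCommGroup F] [NormedSpace ℂ F]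
    {h h' : VarSpace n → F} {x : Fin (2 * n + 1) → ℂ} (hx : x ∈ U)
    (hh : ∀ q, (x, q) ∈ regularSet t → h (x, q) = h' (x, q)) :
    kernelInt Γ h x = kernelInt Γ h' x := by
  refine Finset.sum_congr rfl fun a _ => setIntegral_congr_fun measurableSet_Icc fun τ hτ => ?_
  simp only
  rw [hh _ ((Γ.isBranch a).mem_regularSet hx hτ)]

theorem kernelInt_const_mul (c : ℂ) (h : VarSpace n → ℂ) (x : Fin (2 * n + 1) → ℂ) :
    kernelInt Γ (fun p => c * h p) x = c * kernelInt Γ h x := by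
  simp only [kernelInt, paramIntegral, Finset.mul_sum, ← integral_const_mul, smul_eq_mul]
  refine Finset.sum_congr rfl fun a _ => integral_congr_ae (Eventually.of_forall fun τ => ?_)
  simp only
  ring

theorem kernelInt_sum_mul {ι : Type*} (S : Finset ι) (c : ι → ℂ) {h : ι → VarSpace n → ℂ}
    (hh : ∀ i ∈ S, ContinuousOn (h i) (regularSet t)) {x : Fin (2 * n + 1) → ℂ} (hx : x ∈ U) :
    kernelInt Γ (fun p => ∑ i ∈ S, c i * h i p) x = ∑ i ∈ S, c i * kernelInt Γ (h i) x := by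
  simp only [← kernelInt_const_mul]
  simp only [kernelInt, paramIntegral, Finset.smul_sum]
  rw [Finset.sum_comm]
  refine Finset.sum_congr rfl fun a _ => integral_finsetSum _ fun i hi => ?_
  exact (continuousOn_integrand Γ (continuousOn_const.mul (hh i hi)) a hx).integrableOn_compact
    (isCompact_cube _)

theorem kernelInt_sub {h h' : VarSpace n → ℂ} (hh : ContinuousOn h (regularSet t))
    (hh' : ContinuousOn h' (regularSet t)) {x : Fin (2 * n + 1) → ℂ} (hx : x ∈ U) :
    kernelInt Γ (fun p => h p - h' p) x = kernelInt Γ h x - kernelInt Γ h' x := by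
  simp only [kernelInt, paramIntegral, smul_sub]
  rw [← Finset.sum_sub_distrib]
  refine Finset.sum_congr rfl fun a _ => integral_sub ?_ ?_
  · exact (continuousOn_integrand Γ hh a hx).integrableOn_compact (isCompact_cube _)
  · exact (continuousOn_integrand Γ hh' a hx).integrableOn_compact (isCompact_cube _)

/-! ### The differential equations for the kernel -/

theorem partialD_kernelInt (hU : IsOpen U) {h : VarSpace n → ℂ}
    (hh : ContDiffOn ℂ ∞ h (regularSet t)) {x : Fin (2 * n + 1) → ℂ} (hx : x ∈ U)
    (α : Fin (2 * n + 1)) :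
    partialD α (kernelInt Γ h) x = kernelInt Γ (leftDeriv t s k α h) x := by
  have h1 : HasFDerivAt (kernelInt Γ h) (kernelInt Γ (twistedFDeriv (logDerivLeft t s k) h) x)
      (Function.update x α (x α)) := by
    rw [Function.update_eq_self]
    exact hasFDerivAt_kernelInt Γ hU hh hx
  have h2 := (h1.comp_hasDerivAt (x α) (hasDerivAt_update x α (x α))).deriv
  rw [kernelInt_apply Γ (ContDiffOn.twistedFDeriv (isOpen_regularSet t) contDiffOn_logDerivLeft
    hh).continuousOn hx] at h2
  exact h2.trans (kernelInt_congr Γ hx fun q _ => by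
    simp [twistedFDeriv, leftDeriv, logDerivLeft])

theorem partialD_kernel (hU : IsOpen U) {x : Fin (2 * n + 1) → ℂ} (hx : x ∈ U)
    (α : Fin (2 * n + 1)) :
    partialD α (kernel Γ) x = kernelInt Γ (fun p => logDeriv t s k p (Pi.single α 1, 0)) x := by
  rw [kernel_eq_kernelInt, partialD_kernelInt Γ hU contDiffOn_const hx]
  exact kernelInt_congr Γ hx fun q _ => by simp [leftDeriv]

theorem polyP_mul_partialD_kernel (hU : IsOpen U) {x : Fin (2 * n + 1) → ℂ} (hx : x ∈ U)
    (α : Fin (2 * n + 1)) :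
    polyP t (x α) * partialD α (kernel Γ) x = kernelInt Γ (scaledLogDeriv t s k α) x := by
  rw [partialD_kernel Γ hU hx, ← kernelInt_const_mul]
  rfl

/-- Both derivatives pass under the integral. The outer one requires the formula for the inner one
on a neighbourhood of x_α along the coordinate line, which openness of `U` provides. -/
theorem opD_kernel (hU : IsOpen U) {x : Fin (2 * n + 1) → ℂ} (hx : x ∈ U)
    (α : Fin (2 * n + 1)) : opD t s k α (kernel Γ) x = kernelInt Γ (riccati t s k α) x := by
  have hev : ∀ᶠ z in 𝓝 (x α), Function.update x α z ∈ U := by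
    have hc : ContinuousAt (fun z => Function.update x α z) (x α) := by fun_prop
    exact hc (by simpa using hU.mem_nhds hx)
  have h1 : partialD α (fun y => polyP t (y α) * partialD α (kernel Γ) y) x =
      kernelInt Γ (leftDeriv t s k α (scaledLogDeriv t s k α)) x := by
    rw [← partialD_kernelInt Γ hU (contDiffOn_scaledLogDeriv α) hx]
    refine EventuallyEq.deriv_eq ?_
    filter_upwards [hev] with z hz using polyP_mul_partialD_kernel Γ hU hz α
  rw [opD, h1, kernel_eq_kernelInt, ← kernelInt_const_mul, ← kernelInt_sub Γ
    (contDiffOn_leftDeriv (contDiffOn_scaledLogDeriv α) α).continuousOn continuousOn_const hx]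
  refine kernelInt_congr Γ hx fun q hq => ?_
  rw [mul_one]
  exact leftDeriv_scaledLogDeriv hq α

/-- The equation already holds for the integrand at each q, so the boundary of the cycle plays no
role. -/
theorem opM_kernel_eq_zero (hU : IsOpen U) (T : Finset (Fin (2 * n + 1))) (hT : T.card = n + 2)
    {x : Fin (2 * n + 1) → ℂ} (hx : x ∈ U) (hinj : Set.InjOn x T) :
    opM t s T (kernel Γ) x = 0 := by
  have h1 : ∑ α ∈ T, (polyP t (x α) / ∏ β ∈ T.erase α, (x α - x β)) * partialD α (kernel Γ) x =
      kernelInt Γ (fun p => ∑ α ∈ T, (∏ β ∈ T.erase α, (x α - x β))⁻¹ *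
        scaledLogDeriv t s k α p) x := by
    rw [kernelInt_sum_mul Γ T _ (fun α _ => (contDiffOn_scaledLogDeriv α).continuousOn) hx]
    refine Finset.sum_congr rfl fun α _ => ?_
    rw [← polyP_mul_partialD_kernel Γ hU hx]
    ring
  have h2 : kernelInt Γ (fun p => ∑ α ∈ T, (∏ β ∈ T.erase α, (x α - x β))⁻¹ *
      scaledLogDeriv t s k α p) x = kernelInt Γ (fun _ => s * 1) x := by
    refine kernelInt_congr Γ hx fun q hq => ?_
    have hm : ∑ i, ((s + ∑ l, k l) * vFrac t (x, q) i - k i) = s := by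
      rw [Finset.sum_sub_distrib, ← Finset.mul_sum, sum_vFrac hq]
      ring
    rw [mul_one]
    refine Eq.trans ?_ ((sum_partialFrac_div (t := t) T hT hinj _).trans hm)
    exact Finset.sum_congr rfl fun α _ => by rw [scaledLogDeriv_eq_eval hq, div_eq_inv_mul]
  rw [opM, h1, h2, kernelInt_const_mul, kernel_eq_kernelInt, sub_self]

theorem kernelInt_divergence_eq_zero {x : Fin (2 * n + 1) → ℂ} (hx : x ∈ U)
    (W : Fin (n + 2) → ℂ)
    (hdiv : ContinuousOn (fun p : VarSpace n => ∑ j, (logDeriv t s k p (0, Pi.single j 1) *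
      boundaryField t W x p.2 j + fderiv ℂ (boundaryField t W x) p.2 (Pi.single j 1) j))
      ({p | p.1 = x} ∩ regularSet t)) :
    kernelInt Γ (fun p => ∑ j, (logDeriv t s k p (0, Pi.single j 1) *
      boundaryField t W x p.2 j +
        fderiv ℂ (boundaryField t W x) p.2 (Pi.single j 1) j)) x = 0 := by
  rw [← sum_integral_divergence_eq_zero Γ.map Γ.smooth (fun a => Γ.branch a x)
    (fun a => continuousOn_slice (Γ.isBranch a).continuousOn hx)
    (fun q => (logDeriv t s k (x, q)).comp (ContinuousLinearMap.inr ℂ _ _))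
    (fun a τ hτ => (Γ.isBranch a).hasFDerivAt_right (Γ.smooth a) hx hτ)
    (boundaryField t W x) (fderiv ℂ (boundaryField t W x))
    (fun a τ hτ => (differentiableAt_boundaryField ((Γ.isBranch a).mem_regularSet hx hτ)
      W).hasFDerivAt) (fun a => ?_) (fun c hc => Γ.closed c hc x hx)]
  · refine Finset.sum_congr rfl fun a _ => integral_congr_ae (Eventually.of_forall fun τ => ?_)
    simp
    ring
  · have := hdiv.comp (f := fun τ => (x, Γ.map a τ)) (s := cube (n + 1))
      (continuous_const.prodMk (Γ.smooth a).continuous).continuousOn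
      fun _ hτ => ⟨rfl, (Γ.isBranch a).mem_regularSet hx hτ⟩
    simpa [Function.comp_def] using this

/-- The integrand of L K_n is a constant times a twisted divergence, with the weights
`boundaryWeight` as coefficients of the field. -/
theorem opL_kernel_eq_zero (hn : 0 < n) (hs : Function.Injective (sing t)) (hU : IsOpen U)
    (S : Finset (Fin (2 * n + 1))) (hS : S.card = n + 1) {x : Fin (2 * n + 1) → ℂ} (hx : x ∈ U)
    (hinj : Set.InjOn x S) : opL t s k S (kernel Γ) x = 0 := by
  have h1 : opL t s k S (kernel Γ) x = kernelInt Γ (fun p => ∑ α ∈ S,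
      (∏ β ∈ S.erase α, (x α - x β))⁻¹ * riccati t s k α p) x := by
    rw [kernelInt_sum_mul Γ S _ (fun α _ => continuousOn_riccati α) hx]
    exact Finset.sum_congr rfl fun α _ => by rw [opD_kernel Γ hU hx]
  have hreg {q} (hq : (x, q) ∈ regularSet t) : ∑ α ∈ S,
      (∏ β ∈ S.erase α, (x α - x β))⁻¹ * riccati t s k α (x, q) =
      (-1) ^ n * (s + ∑ l, k l) * ∑ j, (logDeriv t s k (x, q) (0, Pi.single j 1) *
        boundaryField t (boundaryWeight t S x) x q j +
        fderiv ℂ (boundaryField t (boundaryWeight t S x) x) q (Pi.single j 1) j) := by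
    have hne := ne_sing_of_mem_regularSet hq
    have h2 := divergence_boundaryField (s := s) (k := k) hq
      (sum_uExt_mul_boundaryWeight hs (x := x) (fun α => hq (.inl α)) S hS fun α _ i => hne α i)
    have h3 := sum_riccatiPoly_div (k := k) hn hs S hS hinj (fun α _ i => hne α i) rfl
      (sum_vFrac hq) (s := s)
    simp only at h2 h3
    rw [h2, mul_assoc, Finset.mul_sum (a := s + ∑ l, k l)]
    refine (Eq.trans ?_ h3).trans ?_
    · exact Finset.sum_congr rfl fun α _ => by rw [riccati]; field_simp
    · congr 1
      exact Finset.sum_congr rfl fun i _ => by ring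
  rw [h1]
  -- For b = 0 the integrand is identically zero. Otherwise division by b transfers the continuity
  -- of the Riccati terms to the divergence, as Stokes' theorem requires.
  rcases eq_or_ne (s + ∑ l, k l) 0 with hb | hb
  · rw [kernelInt_congr Γ hx (h' := fun _ => 0 * 0) fun q hq => by rw [hreg hq, hb]; ring,
      kernelInt_const_mul, zero_mul]
  have hc : (-1 : ℂ) ^ n * (s + ∑ l, k l) ≠ 0 := mul_ne_zero (by simp) hb
  rw [kernelInt_congr Γ hx (h' := fun p => (-1) ^ n * (s + ∑ l, k l) *
      ∑ j, (logDeriv t s k p (0, Pi.single j 1) *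
        boundaryField t (boundaryWeight t S x) x p.2 j +
        fderiv ℂ (boundaryField t (boundaryWeight t S x) x) p.2 (Pi.single j 1) j))
      fun q hq => hreg hq, kernelInt_const_mul, kernelInt_divergence_eq_zero Γ hx, mul_zero]
  refine ContinuousOn.congr (f := fun p => ((-1) ^ n * (s + ∑ l, k l))⁻¹ * ∑ α ∈ S,
      (∏ β ∈ S.erase α, (x α - x β))⁻¹ * riccati t s k α p) ?_ ?_
  · exact ((continuousOn_const.mul (continuousOn_finsetSum _ fun α _ =>
      continuousOn_const.mul (continuousOn_riccati α)))).mono Set.inter_subset_right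
  · rintro ⟨y, q⟩ ⟨rfl, hq⟩
    simp only
    rw [hreg hq, inv_mul_cancel_left₀ hc]

end Kernel

end EulerKernel

end

theorem theorem3p4p1 (n : ℕ) (hn : 1 < n) (t : Fin n → ℂ) (ht : Function.Injective t)
    (ht0 : ∀ i, t i ≠ 0) (ht1 : ∀ i, t i ≠ 1) (s : ℂ) (k : Fin (n + 2) → ℂ) :
    EulerKernel.IsHolonomic (EulerKernel.systemIdeal t s k) ∧
    ∀ U : Set (Fin (2 * n + 1) → ℂ), IsOpen U →
      ∀ Γ : EulerKernel.TwistedCycle t s k U,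
        ContDiffOn ℂ ∞ (EulerKernel.kernel Γ) U ∧
        (∀ S : Finset (Fin (2 * n + 1)), S.card = n + 1 →
          ∀ x ∈ U, Set.InjOn x S →
            EulerKernel.opL t s k S (EulerKernel.kernel Γ) x = 0) ∧
        (∀ T : Finset (Fin (2 * n + 1)), T.card = n + 2 →
          ∀ x ∈ U, Set.InjOn x T →
            EulerKernel.opM t s T (EulerKernel.kernel Γ) x = 0) := by
  refine ⟨EulerKernel.isHolonomic_systemIdeal ht ht0 ht1 s k, fun U hU Γ => ⟨?_, ?_, ?_⟩⟩
  · rw [EulerKernel.kernel_eq_kernelInt]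
    exact EulerKernel.contDiffOn_kernelInt Γ hU contDiffOn_const
  · exact fun S hS x hx hinj => EulerKernel.opL_kernel_eq_zero Γ (by omega)
      (EulerKernel.sing_injective ht ht0 ht1) hU S hS hx hinj
  · exact fun T hT x hx hinj => EulerKernel.opM_kernel_eq_zero Γ hU T hT hx hinj
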